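/- **Setting.** Let $\Sigma=\{P_1,\dots,P_s\}$ be a system of real analytic functions, each defined on a connected open domain and depending on finitely many of the coordinates $t$, $x_j^{(k)}$ ($1\le j\le n$, $k\in\mathbb N$) of the jet space $\mathbf J(\mathbb R,\mathbb R^n)$, and let $\eta$ be a point at which all $P_i$ are defined. The order matrix is $A_\Sigma=(a_{i,j})$, where $a_{i,j}=\operatorname{ord}_{x_j}P_i$ is the largest $k$ such that $x_j^{(k)}$ occurs in $P_i$, and $-\infty$ if there is none. For a set $Y$ of $s$ variables, $\mathcal O_{Y,\Sigma}=\max_\sigma\sum_i a_{i,\sigma(i)}$ over the bijections $\sigma$ from $\{1,\dots,s\}$ to $Y$; the saddle Jacobi number $\hat{\mathcal O}_\Sigma$ is the least $\mathcal O_{Y,\Sigma}\ne-\infty$ ($-\infty$ if there is none). A canon of a square matrix $(a_{i,j})$ is a vector $\ell\in\mathbb N^s$ such that $(a_{i,j}+\ell_i)$ has $s$ transversal entries (in distinct rows and columns) each maximal in its column. With $\lambda$ the minimal canon of the submatrix of $A_\Sigma$ with columns $Y$, put $\alpha_i=\max_k\lambda_k-\lambda_i$, $\beta_j=\max_i(a_{i,j}-\alpha_i)$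 and $\nabla_{Y,\Sigma}=\det(\partial P_i/\partial x_j^{(\alpha_i+\beta_j)})_{1\le i\le s,\ x_j\in Y}$. The system is *ō-regular at $\eta$* if $\hat{\mathcal O}_\Sigma=0$ and there is $Y$ with $\mathcal O_{Y,\Sigma}=\hat{\mathcal O}_\Sigma$ and $\nabla_{Y,\Sigma}(\eta)\ne0$. The order matrix and the Jacobian matrix $(\partial P_i/\partial x_j)(\eta)$ are given; the entries of the latter lie in a subfield $\mathbb K$ of $\mathbb R$. **The algorithm Ō-reg.** It works on a set $R$ of equations and a set $C$ of variables, initially all of them, with $A$ the submatrix $(R,C)$ of $A_\Sigma$. If $R=\emptyset$, return $\emptyset$. If $\sharp R>\sharp C$ or $A$ has a row of $-\infty$, return "failed". Remove from $C$ the columns of $-\infty$; let $B$ consist of the remaining columns with entries $0$ and $-\infty$ only, restricted to its nontrivial rows (those with an entry $0$), and let $J$ be the corresponding submatrix of the Jacobian matrix at $\eta$. Apply *Seq* to $(B,J)$. One iteration of Seq is as follows: (HK) let $R_0,C_0$ be the sets of rows and columns that contain all zeros of $B$, with $\sharp R_0+\sharp C_0$ equal to the maximal number of transversal zeros, $R_0$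 maximal and $C_0$ minimal for inclusion; restrict to the rows in $R_0$ and the columns not in $C_0$; (Kernel-Support) then remove the set $R_{[K]}$ of rows of the restricted $J$ that occur in a nontrivial linear relation between its rows, and all columns having an entry $0$ of $B$ in a row of $R_{[K]}$. Seq stops at the first iteration that changes nothing (this iteration is counted). Let $(R_1,C_1)$ be the rows and columns that remain. If $R_1=\emptyset$, return "failed". Otherwise choose $Y_1\subset C_1$ with $\sharp Y_1=\sharp R_1$ and $\det(\partial P_i/\partial x_j(\eta))_{i\in R_1,\,x_j\in Y_1}\ne0$, and call Ō-reg on the equations $R\setminus R_1$ and the variables $C\setminus C_1$. If this returns "failed", return "failed"; if it returns $Y_2$, return $Y_1\cup Y_2$. **Theorem.** i) The algorithm Ō-reg terminates and tests if $\Sigma$ is ō-regular at $\eta$: if it is, Ō-reg returns a set $Y$ of $s$ variables such that $\mathcal O_{Y,\Sigma}=0$ and $\nabla_{Y,\Sigma}(\eta)\ne0$; otherwise it returns "failed". ii) For $s,n\ge1$, Ō-reg can be implemented so as to work in $O(p(qd^2+s)n)$ elementary operations in $\mathbb K$, where $p$ is the number of calls of Ō-reg on a nonempty system (including the initial one), and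 $q$ and $d$ are respectively the maximal number of iterations of Seq and the maximal number of nontrivial rows of $B$ in a call of Ō-reg. iii) For $s,n\ge1$, Ō-reg can be implemented so that, if $q\le1$ and $C_0=\emptyset$ at each call, it works in $O((d^2+s\ln(s+1))n)$ elementary operations. Here, an implementation is a program, independent of $\mathbb K$, $s$, $n$ and $\Sigma$, of a random access machine over $\mathbb K$, for which field operations and zero tests in $\mathbb K$, additions, truncated subtractions and comparisons in $\mathbb N$, and memory accesses count for one elementary operation each; the constants in the $O$ are absolute. -/

import Mathlib

noncomputable section

namespace OReg

/-! ### Differential functions on the jet space -/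

/-- A point of the jet space `J(ℝ, ℝⁿ)`: the value of the independent variable `t` and the values
`x_j^{(k)}` of all derivatives of the `n` variables. -/
abbrev Jet (n : ℕ) : Type := ℝ × (Fin n → ℕ → ℝ)

/-- The finite dimensional space with coordinates `t` and `x_j^{(k)}`, `k ≤ r`. -/
abbrev FinJet (n r : ℕ) : Type := ℝ × (Fin n → Fin (r + 1) → ℝ)

/-- The projection of the jet space to finitely many coordinates. -/
def Jet.trunc {n : ℕ} (r : ℕ) (η : Jet n) : FinJet n r := (η.1, fun j k => η.2 j k)

/-- A differential function: a real analytic function of finitely many of the coordinates of the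
jet space, defined on a connected open domain. -/
structure DiffFun (n : ℕ) where
  /-- a bound for the orders of the derivatives that may occur -/
  r : ℕ
  /-- the domain of definition -/
  dom : Set (FinJet n r)
  isOpen_dom : IsOpen dom
  isPreconnected_dom : IsPreconnected dom
  /-- the function -/
  toFun : FinJet n r → ℝ
  analytic : AnalyticOnNhd ℝ toFun dom

/-- `∂P/∂x_j^{(k)}` as a function of the coordinates of order at most `r`. -/
def DiffFun.pderivFin {n : ℕ} (P : DiffFun n) (j : Fin n) (k : ℕ) (z : FinJet n P.r) : ℝ :=
  if h : k < P.r + 1 then fderiv ℝ P.toFun z (0, Pi.single j (Pi.single ⟨k, h⟩ 1)) else 0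

/-- `(∂P/∂x_j^{(k)})(η)`. -/
def DiffFun.pderiv {n : ℕ} (P : DiffFun n) (η : Jet n) (j : Fin n) (k : ℕ) : ℝ :=
  P.pderivFin j k (η.trunc P.r)

/-- `P` is defined at the point `η` of the jet space. -/
def DiffFun.DefinedAt {n : ℕ} (P : DiffFun n) (η : Jet n) : Prop := η.trunc P.r ∈ P.dom

open Classical in
/-- `ord_{x_j} P`: the largest `k` such that `x_j^{(k)}` occurs in `P` (that is, such that
`∂P/∂x_j^{(k)}` does not vanish identically on the domain), and `⊥ = -∞` if there is none. -/
def DiffFun.ord {n : ℕ} (P : DiffFun n) (j : Fin n) : WithBot ℕ :=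
  ((Finset.range (P.r + 1)).filter fun k => ∃ z ∈ P.dom, P.pderivFin j k z ≠ 0).max

/-- The order matrix `A_Σ` of a system `Σ = {P_1, …, P_s}`. -/
def orderMatrix {s n : ℕ} (P : Fin s → DiffFun n) : Matrix (Fin s) (Fin n) (WithBot ℕ) :=
  fun i j => (P i).ord j

/-! ### Jacobi number, saddle Jacobi number, canons and the truncated determinant -/

/-- The Jacobi number of a matrix: the maximum of `∑ i, a_{i, σ i}` over all injections `σ`. -/
def jacobiNumber {s n : ℕ} (A : Matrix (Fin s) (Fin n) (WithBot ℕ)) : WithBot ℕ :=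
  Finset.univ.sup fun σ : Fin s ↪ Fin n => ∑ i, A i (σ i)

/-- The square submatrix formed of the columns in `Y`, in increasing order. -/
def colsIn {s n : ℕ} {α : Type} (A : Matrix (Fin s) (Fin n) α) (Y : Finset (Fin n))
    (hY : Y.card = s) : Matrix (Fin s) (Fin s) α :=
  A.submatrix id (Y.orderEmbOfFin hY)

/-- `O_{Y,A}` for a set `Y` of `s` columns. -/
def jacobiNumberOn {s n : ℕ} (A : Matrix (Fin s) (Fin n) (WithBot ℕ)) (Y : Finset (Fin n))
    (hY : Y.card = s) : WithBot ℕ :=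
  jacobiNumber (colsIn A Y hY)

/-- The values `O_{Y,A} ≠ -∞`, for all sets `Y` of `s` columns. -/
def saddleValues {s n : ℕ} (A : Matrix (Fin s) (Fin n) (WithBot ℕ)) : Set (WithBot ℕ) :=
  {v | v ≠ ⊥ ∧ ∃ (Y : Finset (Fin n)) (hY : Y.card = s), v = jacobiNumberOn A Y hY}

/-- `v` is the saddle Jacobi number of `A`: the least `O_{Y,A} ≠ -∞`, and `-∞` if there is none. -/
def IsSaddleNumber {s n : ℕ} (A : Matrix (Fin s) (Fin n) (WithBot ℕ)) (v : WithBot ℕ) : Prop :=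
  IsLeast (saddleValues A) v ∨ (saddleValues A = ∅ ∧ v = ⊥)

/-- `ℓ` is a canon of `A`: after adding `ℓ_i` to row `i` there is a family of transversal entries,
each of which is maximal in its column. -/
def IsCanon {s n : ℕ} (A : Matrix (Fin s) (Fin n) (WithBot ℕ)) (l : Fin s → ℕ) : Prop :=
  ∃ σ : Fin s ↪ Fin n, ∀ i i' : Fin s, A i' (σ i) + (l i' : WithBot ℕ) ≤ A i (σ i) + (l i : WithBot ℕ)

/-- `l` is the minimal canon of `A` (the least one for the componentwise order). -/
def IsMinimalCanon {s n : ℕ} (A : Matrix (Fin s) (Fin n) (WithBot ℕ)) (l : Fin s → ℕ) : Prop :=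
  IsLeast {l' | IsCanon A l'} l

/-- The row part `α_i = max_k λ_k - λ_i` of the cover associated with a canon. -/
def coverRow {s : ℕ} (l : Fin s → ℕ) (i : Fin s) : ℕ := Finset.univ.sup l - l i

/-- The column part `β_j = max_i (a_{i,j} - α_i)` of the cover associated with a canon. -/
def coverCol {s : ℕ} (A : Matrix (Fin s) (Fin s) (WithBot ℕ)) (l : Fin s → ℕ) (j : Fin s) :
    WithBot ℤ :=
  Finset.univ.sup fun i => (A i j).map fun a : ℕ => (a : ℤ) - (coverRow l i : ℤ)

/-- `(∂P/∂x_j^{(m)})(η)`, which is `0` if `m` is negative or `-∞`. -/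
def DiffFun.pderivInt {n : ℕ} (P : DiffFun n) (η : Jet n) (j : Fin n) (m : WithBot ℤ) : ℝ :=
  (m.map fun k : ℤ => if 0 ≤ k then P.pderiv η j k.toNat else 0).unbotD 0

/-- The value at `η` of the determinant `|∂P_i/∂x_j^{(α_i + β_j)}|`, where `x_j` runs over `Y` and
`(α, β)` is the cover associated with the canon `l` of the order matrix restricted to `Y`. -/
def truncDet {s n : ℕ} (P : Fin s → DiffFun n) (η : Jet n) (Y : Finset (Fin n))
    (hY : Y.card = s) (l : Fin s → ℕ) : ℝ :=
  Matrix.det (Matrix.of fun i k : Fin s =>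
    (P i).pderivInt η (Y.orderEmbOfFin hY k)
      (((coverRow l i : ℤ) : WithBot ℤ) + coverCol (colsIn (orderMatrix P) Y hY) l k))

/-- `∇_{Y,Σ}(η) ≠ 0`: the truncated determinant, built with the Jacobi cover (the cover associated
with the minimal canon), does not vanish at `η`. -/
def NablaNeZero {s n : ℕ} (P : Fin s → DiffFun n) (η : Jet n) (Y : Finset (Fin n))
    (hY : Y.card = s) : Prop :=
  ∃ l : Fin s → ℕ, IsMinimalCanon (colsIn (orderMatrix P) Y hY) l ∧ truncDet P η Y hY l ≠ 0

/-- The system is an ō-system that is regular at `η`: its saddle Jacobi number is `0`, and there is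
`Y` such that `O_{Y,Σ}` is the saddle Jacobi number and `∇_{Y,Σ}(η) ≠ 0`. -/
def IsORegularAt {s n : ℕ} (P : Fin s → DiffFun n) (η : Jet n) : Prop :=
  IsSaddleNumber (orderMatrix P) 0 ∧
    ∃ (Y : Finset (Fin n)) (hY : Y.card = s),
      IsSaddleNumber (orderMatrix P) (jacobiNumberOn (orderMatrix P) Y hY) ∧ NablaNeZero P η Y hY

/-! ### The algorithm

Submatrices of the order matrix `A` and of the Jacobian matrix `J` are given by a set `R` of rows
and a set `C` of columns. -/

/-- `T` is a family of transversal zeros of the submatrix `(R, C)`. -/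
def IsTransversal {s n : ℕ} (A : Matrix (Fin s) (Fin n) (WithBot ℕ)) (R : Finset (Fin s))
    (C : Finset (Fin n)) (T : Finset (Fin s × Fin n)) : Prop :=
  T ⊆ R ×ˢ C ∧ (∀ e ∈ T, A e.1 e.2 = 0) ∧
    Set.InjOn Prod.fst (T : Set (Fin s × Fin n)) ∧ Set.InjOn Prod.snd (T : Set (Fin s × Fin n))

open Classical in
/-- The maximal number of transversal zeros of the submatrix `(R, C)`. -/
def transversalNumber {s n : ℕ} (A : Matrix (Fin s) (Fin n) (WithBot ℕ)) (R : Finset (Fin s))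
    (C : Finset (Fin n)) : ℕ :=
  ((R ×ˢ C).powerset.filter fun T => IsTransversal A R C T).sup Finset.card

/-- `R₀`, `C₀` are sets of rows and columns that contain all zeros of the submatrix `(R, C)`, with
`#R₀ + #C₀` equal to the maximal number of transversal zeros. -/
def IsKonigCover {s n : ℕ} (A : Matrix (Fin s) (Fin n) (WithBot ℕ)) (R : Finset (Fin s))
    (C : Finset (Fin n)) (R₀ : Finset (Fin s)) (C₀ : Finset (Fin n)) : Prop :=
  R₀ ⊆ R ∧ C₀ ⊆ C ∧ (∀ i ∈ R, ∀ j ∈ C, A i j = 0 → i ∈ R₀ ∨ j ∈ C₀) ∧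
    R₀.card + C₀.card = transversalNumber A R C

/-- `(R₀, C₀) = HK(B)` for the submatrix `B = (R, C)`: the König cover with `R₀` maximal and `C₀`
minimal for inclusion. -/
def IsHK {s n : ℕ} (A : Matrix (Fin s) (Fin n) (WithBot ℕ)) (R : Finset (Fin s))
    (C : Finset (Fin n)) (R₀ : Finset (Fin s)) (C₀ : Finset (Fin n)) : Prop :=
  IsKonigCover A R C R₀ C₀ ∧ ∀ R' C', IsKonigCover A R C R' C' → R' ⊆ R₀ ∧ C₀ ⊆ C'

/-- `c` is a linear relation between the rows of the submatrix `(R, C)` of `J`. -/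
def IsRowRelation {s n : ℕ} {F : Type} [Field F] (J : Matrix (Fin s) (Fin n) F)
    (R : Finset (Fin s)) (C : Finset (Fin n)) (c : Fin s → F) : Prop :=
  (∀ i ∉ R, c i = 0) ∧ ∀ j ∈ C, ∑ i ∈ R, c i * J i j = 0

open Classical in
/-- The row kernel support `R_[K]`: the rows that occur in some linear relation. -/
def rowSupport {s n : ℕ} {F : Type} [Field F] (J : Matrix (Fin s) (Fin n) F)
    (R : Finset (Fin s)) (C : Finset (Fin n)) : Finset (Fin s) :=
  R.filter fun i => ∃ c, IsRowRelation J R C c ∧ c i ≠ 0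

open Classical in
/-- The column kernel support `C_[K]`: the columns with an entry `0` in a row of `R_[K]`. -/
def colSupport {s n : ℕ} {F : Type} [Field F] (A : Matrix (Fin s) (Fin n) (WithBot ℕ))
    (J : Matrix (Fin s) (Fin n) F) (R : Finset (Fin s)) (C : Finset (Fin n)) : Finset (Fin n) :=
  C.filter fun j => ∃ i ∈ rowSupport J R C, A i j = 0

/-- `SeqRun A J R C R₁ C₁ q c`: the process `Seq`, started with the submatrices `(R, C)`, returns
the submatrices `(R₁, C₁)` after `q` iterations; `c` is the maximum of the numbers of elements of
the sets `C₀` that `HK` returns during these iterations. An iteration applies `HK`, restricts to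
`R₀` and the complement of `C₀`, and applies `Kernel-Support`; `Seq` stops when nothing changes. -/
inductive SeqRun {s n : ℕ} {F : Type} [Field F] (A : Matrix (Fin s) (Fin n) (WithBot ℕ))
    (J : Matrix (Fin s) (Fin n) F) :
    Finset (Fin s) → Finset (Fin n) → Finset (Fin s) → Finset (Fin n) → ℕ → ℕ → Prop
  | done (R R₀ : Finset (Fin s)) (C C₀ : Finset (Fin n))
      (hHK : IsHK A R C R₀ C₀)
      (hR : R₀ \ rowSupport J R₀ (C \ C₀) = R)
      (hC : (C \ C₀) \ colSupport A J R₀ (C \ C₀) = C) :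
      SeqRun A J R C R C 1 C₀.card
  | next (R R₀ R₁ : Finset (Fin s)) (C C₀ C₁ : Finset (Fin n)) (q c : ℕ)
      (hHK : IsHK A R C R₀ C₀)
      (hne : ¬ (R₀ \ rowSupport J R₀ (C \ C₀) = R ∧
        (C \ C₀) \ colSupport A J R₀ (C \ C₀) = C))
      (hrec : SeqRun A J (R₀ \ rowSupport J R₀ (C \ C₀))
        ((C \ C₀) \ colSupport A J R₀ (C \ C₀)) R₁ C₁ q c) :
      SeqRun A J R C R₁ C₁ (q + 1) (max C₀.card c)

open Classical in
/-- The columns in `C` that are not columns of `-∞` elements (in the rows `R`). -/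
def liveCols {s n : ℕ} (A : Matrix (Fin s) (Fin n) (WithBot ℕ)) (R : Finset (Fin s))
    (C : Finset (Fin n)) : Finset (Fin n) :=
  C.filter fun j => ∃ i ∈ R, A i j ≠ ⊥

open Classical in
/-- The columns of `B`: after the columns of `-∞` elements have been suppressed, those that contain
only `0` and `-∞`. -/
def bCols {s n : ℕ} (A : Matrix (Fin s) (Fin n) (WithBot ℕ)) (R : Finset (Fin s))
    (C : Finset (Fin n)) : Finset (Fin n) :=
  (liveCols A R C).filter fun j => ∀ i ∈ R, A i j = ⊥ ∨ A i j = 0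

open Classical in
/-- The nontrivial rows of `B`: those that contain an entry `0`. -/
def bRows {s n : ℕ} (A : Matrix (Fin s) (Fin n) (WithBot ℕ)) (R : Finset (Fin s))
    (C : Finset (Fin n)) : Finset (Fin s) :=
  R.filter fun i => ∃ j ∈ bCols A R C, A i j = 0

/-- The quantities attached to an execution of the algorithm `Ō-reg`. -/
structure Stats where
  /-- the number of calls of `Ō-reg` on a nonempty system, the initial one included -/
  p : ℕ
  /-- the maximal number of iterations of `Seq` in a call of `Ō-reg` -/
  q : ℕ
  /-- the maximal number of nontrivial rows of `B` in a call of `Ō-reg` -/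
  d : ℕ
  /-- the maximal number of elements of a set `C₀` returned by `HK` -/
  c : ℕ

/-- `ORegRun A J R C out st`: the algorithm `Ō-reg`, called for the equations in `R` and the
variables in `C`, returns `out` (`none` stands for ``failed''), and `st` are the quantities attached
to this execution. The result may depend on the choice of the columns `Y₁` of a nonvanishing minor,
which is left open. -/
inductive ORegRun {s n : ℕ} {F : Type} [Field F] (A : Matrix (Fin s) (Fin n) (WithBot ℕ))
    (J : Matrix (Fin s) (Fin n) F) :
    Finset (Fin s) → Finset (Fin n) → Option (Finset (Fin n)) → Stats → Prop
  | nil (C : Finset (Fin n)) : ORegRun A J ∅ C (some ∅) ⟨0, 0, 0, 0⟩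
  | reject (R : Finset (Fin s)) (C : Finset (Fin n)) (hR : R.Nonempty)
      (h : C.card < R.card ∨ ∃ i ∈ R, ∀ j ∈ C, A i j = ⊥) :
      ORegRun A J R C none ⟨1, 0, 0, 0⟩
  | seqFailed (R : Finset (Fin s)) (C C₁ : Finset (Fin n)) (q c : ℕ) (hR : R.Nonempty)
      (h : ¬ (C.card < R.card ∨ ∃ i ∈ R, ∀ j ∈ C, A i j = ⊥))
      (hseq : SeqRun A J (bRows A R C) (bCols A R C) ∅ C₁ q c) :
      ORegRun A J R C none ⟨1, q, (bRows A R C).card, c⟩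
  | step (R R₁ : Finset (Fin s)) (C C₁ Y₁ : Finset (Fin n)) (q c : ℕ)
      (out : Option (Finset (Fin n))) (st : Stats) (hR : R.Nonempty)
      (h : ¬ (C.card < R.card ∨ ∃ i ∈ R, ∀ j ∈ C, A i j = ⊥))
      (hseq : SeqRun A J (bRows A R C) (bCols A R C) R₁ C₁ q c) (hR₁ : R₁.Nonempty)
      (hY₁ : Y₁ ⊆ C₁) (hcard : Y₁.card = R₁.card)
      (hdet : Matrix.det (J.submatrix (R₁.orderEmbOfFin rfl) (Y₁.orderEmbOfFin hcard)) ≠ 0)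
      (hrec : ORegRun A J (R \ R₁) (liveCols A R C \ C₁) out st) :
      ORegRun A J R C (out.map fun Y₂ => Y₁ ∪ Y₂)
        ⟨st.p + 1, max q st.q, max (bRows A R C).card st.d, max c st.c⟩

/-! ### The model of computation

A random access machine over a field `F`, programmed in a small imperative language. It has integer
variables, field variables, and two-dimensional arrays of integers and of elements of `F`. The
operations are addition, truncated subtraction and comparison of natural numbers, addition,
subtraction, multiplication, division and test for zero in `F`, and access to memory. Each of them
counts for one elementary operation. -/

/-- Integer expressions. -/
inductive NExp where
  | const (k : ℕ)
  | var (x : ℕ)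
  | get (a : ℕ) (i j : NExp)
  | plus (e e' : NExp)
  | minus (e e' : NExp)

/-- Field expressions. -/
inductive FExp where
  | zero
  | one
  | var (x : ℕ)
  | get (a : ℕ) (i j : NExp)
  | plus (e e' : FExp)
  | minus (e e' : FExp)
  | times (e e' : FExp)
  | divide (e e' : FExp)

/-- Tests. -/
inductive Test where
  | le (e e' : NExp)
  | isZero (e : FExp)
  | neg (b : Test)
  | conj (b b' : Test)

/-- Programs. -/
inductive Cmd where
  | skip
  | setN (x : ℕ) (e : NExp)
  | setF (x : ℕ) (e : FExp)
  | putN (a : ℕ) (i j e : NExp)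
  | putF (a : ℕ) (i j : NExp) (e : FExp)
  | seq (c c' : Cmd)
  | ite (b : Test) (c c' : Cmd)
  | while (b : Test) (c : Cmd)

/-- The memory: variables and entries `(i, j)` of two-dimensional arrays. -/
structure Store (F : Type) where
  nvar : ℕ → ℕ
  fvar : ℕ → F
  narr : ℕ → ℕ → ℕ → ℕ
  farr : ℕ → ℕ → ℕ → F

/-- The value of an integer expression. -/
def NExp.eval {F : Type} (σ : Store F) : NExp → ℕ
  | const k => k
  | var x => σ.nvar x
  | get a i j => σ.narr a (i.eval σ) (j.eval σ)
  | plus e e' => e.eval σ + e'.eval σ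
  | minus e e' => e.eval σ - e'.eval σ

/-- The value of a field expression (a division by zero gives zero). -/
def FExp.eval {F : Type} [Field F] (σ : Store F) : FExp → F
  | zero => 0
  | one => 1
  | var x => σ.fvar x
  | get a i j => σ.farr a (i.eval σ) (j.eval σ)
  | plus e e' => e.eval σ + e'.eval σ
  | minus e e' => e.eval σ - e'.eval σ
  | times e e' => e.eval σ * e'.eval σ
  | divide e e' => e.eval σ / e'.eval σ

/-- The truth value of a test. -/
def Test.eval {F : Type} [Field F] (σ : Store F) : Test → Prop
  | le e e' => e.eval σ ≤ e'.eval σ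
  | isZero e => e.eval σ = 0
  | neg b => ¬ b.eval σ
  | conj b b' => b.eval σ ∧ b'.eval σ

/-- The number of elementary operations for an integer expression. -/
def NExp.cost : NExp → ℕ
  | const _ => 1
  | var _ => 1
  | get _ i j => i.cost + j.cost + 1
  | plus e e' => e.cost + e'.cost + 1
  | minus e e' => e.cost + e'.cost + 1

/-- The number of elementary operations for a field expression. -/
def FExp.cost : FExp → ℕ
  | zero => 1
  | one => 1
  | var _ => 1
  | get _ i j => i.cost + j.cost + 1
  | plus e e' => e.cost + e'.cost + 1
  | minus e e' => e.cost + e'.cost + 1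
  | times e e' => e.cost + e'.cost + 1
  | divide e e' => e.cost + e'.cost + 1

/-- The number of elementary operations for a test. -/
def Test.cost : Test → ℕ
  | le e e' => e.cost + e'.cost + 1
  | isZero e => e.cost + 1
  | neg b => b.cost + 1
  | conj b b' => b.cost + b'.cost + 1

/-- Assignment to an integer variable. -/
def Store.setN {F : Type} (σ : Store F) (x v : ℕ) : Store F :=
  { σ with nvar := Function.update σ.nvar x v }

/-- Assignment to a field variable. -/
def Store.setF {F : Type} (σ : Store F) (x : ℕ) (v : F) : Store F :=
  { σ with fvar := Function.update σ.fvar x v }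

/-- Assignment to the entry `(i, j)` of an integer array. -/
def Store.putN {F : Type} (σ : Store F) (a i j v : ℕ) : Store F :=
  { σ with narr := fun a' i' j' => if a' = a ∧ i' = i ∧ j' = j then v else σ.narr a' i' j' }

/-- Assignment to the entry `(i, j)` of a field array. -/
def Store.putF {F : Type} (σ : Store F) (a i j : ℕ) (v : F) : Store F :=
  { σ with farr := fun a' i' j' => if a' = a ∧ i' = i ∧ j' = j then v else σ.farr a' i' j' }

/-- `Exec c σ τ t`: the program `c`, started in the memory state `σ`, stops in the memory state `τ`
after `t` elementary operations. -/
inductive Exec {F : Type} [Field F] : Cmd → Store F → Store F → ℕ → Prop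
  | skip (σ : Store F) : Exec .skip σ σ 1
  | setN (σ : Store F) (x : ℕ) (e : NExp) :
      Exec (.setN x e) σ (σ.setN x (e.eval σ)) (e.cost + 1)
  | setF (σ : Store F) (x : ℕ) (e : FExp) :
      Exec (.setF x e) σ (σ.setF x (e.eval σ)) (e.cost + 1)
  | putN (σ : Store F) (a : ℕ) (i j e : NExp) :
      Exec (.putN a i j e) σ (σ.putN a (i.eval σ) (j.eval σ) (e.eval σ))
        (i.cost + j.cost + e.cost + 1)
  | putF (σ : Store F) (a : ℕ) (i j : NExp) (e : FExp) :
      Exec (.putF a i j e) σ (σ.putF a (i.eval σ) (j.eval σ) (e.eval σ))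
        (i.cost + j.cost + e.cost + 1)
  | seq (c c' : Cmd) (σ τ υ : Store F) (t t' : ℕ) (h : Exec c σ τ t) (h' : Exec c' τ υ t') :
      Exec (.seq c c') σ υ (t + t')
  | iteTrue (b : Test) (c c' : Cmd) (σ τ : Store F) (t : ℕ) (hb : b.eval σ) (h : Exec c σ τ t) :
      Exec (.ite b c c') σ τ (b.cost + 1 + t)
  | iteFalse (b : Test) (c c' : Cmd) (σ τ : Store F) (t : ℕ) (hb : ¬ b.eval σ)
      (h : Exec c' σ τ t) :
      Exec (.ite b c c') σ τ (b.cost + 1 + t)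
  | whileFalse (b : Test) (c : Cmd) (σ : Store F) (hb : ¬ b.eval σ) :
      Exec (.while b c) σ σ (b.cost + 1)
  | whileTrue (b : Test) (c : Cmd) (σ τ υ : Store F) (t t' : ℕ) (hb : b.eval σ)
      (h : Exec c σ τ t) (h' : Exec (.while b c) τ υ t') :
      Exec (.while b c) σ υ (b.cost + 1 + t + t')

/-- The initial memory state for an `s × n` order matrix `A` and Jacobian matrix `J`: integer
variables `0` and `1` contain `s` and `n`, integer array `0` contains `A` (`-∞` is coded by `0` and
`a` by `a + 1`), field array `0` contains `J`, and the remaining memory is zero. -/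
def inputStore {s n : ℕ} {F : Type} [Field F] (A : Matrix (Fin s) (Fin n) (WithBot ℕ))
    (J : Matrix (Fin s) (Fin n) F) : Store F where
  nvar x := if x = 0 then s else if x = 1 then n else 0
  fvar _ := 0
  narr a i j :=
    if h : a = 0 ∧ i < s ∧ j < n then ((A ⟨i, h.2.1⟩ ⟨j, h.2.2⟩).map fun k => k + 1).unbotD 0 else 0
  farr a i j := if h : a = 0 ∧ i < s ∧ j < n then J ⟨i, h.2.1⟩ ⟨j, h.2.2⟩ else 0

/-- The result of a computation: ``failed'' if integer variable `2` is zero, and otherwise the set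
of the columns `j` for which entry `(0, j)` of integer array `1` is not zero. -/
def outputOf (n : ℕ) {F : Type} (τ : Store F) : Option (Finset (Fin n)) :=
  if τ.nvar 2 = 0 then none else some (Finset.univ.filter fun j : Fin n => τ.narr 1 0 j ≠ 0)

/-- `J` is the Jacobian matrix `(∂P_i/∂x_j)(η)`, the entries of which belong to the subfield `K`. -/
def IsJacobianAt {s n : ℕ} (K : Subfield ℝ) (P : Fin s → DiffFun n) (η : Jet n)
    (J : Matrix (Fin s) (Fin n) K) : Prop :=
  ∀ i j, (J i j : ℝ) = (P i).pderiv η j 0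

/-- The program `prog` implements `Ō-reg`, and, for an input whose execution of `Ō-reg` has the
attached quantities `st`, with at most `bound s n st` elementary operations in `K` whenever
`cond st` holds. The system has at least one equation and one variable. -/
def ImplementsORegWithin (prog : Cmd) (cond : Stats → Prop) (bound : ℕ → ℕ → Stats → ℝ) : Prop :=
  ∀ (K : Subfield ℝ) (s n : ℕ), 0 < s → 0 < n →
    ∀ (P : Fin s → DiffFun n) (η : Jet n) (J : Matrix (Fin s) (Fin n) K),
      (∀ i, (P i).DefinedAt η) → IsJacobianAt K P η J →
        ∀ (out : Option (Finset (Fin n))) (st : Stats),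
          ORegRun (orderMatrix P) J Finset.univ Finset.univ out st →
            ∃ (τ : Store K) (t : ℕ), Exec prog (inputStore (orderMatrix P) J) τ t ∧
              ORegRun (orderMatrix P) J Finset.univ Finset.univ (outputOf n τ) st ∧
              (cond st → (t : ℝ) ≤ bound s n st)

end OReg

end

/-! Correctness rests on potentials: numbers `l i` for the rows and `m j` for the columns of `Y`
with `A i j + l i ≤ m j` and equal sums. Adding these inequalities along a transversal shows that
the Jacobi number on `Y` is at most zero, and a transversal of zeros makes it zero. In that case
every canon is the row part of such potentials, the truncated determinant has in place `(i, j)` the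
derivative of order `m j - l i`, and negative orders give 0. Since the sums agree, a permutation
that meets a positive order also meets a negative one, so only order 0 contributes: `∇` is the
determinant of the Jacobian entries at the zeros of `A`, whatever canon is used (`truncDet_eq`).

If the system is regular, take the rows `L` of least potential and the live columns `D` of `Y` of
the same potential. The columns `D` contain only `0` and `-∞`, their zeros lie in `L`, and the rows
of `J` on `L × D` are independent. Such a block survives every iteration of `Seq`
(`SeqRun.subset_of_rowIndep`): it can be moved from the columns to the rows of a König cover without
enlarging it, and it meets no linear relation. Hence `Seq` never returns an empty set of rows, and
what remains is again independent, so that no call fails (`ORegRun.ne_none`). Conversely, the pieces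
returned by successive calls form a block triangular matrix, and potentials are built by raising
those of the later blocks (`ORegRun.exists_potential`).

One program serves for both bounds. `HK` is obtained from a maximal transversal, computed by a
method of labels in which a gap between the labels proves maximality (`MatchState.exists_barrier`),
followed by a search along alternating paths; the kernel support comes from an elimination on the
columns. Both take `O(d² m)` operations for `d` rows and `m` columns. The numbers of finite and of
positive entries of each column are kept up to date, not recounted. If `q ≤ 1`, all of `B` leaves
the system in each call, so the costs `d² m`, `s m` and `d n` add up to `O((d² + s) n)`
(`wp_mainLoop`). The choice of `Y₁` is free, but the quantities `p, q, d, c` do not depend on it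
(`ORegRun.unique`), so bounds proved for the run of the program hold for any run. -/

noncomputable section

namespace OReg

/-! ### Reasoning about programs -/

section Framework

set_option linter.unusedSectionVars false

variable {F : Type} [Field F]

infixr:60 " ;; " => Cmd.seq

/-- The program `c`, started in the state `σ`, stops after at most `T` elementary operations in a
state with property `Q`. -/
def WP (c : Cmd) (σ : Store F) (T : ℕ) (Q : Store F → Prop) : Prop :=
  ∃ τ t, Exec c σ τ t ∧ t ≤ T ∧ Q τ

theorem WP.mono {c : Cmd} {σ : Store F} {T T' : ℕ} {Q Q' : Store F → Prop} (h : WP c σ T Q)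
    (hT : T ≤ T') (hQ : ∀ τ, Q τ → Q' τ) : WP c σ T' Q' := by
  obtain ⟨τ, t, he, ht, hq⟩ := h
  exact ⟨τ, t, he, ht.trans hT, hQ τ hq⟩

/-- `c` may assign integer variable `x`. -/
def Cmd.writesNVar : Cmd → ℕ → Bool
  | skip, _ => false
  | setN y _, x => x == y
  | setF _ _, _ => false
  | putN _ _ _ _, _ => false
  | putF _ _ _ _, _ => false
  | seq c c', x => c.writesNVar x || c'.writesNVar x
  | ite _ c c', x => c.writesNVar x || c'.writesNVar x
  | .while _ c, x => c.writesNVar x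

/-- `c` may assign entries of integer array `a`. -/
def Cmd.writesNArr : Cmd → ℕ → Bool
  | skip, _ => false
  | setN _ _, _ => false
  | setF _ _, _ => false
  | putN b _ _ _, a => a == b
  | putF _ _ _ _, _ => false
  | seq c c', x => c.writesNArr x || c'.writesNArr x
  | ite _ c c', x => c.writesNArr x || c'.writesNArr x
  | .while _ c, x => c.writesNArr x

/-- `c` may assign entries of field array `a`. -/
def Cmd.writesFArr : Cmd → ℕ → Bool
  | skip, _ => false
  | setN _ _, _ => false
  | setF _ _, _ => false
  | putN _ _ _ _, _ => false
  | putF b _ _ _, a => a == b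
  | seq c c', x => c.writesFArr x || c'.writesFArr x
  | ite _ c c', x => c.writesFArr x || c'.writesFArr x
  | .while _ c, x => c.writesFArr x

/-- The states `σ` and `τ` agree on the variables and arrays to which `c` does not write. -/
structure Same (c : Cmd) (σ τ : Store F) : Prop where
  nvar : ∀ x, c.writesNVar x = false → τ.nvar x = σ.nvar x
  narr : ∀ a, c.writesNArr a = false → τ.narr a = σ.narr a
  farr : ∀ a, c.writesFArr a = false → τ.farr a = σ.farr a

theorem Same.refl (c : Cmd) (σ : Store F) : Same c σ σ :=
  ⟨fun _ _ => rfl, fun _ _ => rfl, fun _ _ => rfl⟩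

theorem Same.trans {c : Cmd} {σ τ υ : Store F} (h : Same c σ τ) (h' : Same c τ υ) :
    Same c σ υ :=
  ⟨fun x hx => (h'.nvar x hx).trans (h.nvar x hx), fun x hx => (h'.narr x hx).trans (h.narr x hx),
    fun x hx => (h'.farr x hx).trans (h.farr x hx)⟩

theorem Same.of_writes {c c' : Cmd} {σ τ : Store F} (h : Same c σ τ)
    (h1 : ∀ x, c'.writesNVar x = false → c.writesNVar x = false)
    (h2 : ∀ x, c'.writesNArr x = false → c.writesNArr x = false)
    (h3 : ∀ x, c'.writesFArr x = false → c.writesFArr x = false) : Same c' σ τ :=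
  ⟨fun x hx => h.nvar x (h1 x hx), fun x hx => h.narr x (h2 x hx), fun x hx => h.farr x (h3 x hx)⟩

theorem Same.seq_left {c c' : Cmd} {σ τ : Store F} (h : Same c σ τ) : Same (c ;; c') σ τ :=
  h.of_writes (fun x hx => by simp_all [Cmd.writesNVar]) (fun x hx => by simp_all [Cmd.writesNArr])
    (fun x hx => by simp_all [Cmd.writesFArr])

theorem Same.seq_right {c c' : Cmd} {σ τ : Store F} (h : Same c' σ τ) : Same (c ;; c') σ τ :=
  h.of_writes (fun x hx => by simp_all [Cmd.writesNVar]) (fun x hx => by simp_all [Cmd.writesNArr])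
    (fun x hx => by simp_all [Cmd.writesFArr])

theorem Same.while_body {c : Cmd} {b : Test} {σ τ : Store F} (h : Same c σ τ) :
    Same (.while b c) σ τ :=
  h.of_writes (fun x hx => by simp_all [Cmd.writesNVar]) (fun x hx => by simp_all [Cmd.writesNArr])
    (fun x hx => by simp_all [Cmd.writesFArr])

/-- The frame rule. `Same` depends on the syntax of the program only, so in later proofs the
preservation of a variable or of a whole array is closed by `rfl`. Field variables are not tracked.
-/
theorem Exec.same {c : Cmd} {σ τ : Store F} {t : ℕ} (h : Exec c σ τ t) : Same c σ τ := by
  induction h with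
  | skip σ => exact Same.refl _ _
  | setN σ x e =>
    refine ⟨fun y hy => ?_, fun _ _ => rfl, fun _ _ => rfl⟩
    simp only [Cmd.writesNVar, beq_eq_false_iff_ne] at hy
    simp [Store.setN, hy]
  | setF σ x e => exact ⟨fun _ _ => rfl, fun _ _ => rfl, fun _ _ => rfl⟩
  | putN σ a i j e =>
    refine ⟨fun _ _ => rfl, fun b hb => ?_, fun _ _ => rfl⟩
    simp only [Cmd.writesNArr, beq_eq_false_iff_ne] at hb
    simp [Store.putN, hb]
  | putF σ a i j e =>
    refine ⟨fun _ _ => rfl, fun _ _ => rfl, fun b hb => ?_⟩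
    simp only [Cmd.writesFArr, beq_eq_false_iff_ne] at hb
    simp [Store.putF, hb]
  | seq c c' σ τ υ t t' h h' ih ih' => exact ih.seq_left.trans ih'.seq_right
  | iteTrue b c c' σ τ t hb h ih =>
    exact ih.of_writes (fun x hx => by simp_all [Cmd.writesNVar])
      (fun x hx => by simp_all [Cmd.writesNArr]) (fun x hx => by simp_all [Cmd.writesFArr])
  | iteFalse b c c' σ τ t hb h ih =>
    exact ih.of_writes (fun x hx => by simp_all [Cmd.writesNVar])
      (fun x hx => by simp_all [Cmd.writesNArr]) (fun x hx => by simp_all [Cmd.writesFArr])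
  | whileFalse b c σ hb => exact Same.refl _ _
  | whileTrue b c σ τ υ t t' hb h h' ih ih' => exact ih.while_body.trans ih'

theorem WP.same {c : Cmd} {σ : Store F} {T : ℕ} {Q : Store F → Prop} (h : WP c σ T Q) :
    WP c σ T fun τ => Q τ ∧ Same c σ τ := by
  obtain ⟨τ, t, he, ht, hq⟩ := h
  exact ⟨τ, t, he, ht, hq, he.same⟩

theorem WP.seq {c c' : Cmd} {σ : Store F} {T₁ T₂ T : ℕ} {Q₁ Q : Store F → Prop}
    (h : WP c σ T₁ Q₁) (h' : ∀ τ, Q₁ τ → Same c σ τ → WP c' τ T₂ Q) (hT : T₁ + T₂ ≤ T) :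
    WP (c ;; c') σ T Q := by
  obtain ⟨τ, t, he, ht, hq⟩ := h
  obtain ⟨υ, t', he', ht', hq'⟩ := h' τ hq he.same
  exact ⟨υ, t + t', Exec.seq _ _ _ _ _ _ _ he he', by omega, hq'⟩

theorem WP.ite {b : Test} {c c' : Cmd} {σ : Store F} {T T' : ℕ} {Q : Store F → Prop}
    (h : b.eval σ → WP c σ T Q) (h' : ¬ b.eval σ → WP c' σ T Q) (hT : b.cost + 1 + T ≤ T') :
    WP (.ite b c c') σ T' Q := by
  by_cases hb : b.eval σ
  · obtain ⟨τ, t, he, ht, hq⟩ := h hb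
    exact ⟨τ, _, Exec.iteTrue _ _ _ _ _ _ hb he, by omega, hq⟩
  · obtain ⟨τ, t, he, ht, hq⟩ := h' hb
    exact ⟨τ, _, Exec.iteFalse _ _ _ _ _ _ hb he, by omega, hq⟩

/-- Programs without loops. -/
def Cmd.loopFree : Cmd → Bool
  | seq c c' => c.loopFree && c'.loopFree
  | ite _ c c' => c.loopFree && c'.loopFree
  | .while _ _ => false
  | _ => true

open Classical in
/-- The effect of a program without loops. -/
def Cmd.run (σ : Store F) : Cmd → Store F
  | skip => σ
  | setN x e => σ.setN x (e.eval σ)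
  | setF x e => σ.setF x (e.eval σ)
  | putN a i j e => σ.putN a (i.eval σ) (j.eval σ) (e.eval σ)
  | putF a i j e => σ.putF a (i.eval σ) (j.eval σ) (e.eval σ)
  | seq c c' => c'.run (c.run σ)
  | ite b c c' => if b.eval σ then c.run σ else c'.run σ
  | .while _ _ => σ

/-- A bound for the number of operations of a program without loops. -/
def Cmd.maxCost : Cmd → ℕ
  | skip => 1
  | setN _ e => e.cost + 1
  | setF _ e => e.cost + 1
  | putN _ i j e => i.cost + j.cost + e.cost + 1
  | putF _ i j e => i.cost + j.cost + e.cost + 1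
  | seq c c' => c.maxCost + c'.maxCost
  | ite b c c' => b.cost + 1 + max c.maxCost c'.maxCost
  | .while _ _ => 0

theorem exec_of_loopFree {c : Cmd} (hc : c.loopFree = true) (σ : Store F) :
    ∃ t ≤ c.maxCost, Exec c σ (c.run σ) t := by
  induction c generalizing σ with
  | skip => exact ⟨_, le_rfl, Exec.skip _⟩
  | setN => exact ⟨_, le_rfl, Exec.setN _ _ _⟩
  | setF => exact ⟨_, le_rfl, Exec.setF _ _ _⟩
  | putN => exact ⟨_, le_rfl, Exec.putN _ _ _ _ _⟩
  | putF => exact ⟨_, le_rfl, Exec.putF _ _ _ _ _⟩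
  | seq c c' ih ih' =>
    simp only [Cmd.loopFree, Bool.and_eq_true] at hc
    obtain ⟨t, ht, h⟩ := ih hc.1 σ
    obtain ⟨t', ht', h'⟩ := ih' hc.2 (c.run σ)
    exact ⟨t + t', Nat.add_le_add ht ht', Exec.seq _ _ _ _ _ _ _ h h'⟩
  | ite b c c' ih ih' =>
    simp only [Cmd.loopFree, Bool.and_eq_true] at hc
    by_cases hb : b.eval σ
    · obtain ⟨t, ht, h⟩ := ih hc.1 σ
      refine ⟨b.cost + 1 + t, ?_, ?_⟩
      · simp only [Cmd.maxCost]; omega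
      · simpa [Cmd.run, hb] using Exec.iteTrue b c c' σ _ t hb h
    · obtain ⟨t, ht, h⟩ := ih' hc.2 σ
      refine ⟨b.cost + 1 + t, ?_, ?_⟩
      · simp only [Cmd.maxCost]; omega
      · simpa [Cmd.run, hb] using Exec.iteFalse b c c' σ _ t hb h
  | _ => simp [Cmd.loopFree] at hc

/-- A program without loops is evaluated symbolically by `Cmd.run`, which leaves the postcondition
of an explicit state; the two side conditions are decided by computation. -/
theorem WP.block {c : Cmd} {σ : Store F} {T : ℕ} {Q : Store F → Prop} (hQ : Q (c.run σ))
    (hc : c.loopFree = true := by rfl) (hT : c.maxCost ≤ T := by decide) : WP c σ T Q := by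
  obtain ⟨t, ht, h⟩ := exec_of_loopFree hc σ
  exact ⟨_, t, h, ht.trans hT, hQ⟩

theorem WP.while_exit {b : Test} {c : Cmd} {σ : Store F} {T : ℕ} {Q : Store F → Prop}
    (hb : ¬ b.eval σ) (hQ : Q σ) (hT : b.cost + 1 ≤ T) : WP (.while b c) σ T Q :=
  ⟨σ, _, Exec.whileFalse b c σ hb, hT, hQ⟩

theorem WP.while_step {b : Test} {c : Cmd} {σ : Store F} {T₁ T₂ T : ℕ} {Q₁ Q : Store F → Prop}
    (hb : b.eval σ) (h : WP c σ T₁ Q₁)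
    (h' : ∀ τ, Q₁ τ → Same c σ τ → WP (.while b c) τ T₂ Q) (hT : b.cost + 1 + T₁ + T₂ ≤ T) :
    WP (.while b c) σ T Q := by
  obtain ⟨τ, t, he, ht, hq⟩ := h
  obtain ⟨υ, t', he', ht', hq'⟩ := h' τ hq he.same
  exact ⟨υ, _, Exec.whileTrue _ _ _ _ _ _ _ hb he he', by omega, hq'⟩

/-- The index `k` bounds the number of iterations to come; it drops strictly, which yields both
termination and cost. The reference state `σ₀` makes the frame property of all previous iterations
available in the body. -/
theorem WP.while_measure {b : Test} {c : Cmd} {T : ℕ} {σ₀ : Store F} (I : ℕ → Store F → Prop)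
    (h : ∀ k σ, I k σ → b.eval σ → Same c σ₀ σ → WP c σ T fun τ => ∃ k' < k, I k' τ)
    {k : ℕ} {σ : Store F} (hI : I k σ) (hσ : Same c σ₀ σ) :
    WP (.while b c) σ (k * (b.cost + 1 + T) + (b.cost + 1)) fun τ =>
      (∃ k', I k' τ) ∧ ¬ b.eval τ := by
  induction k using Nat.strong_induction_on generalizing σ with
  | _ k ih =>
    by_cases hb : b.eval σ
    · refine WP.while_step (T₂ := (k - 1) * (b.cost + 1 + T) + (b.cost + 1)) hb (h k σ hI hb hσ)
        ?_ ?_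
      · rintro τ ⟨k', hk', hI'⟩ hτ
        refine (ih k' hk' hI' (hσ.trans hτ)).mono ?_ fun _ h => h
        gcongr; omega
      -- The body produces some `k' < k`, so `k` is positive and `k - 1` is not truncated.
      · obtain ⟨τ, t, -, -, k', hk', -⟩ := h k σ hI hb hσ
        obtain ⟨k, rfl⟩ : ∃ m, k = m + 1 := ⟨k - 1, by omega⟩
        simp only [Nat.add_sub_cancel]; ring_nf; omega
    · exact WP.while_exit hb ⟨⟨k, hI⟩, hb⟩ (by omega)

/-- `for x = 0, …, (value of y) - 1 do c`. -/
def Cmd.loop (x y : ℕ) (c : Cmd) : Cmd :=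
  .setN x (.const 0) ;;
    .while (.le (.plus (.var x) (.const 1)) (.var y)) (c ;; .setN x (.plus (.var x) (.const 1)))

/-- The increment is executed after the body `c`, so the invariant must be insensitive to the
counter (`hI`). Each iteration adds 6 operations for the test and 4 for the increment; the remaining
8 are the initialization and the last test. -/
theorem WP.loop {x y : ℕ} {c : Cmd} {σ : Store F} {T T' : ℕ} (I : ℕ → Store F → Prop)
    (hx : c.writesNVar x = false) (hy : c.writesNVar y = false) (hxy : x ≠ y)
    (hI : ∀ k τ v, I k τ → I k (τ.setN x v)) (h0 : I 0 σ)
    (h : ∀ k < σ.nvar y, ∀ τ, I k τ → τ.nvar x = k → Same (Cmd.loop x y c) σ τ →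
      WP c τ T (I (k + 1)))
    (hT : σ.nvar y * (T + 10) + 8 ≤ T') :
    WP (Cmd.loop x y c) σ T' (I (σ.nvar y)) := by
  have hS : ∀ τ v, Same (Cmd.loop x y c) σ τ → Same (Cmd.loop x y c) σ (τ.setN x v) := by
    intro τ v hτ
    refine hτ.trans ⟨fun z hz => ?_, fun _ _ => rfl, fun _ _ => rfl⟩
    have : z ≠ x := by
      rintro rfl; simp [Cmd.loop, Cmd.writesNVar] at hz
    simp [Store.setN, this]
  -- Induction on the number `k` of iterations that remain; the counter then has the value `σ.nvar y
  -- - k`.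
  have key : ∀ k, k ≤ σ.nvar y → ∀ τ, I (σ.nvar y - k) τ → τ.nvar x = σ.nvar y - k →
      τ.nvar y = σ.nvar y → Same (Cmd.loop x y c) σ τ →
      WP (.while (.le (.plus (.var x) (.const 1)) (.var y))
        (c ;; .setN x (.plus (.var x) (.const 1)))) τ (k * (T + 10) + 6) (I (σ.nvar y)) := by
    intro k
    induction k with
    | zero =>
      intro _ τ hIτ hτx hτy _
      refine WP.while_exit ?_ (by simpa using hIτ) (by simp [Test.cost, NExp.cost])
      simp [Test.eval, NExp.eval, hτx, hτy]
    | succ k ih =>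
      intro hk τ hIτ hτx hτy hτ
      refine WP.while_step (T₁ := T + 4) (T₂ := k * (T + 10) + 6) ?_
        (WP.seq (h _ (by omega) τ hIτ hτx hτ) (T₂ := 4)
          (Q := fun υ => I (σ.nvar y - k) υ ∧ υ.nvar x = σ.nvar y - k ∧ υ.nvar y = σ.nvar y ∧
            Same (Cmd.loop x y c) σ υ) ?_ le_rfl) ?_ ?_
      · simp only [Test.eval, NExp.eval, hτx, hτy]; omega
      · intro υ hυ hs
        have hυx := hs.nvar x hx
        have hυy := hs.nvar y hy
        refine WP.block ?_ rfl (by simp [Cmd.maxCost, NExp.cost])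
        have e : σ.nvar y - (k + 1) + 1 = σ.nvar y - k := by omega
        rw [e] at hυ
        refine ⟨hI _ _ _ hυ, ?_, ?_, ?_⟩
        · simp [Cmd.run, Store.setN, NExp.eval, hυx, hτx]; omega
        · simp [Cmd.run, Store.setN, hxy.symm, hυy, hτy]
        · exact hS _ _ (hτ.trans (hs.seq_left.while_body.seq_right))
      · rintro υ ⟨h1, h2, h3, h4⟩ _
        exact ih (by omega) υ h1 h2 h3 h4
      · simp [Test.cost, NExp.cost]; ring_nf; omega
  refine WP.seq (T₁ := 2) (T₂ := σ.nvar y * (T + 10) + 6)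
    (Q₁ := fun τ => τ = σ.setN x 0) (WP.block rfl rfl (by simp [Cmd.maxCost, NExp.cost])) ?_
    (by omega)
  rintro τ rfl hs
  refine key _ le_rfl _ ?_ ?_ ?_ ?_
  · simpa using hI _ _ _ h0
  · simp [Store.setN]
  · simp [Store.setN, hxy.symm]
  · exact hs.seq_left

/-- A loop over all indices below `N`. -/
theorem WP.loopFin {N : ℕ} {x y : ℕ} {c : Cmd} {σ : Store F} {T T' : ℕ}
    (I : Finset (Fin N) → Store F → Prop)
    (hN : σ.nvar y = N)
    (hx : c.writesNVar x = false) (hy : c.writesNVar y = false) (hxy : x ≠ y)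
    (hI : ∀ S τ v, I S τ → I S (τ.setN x v)) (h0 : I ∅ σ)
    (h : ∀ (S : Finset (Fin N)) (i : Fin N), i ∉ S → ∀ τ, I S τ → τ.nvar x = i → Same (Cmd.loop x y c) σ τ →
      WP c τ T (I (insert i S)))
    (hT : N * (T + 10) + 8 ≤ T') :
    WP (Cmd.loop x y c) σ T' (I Finset.univ) := by
  subst hN
  refine (WP.loop (T' := T') (fun k => I (Finset.univ.filter fun i => i.val < k)) hx hy hxy
    (fun k τ v => hI _ τ v) ?_ ?_ hT).mono le_rfl ?_
  · simpa using h0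
  · intro k hk τ hIτ hτ hs
    have e : (Finset.univ.filter fun i : Fin (σ.nvar y) => i.val < k + 1) =
        insert ⟨k, hk⟩ (Finset.univ.filter fun i : Fin (σ.nvar y) => i.val < k) := by
      ext i; simp [Fin.ext_iff]; omega
    rw [e]
    exact h _ ⟨k, hk⟩ (by simp) τ hIτ hτ hs
  · intro τ h
    simpa using h

/-- Row `0` of integer array `a` lists the elements of `U`, the number of which is `d`. -/
def Lists {N : ℕ} (σ : Store F) (a d : ℕ) (U : Finset (Fin N)) : Prop :=
  d = U.card ∧ ∃ L : List (Fin N), L.Nodup ∧ L.toFinset = U ∧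
    ∀ (k : ℕ) (h : k < L.length), σ.narr a 0 k = L[k]

theorem Lists.of_narr {N : ℕ} {σ τ : Store F} {a d : ℕ} {U : Finset (Fin N)} (h : Lists σ a d U)
    (e : τ.narr a = σ.narr a) : Lists τ a d U := by
  obtain ⟨h1, L, h2, h3, h4⟩ := h
  exact ⟨h1, L, h2, h3, fun k hk => by rw [e, h4 k hk]⟩

theorem Lists.empty {N : ℕ} (σ : Store F) (a : ℕ) : Lists σ a 0 (∅ : Finset (Fin N)) :=
  ⟨by simp, [], by simp⟩

theorem Lists.insert {N : ℕ} {σ : Store F} {a d : ℕ} {U : Finset (Fin N)} (h : Lists σ a d U)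
    {i : Fin N} (hi : i ∉ U) : Lists (σ.putN a 0 d i) a (d + 1) (insert i U) := by
  obtain ⟨h1, L, h2, h3, h4⟩ := h
  have hl : L.length = d := by rw [h1, ← h3, List.toFinset_card_of_nodup h2]
  refine ⟨by rw [Finset.card_insert_of_notMem hi, h1], L ++ [i], ?_, ?_, ?_⟩
  · have : i ∉ L := by simpa [← h3] using hi
    simp only [List.nodup_append, List.nodup_singleton, h2, true_and]
    simpa using fun a ha => by rintro rfl; exact this ha
  · ext; simp [← h3]
  · intro k hk
    simp only [List.length_append, List.length_singleton] at hk
    rcases Nat.lt_succ_iff_lt_or_eq.1 hk with hk | rfl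
    · rw [List.getElem_append_left hk, ← h4 k hk]
      have : k ≠ d := by omega
      simp [Store.putN, this]
    · simp [Store.putN, hl]

/-- `for x in (the list of length (value of y) in array a) do c`, with counter `k`. -/
def Cmd.forEach (k y a x : ℕ) (c : Cmd) : Cmd :=
  Cmd.loop k y (.setN x (.get a (.const 0) (.var k)) ;; c)

/-- The invariant refers to the set of elements already treated, so that no later proof depends on
the order of the list. Loading the element costs 4 operations on top of the 10 of the loop. -/
theorem WP.forEach {N : ℕ} {k y a x : ℕ} {c : Cmd} {σ : Store F} {T T' : ℕ}
    {U : Finset (Fin N)} (I : Finset (Fin N) → Store F → Prop)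
    (hU : Lists σ a (σ.nvar y) U)
    (hk : c.writesNVar k = false) (hy : c.writesNVar y = false) (ha : c.writesNArr a = false)
    (hky : k ≠ y) (hxk : x ≠ k) (hxy : x ≠ y)
    (hI : ∀ S τ v w, I S τ → I S ((τ.setN k v).setN x w)) (h0 : I ∅ σ)
    (h : ∀ S ⊆ U, ∀ i ∈ U, i ∉ S → ∀ τ, I S τ → τ.nvar x = i →
      Same (Cmd.forEach k y a x c) σ τ → WP c τ T (I (insert i S)))
    (hT : U.card * (T + 14) + 8 ≤ T') :
    WP (Cmd.forEach k y a x c) σ T' (I U) := by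
  obtain ⟨h1, L, h2, h3, h4⟩ := hU
  have hl : L.length = σ.nvar y := by rw [h1, ← h3, List.toFinset_card_of_nodup h2]
  -- `hI` changes the counter and the element variable together, whereas `WP.loop` changes the
  -- counter alone. Hiding the value of `x` behind `∃ w` bridges the gap.
  refine (WP.loop (T := T + 4) (T' := T') (fun k' τ => ∃ w, I (L.take k').toFinset (τ.setN x w))
    ?_ ?_ hky ?_ ?_ ?_ ?_).mono le_rfl ?_
  · simpa [Cmd.writesNVar, hk] using hxk.symm
  · simpa [Cmd.writesNVar, hy] using hxy.symm
  · rintro k' τ v ⟨w, hw⟩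
    refine ⟨w, ?_⟩
    have := hI _ _ v w hw
    have e : ((τ.setN x w).setN k v).setN x w = (τ.setN k v).setN x w := by
      simp only [Store.setN, Function.update_comm hxk, Function.update_idem]
    rwa [e] at this
  · exact ⟨σ.nvar x, by simpa [Store.setN] using h0⟩
  · rintro k' hk' τ ⟨w, hw⟩ hτk hs
    have hk'' : k' < L.length := by omega
    have ea : τ.narr a = σ.narr a := hs.narr a (by simp [Cmd.loop, Cmd.writesNArr, ha])
    have ev : (NExp.get a (.const 0) (.var k)).eval τ = L[k'] := by
      simp [NExp.eval, hτk, ea, h4 k' hk'']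
    refine WP.seq (T₁ := 4) (T₂ := T) (Q₁ := fun υ => υ = τ.setN x L[k'])
      (WP.block (by simp [Cmd.run, ev]) rfl (by simp [Cmd.maxCost, NExp.cost])) ?_ (by omega)
    rintro υ rfl hυ
    have hmem : ∀ i, i ∈ L.take k' → i ∈ L := fun i hi => List.mem_of_mem_take hi
    have hnot : L[k'] ∉ (L.take k').toFinset := by
      rw [List.mem_toFinset, List.mem_take_iff_getElem]
      rintro ⟨i, hi, hh⟩
      have := (List.Nodup.getElem_inj_iff h2).1 hh
      omega
    have e : (L.take (k' + 1)).toFinset = Insert.insert L[k'] (L.take k').toFinset := by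
      ext i
      rw [Finset.mem_insert, List.mem_toFinset, List.mem_toFinset, List.take_add_one,
        List.getElem?_eq_getElem hk'', List.mem_append, or_comm, Option.toList_some,
        List.mem_singleton]
    refine (h (L.take k').toFinset ?_ L[k'] (by simp [← h3]) hnot (τ.setN x L[k']) ?_ ?_ ?_).mono
      le_rfl ?_
    · intro i hi; rw [← h3]; simp only [List.mem_toFinset] at hi ⊢; exact hmem i hi
    · have := hI _ _ (τ.nvar k) (L[k'] : ℕ) hw
      have e : ((τ.setN x w).setN k (τ.nvar k)).setN x (L[k'] : ℕ) = τ.setN x (L[k'] : ℕ) := by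
        simp only [Store.setN, Function.update_comm hxk, Function.update_idem,
          Function.update_eq_self]
      rwa [e] at this
    · simp [Store.setN]
    · exact hs.trans (hυ.seq_left.seq_left.while_body.seq_right)
    · intro υ hυ
      rw [e]
      exact ⟨υ.nvar x, by simpa [Store.setN] using hυ⟩
  · rw [← h1] at hT; simpa [add_assoc] using hT
  · rintro τ ⟨w, hw⟩
    rw [← hl, List.take_length, h3] at hw
    -- Writing back the present values of both variables removes the auxiliary value `w`.
    have := hI _ _ (τ.nvar k) (τ.nvar x) hw
    have e : ((τ.setN x w).setN k (τ.nvar k)).setN x (τ.nvar x) = τ := by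
      simp only [Store.setN, Function.update_comm hxk, Function.update_idem,
        Function.update_eq_self]
    rwa [e] at this

end Framework

/-! ### Memory layout and abbreviations -/

section Layout

set_option linter.unusedSectionVars false

variable {F : Type} [Field F]

notation "vOk" => (2 : ℕ)
notation "vRem" => (3 : ℕ)
notation "vNumV" => (4 : ℕ)
notation "vNumU" => (5 : ℕ)
notation "vChanged" => (6 : ℕ)
notation "vK" => (7 : ℕ)
notation "vI" => (8 : ℕ)
notation "vK'" => (9 : ℕ)
notation "vJ" => (10 : ℕ)
notation "vCur" => (11 : ℕ)
notation "vPtr" => (12 : ℕ)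
notation "vBest" => (13 : ℕ)
notation "vMin" => (14 : ℕ)
notation "vGrow" => (15 : ℕ)
notation "vPiv" => (16 : ℕ)
notation "vCount" => (17 : ℕ)
notation "vFlag" => (18 : ℕ)
notation "vTmp" => (19 : ℕ)
notation "aOrd" => (0 : ℕ)
notation "aOut" => (1 : ℕ)
notation "aR" => (2 : ℕ)
notation "aC" => (3 : ℕ)
notation "aLive" => (4 : ℕ)
notation "aPos" => (5 : ℕ)
notation "aRows" => (6 : ℕ)
notation "aCols" => (7 : ℕ)
notation "aR'" => (8 : ℕ)
notation "aC'" => (9 : ℕ)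
notation "aMate" => (10 : ℕ)
notation "aLab" => (11 : ℕ)
notation "aZr" => (12 : ℕ)
notation "aZc" => (13 : ℕ)
notation "aPiv" => (14 : ℕ)
notation "aKer" => (15 : ℕ)
notation "aUsed" => (16 : ℕ)

/-- The entry with index `e` of a one-dimensional array. -/
abbrev NExp.get1 (a : ℕ) (e : NExp) : NExp := .get a (.const 0) e

/-- Assignment to an entry of a one-dimensional array. -/
abbrev Cmd.put1 (a : ℕ) (i e : NExp) : Cmd := .putN a (.const 0) i e

/-- Test for equality with a constant. -/
def Test.eqc (e : NExp) (k : ℕ) : Test := .conj (.le e (.const k)) (.le (.const k) e)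

/-- Test for a nonzero value. -/
def Test.pos (e : NExp) : Test := .le (.const 1) e

@[simp] theorem Test.eval_eqc (σ : Store F) (e : NExp) (k : ℕ) :
    (Test.eqc e k).eval σ ↔ e.eval σ = k := by
  simp only [Test.eqc, Test.eval, NExp.eval]; omega

@[simp] theorem Test.eval_pos (σ : Store F) (e : NExp) :
    (Test.pos e).eval σ ↔ e.eval σ ≠ 0 := by
  simp only [Test.pos, Test.eval, NExp.eval]; omega

/-- The code of an entry of the order matrix. -/
def code (a : WithBot ℕ) : ℕ := (a.map fun k => k + 1).unbotD 0

theorem code_coe (a : ℕ) : code (WithBot.some a) = a + 1 := rfl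

@[simp] theorem code_eq_zero {a : WithBot ℕ} : code a = 0 ↔ a = ⊥ := by
  induction a using WithBot.recBotCoe with
  | bot => simp [code]
  | coe a => simp only [code_coe, WithBot.coe_ne_bot, iff_false]; omega

@[simp] theorem code_eq_one {a : WithBot ℕ} : code a = 1 ↔ a = 0 := by
  induction a using WithBot.recBotCoe with
  | bot => simp [code]
  | coe a => rw [code_coe, ← WithBot.coe_zero, WithBot.coe_inj]; omega

theorem two_le_code {a : WithBot ℕ} : 2 ≤ code a ↔ a ≠ ⊥ ∧ a ≠ 0 := by
  have h0 := @code_eq_zero a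
  have h1 := @code_eq_one a
  rw [Ne, Ne, ← h0, ← h1]; omega

variable {s n : ℕ}

/-- Integer array `0` contains the order matrix. -/
def HoldsOrd (A : Matrix (Fin s) (Fin n) (WithBot ℕ)) (σ : Store F) : Prop :=
  ∀ (i : Fin s) (j : Fin n), σ.narr aOrd i j = code (A i j)

/-- Row `0` of the array `a` describes the subset `R` of `U`. -/
def Flags {N : ℕ} (σ : Store F) (a : ℕ) (U R : Finset (Fin N)) : Prop :=
  R ⊆ U ∧ ∀ i ∈ U, σ.narr a 0 i ≠ 0 ↔ i ∈ R

theorem Flags.of_narr {N : ℕ} {σ τ : Store F} {a : ℕ} {U R : Finset (Fin N)} (h : Flags σ a U R)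
    (e : τ.narr a = σ.narr a) : Flags τ a U R := by
  unfold Flags; rwa [e]

/-- The memory during a call of `Seq`: `U` and `V` are the rows and columns of `B`, and `R` and `C`
the current sets of rows and columns. -/
structure Ctx (A : Matrix (Fin s) (Fin n) (WithBot ℕ)) (U R : Finset (Fin s))
    (V C : Finset (Fin n)) (σ : Store F) : Prop where
  ord : HoldsOrd A σ
  rows : Lists σ aRows (σ.nvar vNumU) U
  cols : Lists σ aCols (σ.nvar vNumV) V
  flagR : Flags σ aR' U R
  flagC : Flags σ aC' V C

theorem Ctx.of_eq {A : Matrix (Fin s) (Fin n) (WithBot ℕ)} {U R : Finset (Fin s)}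
    {V C : Finset (Fin n)} {σ τ : Store F} (h : Ctx A U R V C σ)
    (h0 : τ.narr aOrd = σ.narr aOrd) (h6 : τ.narr aRows = σ.narr aRows)
    (h7 : τ.narr aCols = σ.narr aCols) (h8 : τ.narr aR' = σ.narr aR')
    (h9 : τ.narr aC' = σ.narr aC') (hu : τ.nvar vNumU = σ.nvar vNumU)
    (hv : τ.nvar vNumV = σ.nvar vNumV) : Ctx A U R V C τ := by
  refine ⟨?_, ?_, ?_, h.flagR.of_narr h8, h.flagC.of_narr h9⟩
  · intro i j; rw [h0]; exact h.ord i j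
  · rw [hu]; exact h.rows.of_narr h6
  · rw [hv]; exact h.cols.of_narr h7

theorem Ctx.of_same {A : Matrix (Fin s) (Fin n) (WithBot ℕ)} {U R : Finset (Fin s)}
    {V C : Finset (Fin n)} {c : Cmd} {σ τ : Store F} (h : Ctx A U R V C σ) (hs : Same c σ τ)
    (h0 : c.writesNArr aOrd = false := by rfl) (h6 : c.writesNArr aRows = false := by rfl)
    (h7 : c.writesNArr aCols = false := by rfl) (h8 : c.writesNArr aR' = false := by rfl)
    (h9 : c.writesNArr aC' = false := by rfl) (hu : c.writesNVar vNumU = false := by rfl)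
    (hv : c.writesNVar vNumV = false := by rfl) : Ctx A U R V C τ :=
  h.of_eq (hs.narr _ h0) (hs.narr _ h6) (hs.narr _ h7) (hs.narr _ h8) (hs.narr _ h9)
    (hs.nvar _ hu) (hs.nvar _ hv)

/-- Loop over the rows of `B`. -/
abbrev Cmd.forRows (c : Cmd) : Cmd := Cmd.forEach vK vNumU aRows vI c

/-- Loop over the columns of `B`. -/
abbrev Cmd.forCols (c : Cmd) : Cmd := Cmd.forEach vK' vNumV aCols vJ c

end Layout

/-! ### Maximal transversals by relabelling -/

section Matching

set_option linter.unusedSectionVars false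

variable {F : Type} [Field F] {s n : ℕ}

/-- The state of the computation of a maximal family of transversal zeros. Column `j` is matched
with row `i` if `mate j = i + 1`; `P` are the rows that have been considered, `ab` those that have
been abandoned, and the row `cur - 1` (if any) has to be matched. -/
structure MatchState (A : Matrix (Fin s) (Fin n) (WithBot ℕ)) (R P : Finset (Fin s))
    (C : Finset (Fin n)) (L : ℕ) (mate lab : Fin n → ℕ) (ab : Finset (Fin s)) (cur : ℕ) :
    Prop where
  mate_mem : ∀ j ∈ C, mate j ≠ 0 →
    ∃ i ∈ R, i ∈ P ∧ mate j = i + 1 ∧ A i j = 0 ∧ i ∉ ab ∧ cur ≠ i + 1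
  mate_inj : ∀ j ∈ C, ∀ j' ∈ C, mate j ≠ 0 → mate j = mate j' → j = j'
  row : ∀ i ∈ R, i ∈ P → i ∈ ab ∨ cur = i + 1 ∨ ∃ j ∈ C, mate j = i + 1
  cur_mem : cur ≠ 0 → ∃ i ∈ R, i ∈ P ∧ cur = i + 1 ∧ i ∉ ab
  ab_sub : ab ⊆ R
  ab_mem : ab ⊆ P
  ab_lab : ∀ i ∈ ab, ∀ j ∈ C, A i j = 0 → L ≤ lab j
  lab_mate : ∀ j ∈ C, lab j ≠ 0 → mate j ≠ 0
  lab_le : ∀ j ∈ C, lab j ≤ L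
  lab_step : ∀ j ∈ C, ∀ i : Fin s, mate j = i + 1 → ∀ j' ∈ C, A i j' = 0 → lab j ≤ lab j' + 1

variable {A : Matrix (Fin s) (Fin n) (WithBot ℕ)} {R P : Finset (Fin s)}
  {C : Finset (Fin n)} {L : ℕ} {mate lab : Fin n → ℕ} {ab : Finset (Fin s)} {cur : ℕ}

theorem MatchState.init (h : ∀ j ∈ C, mate j = 0 ∧ lab j = 0) :
    MatchState A R ∅ C L mate lab ∅ 0 where
  mate_mem j hj h' := absurd (h j hj).1 h'
  mate_inj j hj _ _ h' := absurd (h j hj).1 h'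
  row i _ h' := by simp at h'
  cur_mem h' := absurd rfl h'
  ab_sub := by simp
  ab_mem := by simp
  ab_lab i h' := by simp at h'
  lab_mate j hj h' := absurd (h j hj).2 h'
  lab_le j hj := by simp [h j hj]
  lab_step j hj i h' := by simp [h j hj] at h'

theorem MatchState.skip (h : MatchState A R P C L mate lab ab 0) {i : Fin s} (hi : i ∉ R) :
    MatchState A R (insert i P) C L mate lab ab 0 where
  mate_mem j hj h' := by
    obtain ⟨i, h1, h2, h3⟩ := h.mate_mem j hj h'
    exact ⟨i, h1, by simp [h2], h3⟩
  mate_inj := h.mate_inj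
  row i' h1 h2 := by
    refine h.row i' h1 ?_
    rcases Finset.mem_insert.1 h2 with rfl | h2
    · exact absurd h1 hi
    · exact h2
  cur_mem h' := absurd rfl h'
  ab_sub := h.ab_sub
  ab_mem := h.ab_mem.trans (Finset.subset_insert _ _)
  ab_lab := h.ab_lab
  lab_mate := h.lab_mate
  lab_le := h.lab_le
  lab_step := h.lab_step

theorem MatchState.fetch (h : MatchState A R P C L mate lab ab 0) {i : Fin s} (hi : i ∈ R)
    (hP : i ∉ P) : MatchState A R (insert i P) C L mate lab ab (i + 1) where
  mate_mem j hj h' := by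
    obtain ⟨i', h1, h2, h3, h4, h5, h6⟩ := h.mate_mem j hj h'
    refine ⟨i', h1, by simp [h2], h3, h4, h5, ?_⟩
    intro e
    have : i = i' := by ext; omega
    exact hP (this ▸ h2)
  mate_inj := h.mate_inj
  row i' h1 h2 := by
    rcases Finset.mem_insert.1 h2 with rfl | h2
    · simp
    · rcases h.row i' h1 h2 with h | h | h
      · exact Or.inl h
      · simp at h
      · exact Or.inr (Or.inr h)
  cur_mem _ := ⟨i, hi, by simp, rfl, fun h' => hP (h.ab_mem h')⟩
  ab_sub := h.ab_sub
  ab_mem := h.ab_mem.trans (Finset.subset_insert _ _)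
  ab_lab := h.ab_lab
  lab_mate := h.lab_mate
  lab_le := h.lab_le
  lab_step := h.lab_step

/-- A row whose zeros all lie in columns of label at least `L` is given up for good. Labels never
decrease, so this reason stays valid, and `MatchState.exists_barrier` shows that no transversal
element is lost. -/
theorem MatchState.abandon {i : Fin s} (h : MatchState A R P C L mate lab ab (i + 1))
    (hi : ∀ j ∈ C, A i j = 0 → L ≤ lab j) :
    MatchState A R P C L mate lab (insert i ab) 0 where
  mate_mem j hj h' := by
    obtain ⟨i', h1, h2, h3, h4, h5, h6⟩ := h.mate_mem j hj h'
    refine ⟨i', h1, by simp [h2], h3, h4, ?_, by omega⟩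
    simp only [Finset.mem_insert, not_or]
    refine ⟨?_, h5⟩
    rintro rfl; exact h6 rfl
  mate_inj := h.mate_inj
  row i' h1 h2 := by
    rcases h.row i' h1 h2 with h | h | h
    · simp [h]
    · have : i' = i := by ext; omega
      simp [this]
    · exact Or.inr (Or.inr h)
  cur_mem h' := absurd rfl h'
  ab_sub := by
    obtain ⟨i', h1, h2, h3, h4⟩ := h.cur_mem (by simp)
    have : i' = i := by ext; omega
    exact Finset.insert_subset (this ▸ h1) h.ab_sub
  ab_mem := by
    obtain ⟨i', h1, h2, h3, h4⟩ := h.cur_mem (by simp)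
    have : i' = i := by ext; omega
    exact Finset.insert_subset (this ▸ h2) h.ab_mem
  ab_lab i' h' := by
    rcases Finset.mem_insert.1 h' with rfl | h'
    · exact hi
    · exact h.ab_lab i' h'
  lab_mate := h.lab_mate
  lab_le := h.lab_le
  lab_step := h.lab_step

/-- The row takes the column of least label and displaces its former mate, which becomes the current
row. The minimality of `lab j₀` gives `lab_step` for the new pair after the label has grown by one;
for the other pairs it persists because labels only grow. -/
theorem MatchState.assign {i : Fin s} {j₀ : Fin n} {mate' lab' : Fin n → ℕ}
    (h : MatchState A R P C L mate lab ab (i + 1))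
    (hj₀ : j₀ ∈ C) (hA : A i j₀ = 0) (hL : lab j₀ < L)
    (hmin : ∀ j ∈ C, A i j = 0 → lab j₀ ≤ lab j)
    (hm₀ : mate' j₀ = i + 1) (hl₀ : lab' j₀ = lab j₀ + 1)
    (hm : ∀ j, j ≠ j₀ → mate' j = mate j) (hl : ∀ j, j ≠ j₀ → lab' j = lab j) :
    MatchState A R P C L mate' lab' ab (mate j₀) := by
  obtain ⟨i', hiR, hiP, e, hiab⟩ := h.cur_mem (by simp)
  obtain rfl : i' = i := by ext; omega
  have hlab : ∀ j, lab j ≤ lab' j := by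
    intro j
    by_cases hj : j = j₀
    · subst hj; omega
    · rw [hl j hj]
  constructor
  · intro j hj h'
    by_cases e : j = j₀
    · subst e
      refine ⟨i', hiR, hiP, hm₀, hA, hiab, ?_⟩
      intro h2
      obtain ⟨i'', -, -, h3, -, -, h4⟩ := h.mate_mem j hj (by omega)
      omega
    · rw [hm j e] at h' ⊢
      obtain ⟨i'', h1, h2, h3, h4, h5, h6⟩ := h.mate_mem j hj h'
      refine ⟨i'', h1, h2, h3, h4, h5, ?_⟩
      intro h7
      exact e (h.mate_inj j hj j₀ hj₀ h' (by omega))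
  · intro j hj j' hj' h1 h2
    by_cases e : j = j₀
    · by_cases e' : j' = j₀
      · rw [e, e']
      · subst e
        rw [hm₀, hm j' e'] at h2
        obtain ⟨i'', -, -, h3, -, -, h4⟩ := h.mate_mem j' hj' (by omega)
        omega
    · by_cases e' : j' = j₀
      · subst e'
        rw [hm₀, hm j e] at h2
        obtain ⟨i'', -, -, h3, -, -, h4⟩ := h.mate_mem j hj (by omega)
        omega
      · rw [hm j e] at h1 h2
        rw [hm j' e'] at h2
        exact h.mate_inj j hj j' hj' h1 h2
  · intro i'' h1 h2
    rcases h.row i'' h1 h2 with h3 | h3 | ⟨j, hj, h3⟩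
    · exact Or.inl h3
    · exact Or.inr (Or.inr ⟨j₀, hj₀, by omega⟩)
    · by_cases e : j = j₀
      · subst e; exact Or.inr (Or.inl h3)
      · exact Or.inr (Or.inr ⟨j, hj, by rw [hm j e, h3]⟩)
  · intro h1
    obtain ⟨i'', h1, h2, h3, h4, h5, h6⟩ := h.mate_mem j₀ hj₀ h1
    exact ⟨i'', h1, h2, h3, h5⟩
  · exact h.ab_sub
  · exact h.ab_mem
  · intro i'' h1 j hj h2
    exact (h.ab_lab i'' h1 j hj h2).trans (hlab j)
  · intro j hj h1
    by_cases e : j = j₀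
    · subst e; omega
    · rw [hm j e]; rw [hl j e] at h1; exact h.lab_mate j hj h1
  · intro j hj
    by_cases e : j = j₀
    · subst e; omega
    · rw [hl j e]; exact h.lab_le j hj
  · intro j hj i'' h1 j' hj' h2
    by_cases e : j = j₀
    · subst e
      obtain rfl : i'' = i' := by ext; omega
      have := hmin j' hj' h2
      have := hlab j'
      omega
    · rw [hm j e] at h1
      rw [hl j e]
      have := h.lab_step j hj i'' h1 j' hj' h2
      have := hlab j'
      omega

/-- Only matched columns carry a nonzero label, and there are at most `R.card` of them. An
assignment raises the sum by one, so this bounds the number of assignments. -/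
theorem MatchState.sum_le (h : MatchState A R P C L mate lab ab cur) :
    ∑ j ∈ C, lab j ≤ R.card * L := by
  classical
  have h1 : ∑ j ∈ C, lab j = ∑ j ∈ C.filter (fun j => mate j ≠ 0), lab j := by
    symm
    apply Finset.sum_subset (Finset.filter_subset _ _)
    intro j hj h'
    by_contra h2
    exact h' (Finset.mem_filter.2 ⟨hj, h.lab_mate j hj h2⟩)
  have h2 : (C.filter (fun j => mate j ≠ 0)).card ≤ (R.image fun i : Fin s => (i : ℕ) + 1).card := by
    apply Finset.card_le_card_of_injOn mate
    · intro j hj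
      simp only [Finset.coe_filter, Set.mem_ofPred_eq] at hj
      obtain ⟨i, hi, -, h3, -⟩ := h.mate_mem j hj.1 hj.2
      simp only [Finset.coe_image, Set.mem_image]
      exact ⟨i, hi, h3.symm⟩
    · intro j hj j' hj' e
      simp only [Finset.coe_filter, Set.mem_ofPred_eq] at hj hj'
      exact h.mate_inj j hj.1 j' hj'.1 hj.2 e
  calc ∑ j ∈ C, lab j = ∑ j ∈ C.filter (fun j => mate j ≠ 0), lab j := h1
    _ ≤ ∑ j ∈ C.filter (fun j => mate j ≠ 0), L := by
        apply Finset.sum_le_sum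
        intro j hj
        exact h.lab_le j (Finset.mem_filter.1 hj).1
    _ = (C.filter (fun j => mate j ≠ 0)).card * L := by simp
    _ ≤ R.card * L := by gcongr; exact h2.trans Finset.card_image_le

/-- A set `G` of matched columns that contains all neighbours of the abandoned rows and of the rows
matched with its elements. -/
def IsBarrier (A : Matrix (Fin s) (Fin n) (WithBot ℕ)) (C : Finset (Fin n)) (mate : Fin n → ℕ)
    (ab : Finset (Fin s)) (G : Finset (Fin n)) : Prop :=
  (∀ j ∈ G, mate j ≠ 0) ∧ (∀ i ∈ ab, ∀ j ∈ C, A i j = 0 → j ∈ G) ∧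
    ∀ j ∈ G, ∀ i : Fin s, mate j = i + 1 → ∀ j' ∈ C, A i j' = 0 → j' ∈ G

/-- The gap argument: with an abandoned row there are too few matched columns for all values `1, …,
L - 1` to be labels. An alternating path from an abandoned row starts at label `L` and descends by
at most one at each step, so it cannot cross a missing value `k`. The columns of label above `k` are
thus closed under alternating paths, and they are all matched. -/
theorem MatchState.exists_barrier (h : MatchState A R P C L mate lab ab cur)
    (hL : R.card < L) : ∃ G ⊆ C, IsBarrier A C mate ab G := by
  classical
  by_cases hab : ab = ∅
  · subst hab
    exact ⟨∅, by simp, by simp [IsBarrier]⟩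
  obtain ⟨i₀, hi₀⟩ := Finset.nonempty_iff_ne_empty.2 hab
  -- a positive label below `L` that does not occur
  obtain ⟨k, hk0, hkL, hk⟩ : ∃ k, 0 < k ∧ k < L ∧ ∀ j ∈ C, lab j ≠ k := by
    by_contra! hcon
    -- Otherwise columns with the labels `1, …, L - 1` would have `L - 1` distinct mates in `R`, all
    -- different from the abandoned row `i₀`, against `R.card < L`.
    have h1 : (Finset.Ico 1 L).card ≤
        ((R.erase i₀).image fun i : Fin s => (i : ℕ) + 1).card := by
      have hR := Finset.card_pos.2 ⟨i₀, h.ab_sub hi₀⟩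
      obtain ⟨j₁, -⟩ := hcon 1 one_pos (by omega)
      have : Nonempty (Fin n) := ⟨j₁⟩
      choose! f hf using hcon
      apply Finset.card_le_card_of_injOn (fun k => mate (f k))
      · intro k hk
        simp only [Finset.coe_Ico, Set.mem_Ico] at hk
        obtain ⟨h1, h2⟩ := hf k (by omega) hk.2
        obtain ⟨i, hi, -, h3, -, h4, -⟩ :=
          h.mate_mem _ h1 (h.lab_mate _ h1 (by omega))
        simp only [Finset.coe_image, Set.mem_image, Finset.coe_erase]
        refine ⟨i, ⟨hi, ?_⟩, h3.symm⟩
        rintro rfl; exact h4 hi₀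
      · intro k hk k' hk' e
        simp only [Finset.coe_Ico, Set.mem_Ico] at hk hk'
        obtain ⟨h1, h2⟩ := hf k (by omega) hk.2
        obtain ⟨h1', h2'⟩ := hf k' (by omega) hk'.2
        have := h.mate_inj _ h1 _ h1' (h.lab_mate _ h1 (by omega)) e
        rw [← h2, ← h2', this]
    have h2 := h1.trans Finset.card_image_le
    rw [Nat.card_Ico, Finset.card_erase_of_mem (h.ab_sub hi₀)] at h2
    have := Finset.card_pos.2 ⟨i₀, h.ab_sub hi₀⟩
    omega
  refine ⟨C.filter fun j => k < lab j, Finset.filter_subset _ _, ?_, ?_, ?_⟩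
  · intro j hj
    simp only [Finset.mem_filter] at hj
    exact h.lab_mate j hj.1 (by omega)
  · intro i hi j hj hA
    have := h.ab_lab i hi j hj hA
    simp only [Finset.mem_filter]
    exact ⟨hj, by omega⟩
  · intro j hj i hi j' hj' hA
    simp only [Finset.mem_filter] at hj ⊢
    have h1 := h.lab_step j hj.1 i hi j' hj' hA
    have h2 := hk j' hj'
    exact ⟨hj', by omega⟩

end Matching

/-! ### The program for maximal transversals -/

section MatchProgram

set_option linter.unusedSectionVars false

variable {F : Type} [Field F] {s n : ℕ}

/-- Search for the column of least label below `vMin` with a zero in row `vI`. -/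
def matchFind : Cmd :=
  Cmd.forCols (.ite (.conj (.pos (.get1 aC' (.var vJ))) (.conj
      (.eqc (.get aOrd (.var vI) (.var vJ)) 1)
      (.le (.plus (.get1 aLab (.var vJ)) (.const 1)) (.var vMin))))
    (.setN vBest (.plus (.var vJ) (.const 1)) ;; .setN vMin (.get1 aLab (.var vJ))) .skip)

/-- One step of the computation of a maximal family of transversal zeros. -/
def matchStep : Cmd :=
  .ite (.le (.var vCur) (.const 0))
    (.setN vI (.get1 aRows (.var vPtr)) ;; .setN vPtr (.plus (.var vPtr) (.const 1)) ;;
      .ite (.pos (.get1 aR' (.var vI))) (.setN vCur (.plus (.var vI) (.const 1))) .skip)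
    ((.setN vI (.minus (.var vCur) (.const 1)) ;; .setN vBest (.const 0) ;;
      .setN vMin (.plus (.var vNumU) (.const 1))) ;; matchFind ;;
      .ite (.pos (.var vBest))
        (.setN vJ (.minus (.var vBest) (.const 1)) ;; .setN vTmp (.get1 aMate (.var vJ)) ;;
          .put1 aMate (.var vJ) (.plus (.var vI) (.const 1)) ;;
          .put1 aLab (.var vJ) (.plus (.get1 aLab (.var vJ)) (.const 1)) ;;
          .setN vCur (.var vTmp))
        (.put1 aZr (.var vI) (.const 1) ;; .setN vCur (.const 0)))

/-- Initialization of the arrays used in an iteration of `Seq`. -/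
def clearArrays : Cmd :=
  Cmd.forRows (.put1 aZr (.var vI) (.const 0) ;; .put1 aKer (.var vI) (.const 0) ;;
    .put1 aUsed (.var vI) (.const 0)) ;;
  Cmd.forCols (.put1 aMate (.var vJ) (.const 0) ;; .put1 aLab (.var vJ) (.const 0) ;;
    .put1 aZc (.var vJ) (.const 0) ;; .put1 aPiv (.var vJ) (.const 0))

/-- Computation of a maximal family of transversal zeros. -/
def matchAll : Cmd :=
  (.setN vCur (.const 0) ;; .setN vPtr (.const 0)) ;;
    .while (.neg (.conj (.le (.var vNumU) (.var vPtr)) (.le (.var vCur) (.const 0)))) matchStep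

variable {A : Matrix (Fin s) (Fin n) (WithBot ℕ)} {U R : Finset (Fin s)}
  {V C : Finset (Fin n)} {σ : Store F}

theorem Ctx.card_rows (h : Ctx A U R V C σ) : σ.nvar vNumU = U.card := h.rows.1

theorem wp_clearArrays (h : Ctx A U R V C σ) :
    WP clearArrays σ (40 * U.card + 50 * V.card + 20) fun τ =>
      (∀ i ∈ U, τ.narr aZr 0 i = 0 ∧ τ.narr aKer 0 i = 0 ∧ τ.narr aUsed 0 i = 0) ∧
      ∀ j ∈ V, τ.narr aMate 0 j = 0 ∧ τ.narr aLab 0 j = 0 ∧ τ.narr aZc 0 j = 0 ∧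
        τ.narr aPiv 0 j = 0 := by
  refine WP.seq (T₂ := 50 * V.card + 10) (WP.forEach (T := 20) (fun S τ => ∀ i ∈ S,
    τ.narr aZr 0 i = 0 ∧ τ.narr aKer 0 i = 0 ∧ τ.narr aUsed 0 i = 0) h.rows rfl rfl rfl
    (by decide) (by decide) (by decide) (fun _ _ _ _ h => h) (by simp) ?_ le_rfl) ?_ (by omega)
  · intro S hS i hi hiS τ hI hτ hs
    refine WP.block ?_
    intro i' hi'
    simp only [Cmd.run, NExp.eval, Store.putN, hτ]
    rcases Finset.mem_insert.1 hi' with rfl | hi'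
    · simp
    · have := hI i' hi'
      simp [this]
  · intro τ hτ hs
    have h' := h.of_same hs
    refine (WP.forEach (T := 20) (fun S υ => (∀ j ∈ S, υ.narr aMate 0 j = 0 ∧ υ.narr aLab 0 j = 0 ∧
      υ.narr aZc 0 j = 0 ∧ υ.narr aPiv 0 j = 0)) h'.cols rfl rfl rfl
      (by decide) (by decide) (by decide) (fun _ _ _ _ h => h) (by simp) ?_ ?_).same.mono le_rfl ?_
    · intro S hS i hi hiS τ hI hτ hs
      refine WP.block ?_
      intro i' hi'
      simp only [Cmd.run, NExp.eval, Store.putN, hτ]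
      rcases Finset.mem_insert.1 hi' with rfl | hi'
      · simp
      · have := hI i' hi'
        simp [this]
    · omega
    · rintro υ ⟨h1, h2⟩
      refine ⟨?_, h1⟩
      rw [h2.narr aZr rfl, h2.narr aKer rfl, h2.narr aUsed rfl]
      exact hτ

/-- `vMin` starts at the threshold for labels, so the first alternative is the hypothesis of
`MatchState.abandon` and the second that of `MatchState.assign`. -/
theorem wp_matchFind (h : Ctx A U R V C σ) {i : Fin s} (hi : σ.nvar vI = i)
    (hb : σ.nvar vBest = 0) :
    WP matchFind σ (V.card * 50 + 8) fun τ =>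
      (τ.nvar vBest = 0 ∧ ∀ j ∈ C, A i j = 0 → σ.nvar vMin ≤ σ.narr aLab 0 j) ∨
      ∃ j ∈ C, τ.nvar vBest = j + 1 ∧ A i j = 0 ∧ σ.narr aLab 0 j < σ.nvar vMin ∧
        ∀ j' ∈ C, A i j' = 0 → σ.narr aLab 0 j ≤ σ.narr aLab 0 j' := by
  refine (WP.forEach (T := 36) (fun S τ =>
      (τ.nvar vBest = 0 ∧ τ.nvar vMin = σ.nvar vMin ∧
        ∀ j ∈ C, j ∈ S → A i j = 0 → σ.nvar vMin ≤ σ.narr aLab 0 j) ∨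
      ∃ j ∈ C, τ.nvar vBest = j + 1 ∧ τ.nvar vMin = σ.narr aLab 0 j ∧ A i j = 0 ∧
        σ.narr aLab 0 j < σ.nvar vMin ∧
        ∀ j' ∈ C, j' ∈ S → A i j' = 0 → σ.narr aLab 0 j ≤ σ.narr aLab 0 j') h.cols rfl rfl rfl
    (by decide) (by decide) (by decide) ?_ (Or.inl ⟨hb, rfl, by simp⟩) ?_ (by omega)).mono le_rfl ?_
  · intro S τ v w h; simpa [Store.setN] using h
  · intro S hS j hj hjS τ hI hτ hs
    have h' := h.of_same hs
    refine WP.block ?_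
    have e1 : τ.nvar vI = i := by rw [hs.nvar vI rfl, hi]
    have e2 : τ.narr aLab = σ.narr aLab := hs.narr _ rfl
    simp only [Cmd.run, Test.eval, Test.eval_pos, Test.eval_eqc, NExp.eval, hτ, e1, h'.ord i j,
      code_eq_one, h'.flagC.2 j hj, e2]
    split_ifs with hc
    · right
      refine ⟨j, hc.1, ?_, ?_, hc.2.1, ?_, ?_⟩
      · simp [Store.setN, hτ]
      · simp [Store.setN, hτ, e2]
      · rcases hI with hI | ⟨j₀, hI⟩ <;> omega
      · intro j' hj' hjS' hA
        rcases Finset.mem_insert.1 hjS' with rfl | hjS'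
        · exact le_rfl
        · rcases hI with ⟨-, h2, hI⟩ | ⟨j₀, -, -, h2, -, -, hI⟩ <;>
          · have := hI j' hj' hjS' hA
            omega
    · rcases hI with ⟨h1, h2, h3⟩ | ⟨j₀, h0, h1, h2, h3, h4, h5⟩
      · refine Or.inl ⟨h1, h2, ?_⟩
        intro j' hj' hjS' hA
        rcases Finset.mem_insert.1 hjS' with rfl | hjS'
        · by_contra hlt
          exact hc ⟨hj', hA, by omega⟩
        · exact h3 j' hj' hjS' hA
      · refine Or.inr ⟨j₀, h0, h1, h2, h3, h4, ?_⟩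
        intro j' hj' hjS' hA
        rcases Finset.mem_insert.1 hjS' with rfl | hjS'
        · by_contra hlt
          exact hc ⟨hj', hA, by omega⟩
        · exact h5 j' hj' hjS' hA
  · rintro τ (⟨h1, h2, h3⟩ | ⟨j₀, h0, h1, h2, h3, h4, h5⟩)
    · exact Or.inl ⟨h1, fun j hj => h3 j hj (h.flagC.1 hj)⟩
    · exact Or.inr ⟨j₀, h0, h1, h3, h4, fun j hj => h5 j hj (h.flagC.1 hj)⟩

/-- The memory during the computation of a maximal family of transversal zeros. -/
structure MatchMem (A : Matrix (Fin s) (Fin n) (WithBot ℕ)) (U R : Finset (Fin s))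
    (V C : Finset (Fin n)) (L : List (Fin s)) (k : ℕ) (σ : Store F) : Prop where
  ctx : Ctx A U R V C σ
  nodup : L.Nodup
  toFinset : L.toFinset = U
  list : ∀ (k : ℕ) (h : k < L.length), σ.narr aRows 0 k = L[k]
  ptr : σ.nvar vPtr ≤ L.length
  flag : ∃ ab, Flags σ aZr U ab ∧ MatchState A R (L.take (σ.nvar vPtr)).toFinset C (U.card + 1)
    (fun j => σ.narr aMate 0 j) (fun j => σ.narr aLab 0 j) ab (σ.nvar vCur)
  measure : k = 2 * (L.length - σ.nvar vPtr) + (if σ.nvar vCur = 0 then 0 else 1) +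
    (U.card * (U.card + 1) - ∑ j ∈ C, σ.narr aLab 0 j)

/-- Every step lowers the measure: a row taken from the list frees 2 and, as the current row, uses
1; an assignment raises the sum of labels; abandoning a row leaves no current row. -/
theorem wp_matchStep {L : List (Fin s)} {k : ℕ} (h : MatchMem A U R V C L k σ)
    (hb : ¬ (σ.nvar vNumU ≤ σ.nvar vPtr ∧ σ.nvar vCur ≤ 0)) :
    WP matchStep σ (V.card * 50 + 60) fun τ => ∃ k' < k, MatchMem A U R V C L k' τ := by
  obtain ⟨hctx, hnd, hLU, hlist, hptr, ⟨ab, hfl, hst⟩, hk⟩ := h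
  have hlen : L.length = σ.nvar vNumU := by
    rw [hctx.card_rows, ← hLU, List.toFinset_card_of_nodup hnd]
  have hRU : R.card ≤ U.card := Finset.card_le_card hctx.flagR.1
  have hVC := hctx.flagC.1
  refine WP.ite (T := V.card * 50 + 55) ?_ ?_ (by simp [Test.cost, NExp.cost]; omega)
  · intro hc
    have hc : σ.nvar vCur = 0 := by simpa [Test.eval, NExp.eval] using hc
    have hlt : σ.nvar vPtr < L.length := by omega
    have e : σ.narr aRows 0 (σ.nvar vPtr) = L[σ.nvar vPtr] := hlist _ hlt
    have hU : L[σ.nvar vPtr] ∈ U := by simp [← hLU]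
    have htake : (L.take (σ.nvar vPtr + 1)).toFinset =
        insert L[σ.nvar vPtr] (L.take (σ.nvar vPtr)).toFinset := by
      ext i
      rw [Finset.mem_insert, List.mem_toFinset, List.mem_toFinset, List.take_add_one,
        List.getElem?_eq_getElem hlt, List.mem_append, or_comm, Option.toList_some,
        List.mem_singleton]
    have hnot : L[σ.nvar vPtr] ∉ (L.take (σ.nvar vPtr)).toFinset := by
      rw [List.mem_toFinset, List.mem_take_iff_getElem]
      rintro ⟨i, hi, hh⟩
      have := (List.Nodup.getElem_inj_iff hnd).1 hh
      omega
    rw [hc] at hst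
    refine (WP.block (T := 30) ?_).mono (by omega) fun _ h => h
    simp only [Cmd.run, NExp.eval, Test.eval_pos, e]
    have e8 : σ.narr aR' 0 L[σ.nvar vPtr] ≠ 0 ↔ L[σ.nvar vPtr] ∈ R := hctx.flagR.2 _ hU
    have er : ((σ.setN vI L[σ.nvar vPtr]).setN vPtr
        ((σ.setN vI L[σ.nvar vPtr]).nvar vPtr + 1)).narr aR' 0
        (((σ.setN vI L[σ.nvar vPtr]).setN vPtr
        ((σ.setN vI L[σ.nvar vPtr]).nvar vPtr + 1)).nvar vI) = σ.narr aR' 0 L[σ.nvar vPtr] := by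
      simp [Store.setN]
    simp only [er, e8]
    split_ifs with hm
    · refine ⟨_, ?_, hctx.of_eq rfl rfl rfl rfl rfl (by simp [Store.setN]) (by simp [Store.setN]),
        hnd, hLU, hlist, ?_, ⟨ab, hfl, ?_⟩, rfl⟩
      · simp [Store.setN, hk, hc]; omega
      · simp [Store.setN]; omega
      · simpa [Store.setN, htake] using hst.fetch hm hnot
    · refine ⟨_, ?_, hctx.of_eq rfl rfl rfl rfl rfl (by simp [Store.setN]) (by simp [Store.setN]),
        hnd, hLU, hlist, ?_, ⟨ab, hfl, ?_⟩, rfl⟩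
      · simp [Store.setN, hk, hc]; omega
      · simp [Store.setN]; omega
      · simpa [Store.setN, htake, hc] using hst.skip hm
  · intro hc
    have hc : σ.nvar vCur ≠ 0 := by simpa [Test.eval, NExp.eval] using hc
    obtain ⟨i, hiR, hiP, hcur, hiab⟩ := hst.cur_mem hc
    refine WP.seq (T₁ := 15) (T₂ := V.card * 50 + 40) (Q₁ := fun τ => τ.nvar vI = i ∧
      τ.nvar vBest = 0 ∧ τ.nvar vMin = U.card + 1 ∧ τ.narr = σ.narr) (WP.block ?_) ?_ (by omega)
    · simp [Cmd.run, NExp.eval, Store.setN, hcur, hctx.card_rows]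
    rintro τ ⟨hi, hb0, hmin, hτ⟩ hs
    have hctx' := hctx.of_same hs
    refine WP.seq (T₁ := V.card * 50 + 8) (T₂ := 32) (wp_matchFind hctx' hi hb0) ?_ (by omega)
    intro υ hυ hs'
    have hctx'' := hctx'.of_same hs'
    have enarr : ∀ a, υ.narr a = σ.narr a := fun a => by rw [hs'.narr a rfl, hτ]
    have evi : υ.nvar vI = i := by rw [hs'.nvar vI rfl, hi]
    have eptr : υ.nvar vPtr = σ.nvar vPtr := by rw [hs'.nvar vPtr rfl, hs.nvar vPtr rfl]
    simp only [hτ, hmin] at hυ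
    rw [hcur] at hst
    refine WP.block ?_
    simp only [Cmd.run, NExp.eval, Test.eval_pos]
    rcases hυ with ⟨h1, h2⟩ | ⟨j, hj, h1, h2, h3, h4⟩
    · simp only [h1, ne_eq, not_true_eq_false, if_false]
      refine ⟨_, ?_, hctx''.of_eq rfl rfl rfl rfl rfl (by simp [Store.setN, Store.putN])
        (by simp [Store.setN, Store.putN]), hnd, hLU, ?_, ?_, ⟨insert i ab, ⟨?_, ?_⟩, ?_⟩, rfl⟩
      · simp [Store.setN, Store.putN, hk, hc, enarr, eptr]
      · simpa [Store.setN, Store.putN, enarr] using hlist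
      · simpa [Store.setN, Store.putN, eptr] using hptr
      · exact Finset.insert_subset (hctx.flagR.1 hiR) hfl.1
      · intro i' hi'
        have := hfl.2 i' hi'
        simp only [Store.setN, Store.putN, evi, enarr]
        by_cases e : i' = i
        · subst e; simp
        · have : (i' : ℕ) ≠ i := fun h => e (Fin.ext h)
          simp [*]
      · have := hst.abandon h2
        simpa [Store.setN, Store.putN, enarr, eptr] using this
    · have hmate' : ∀ j' : Fin n, ((j' : ℕ) = j) ↔ j' = j := fun j' => Fin.ext_iff.symm
      have hA := hst.assign (j₀ := j) (mate' := fun j' => if j' = j then i + 1 else σ.narr aMate 0 j')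
        (lab' := fun j' => if j' = j then σ.narr aLab 0 j + 1 else σ.narr aLab 0 j')
        hj h2 h3 h4 (by simp) (by simp) (by simp +contextual) (by simp +contextual)
      have hpos : υ.nvar vBest ≠ 0 := by omega
      simp only [ne_eq, hpos, not_false_eq_true, if_true]
      have hsum : ∑ j' ∈ C, (if j' = j then σ.narr aLab 0 j + 1 else σ.narr aLab 0 j') =
          ∑ j' ∈ C, σ.narr aLab 0 j' + 1 := by
        rw [← Finset.add_sum_erase _ _ hj, ← Finset.add_sum_erase (a := j) C _ hj]
        rw [Finset.sum_congr rfl (g := fun j' : Fin n => σ.narr aLab 0 j')]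
        · simp; omega
        · intro j' hj'
          simp [Finset.ne_of_mem_erase hj']
      -- Without this bound on the new sum, the truncated difference in the measure might already be
      -- zero and not decrease.
      have hle := hA.sum_le
      have hle2 : R.card * (U.card + 1) ≤ U.card * (U.card + 1) := by gcongr
      rw [hsum] at hle
      refine ⟨_, ?_, hctx''.of_eq rfl rfl rfl rfl rfl (by simp [Store.setN, Store.putN])
        (by simp [Store.setN, Store.putN]), hnd, hLU, ?_, ?_, ⟨ab, ⟨hfl.1, ?_⟩, ?_⟩, rfl⟩
      · simp only [Store.setN, Store.putN, hk, hc, enarr, h1]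
        simp [hmate', hsum, eptr]
        split_ifs <;> omega
      · simpa [Store.setN, Store.putN, enarr] using hlist
      · simpa [Store.setN, Store.putN, eptr] using hptr
      · simpa [Store.setN, Store.putN, enarr] using hfl.2
      · simpa [Store.setN, Store.putN, enarr, eptr, h1, evi, hmate'] using hA

/-- The threshold `U.card + 1` exceeds `R.card`, as `MatchState.exists_barrier` requires, and keeps
the number of steps quadratic in `U.card`; a step scans the columns once. -/
theorem wp_matchAll (h : Ctx A U R V C σ) (hz : ∀ i ∈ U, σ.narr aZr 0 i = 0)
    (hm : ∀ j ∈ V, σ.narr aMate 0 j = 0 ∧ σ.narr aLab 0 j = 0) :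
    WP matchAll σ ((U.card + 3) ^ 2 * (V.card * 50 + 80)) fun τ =>
      ∃ ab, Flags τ aZr U ab ∧ MatchState A R U C (U.card + 1)
        (fun j => τ.narr aMate 0 j) (fun j => τ.narr aLab 0 j) ab 0 := by
  obtain ⟨L, hnd, hLU, hlist⟩ := h.rows.2
  have hlen : L.length = U.card := by rw [← hLU, List.toFinset_card_of_nodup hnd]
  refine WP.seq (T₁ := 10) (T₂ := (2 * U.card + U.card * (U.card + 1)) * (9 + (V.card * 50 + 60))
      + 10) (Q₁ := fun τ => τ.nvar vCur = 0 ∧ τ.nvar vPtr = 0 ∧ τ.narr = σ.narr) (WP.block ?_) ?_ ?_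
  · simp [Cmd.run, NExp.eval, Store.setN]
  · rintro τ ⟨h1, h2, h3⟩ hs
    have hctx := h.of_same hs
    refine (WP.while_measure (σ₀ := τ) (T := V.card * 50 + 60)
      (k := 2 * U.card + U.card * (U.card + 1)) (MatchMem A U R V C L) ?_ ?_
      (Same.refl _ _)).mono ?_ ?_
    · intro k υ hI hb _
      refine wp_matchStep hI ?_
      simpa [Test.eval, NExp.eval] using hb
    · have hsum : ∑ j ∈ C, τ.narr aLab 0 j = 0 := by
        refine Finset.sum_eq_zero fun j hj => ?_
        rw [h3]
        exact (hm j (h.flagC.1 hj)).2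
      refine ⟨hctx, hnd, hLU, by rwa [h3], by omega, ⟨∅, ⟨by simp, ?_⟩, ?_⟩, ?_⟩
      · intro i hi; simp [h3, hz i hi]
      · rw [h1, h2]
        simp only [List.take_zero, List.toFinset_nil]
        refine MatchState.init fun j hj => ?_
        rw [h3]; exact hm j (h.flagC.1 hj)
      · simp [h1, h2, hsum, hlen]
    · simp [Test.cost, NExp.cost]
    · rintro υ ⟨⟨k, hI⟩, hb⟩
      obtain ⟨hctx, hnd, hLU, hlist, hptr, ⟨ab, hfl, hst⟩, hk⟩ := hI
      simp only [Test.eval, NExp.eval, not_not] at hb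
      rw [hctx.card_rows] at hb
      refine ⟨ab, hfl, ?_⟩
      rw [List.take_of_length_le (by omega), hLU] at hst
      have : υ.nvar vCur = 0 := by omega
      rwa [this] at hst
  · nlinarith [Nat.zero_le (U.card * V.card), Nat.zero_le V.card, Nat.zero_le U.card]

end MatchProgram

/-! ### König covers -/

section Konig

variable {s n : ℕ} {A : Matrix (Fin s) (Fin n) (WithBot ℕ)} {R R' : Finset (Fin s)}
  {C C' : Finset (Fin n)} {T : Finset (Fin s × Fin n)}

theorem IsTransversal.card_le (h : IsTransversal A R C T) : T.card ≤ transversalNumber A R C := by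
  classical
  unfold transversalNumber
  exact Finset.le_sup (f := Finset.card) (Finset.mem_filter.2 ⟨Finset.mem_powerset.2 h.1, h⟩)

theorem exists_isTransversal_card (A : Matrix (Fin s) (Fin n) (WithBot ℕ)) (R : Finset (Fin s))
    (C : Finset (Fin n)) : ∃ T, IsTransversal A R C T ∧ T.card = transversalNumber A R C := by
  classical
  have hne : ((R ×ˢ C).powerset.filter fun T => IsTransversal A R C T).Nonempty :=
    ⟨∅, by simp [IsTransversal]⟩
  obtain ⟨T, hT, h⟩ := Finset.exists_mem_eq_sup _ hne Finset.card
  exact ⟨T, (Finset.mem_filter.1 hT).2, h.symm⟩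

/-- All zeros of the submatrix `(R, C)` are in the rows `R'` or in the columns `C'`. -/
def Covers (A : Matrix (Fin s) (Fin n) (WithBot ℕ)) (R : Finset (Fin s)) (C : Finset (Fin n))
    (R' : Finset (Fin s)) (C' : Finset (Fin n)) : Prop :=
  ∀ i ∈ R, ∀ j ∈ C, A i j = 0 → i ∈ R' ∨ j ∈ C'

open Classical in
-- Inclusion and exclusion: each element of `T` is covered, and those covered twice are counted
-- twice. When the cover is as small as `T` is large, no element can be covered twice and no
-- covering row can be missed by `T`; `IsKonigCover.not_both` and `IsKonigCover.exists_mem` are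
-- these two cases of equality.
theorem IsTransversal.card_add_le (h : IsTransversal A R C T) (hc : Covers A R C R' C') :
    T.card + (T.filter fun e => e.1 ∈ R' ∧ e.2 ∈ C').card ≤
      (T.filter fun e => e.1 ∈ R').card + (T.filter fun e => e.2 ∈ C').card := by
  rw [Finset.filter_and, ← Finset.card_union_add_card_inter (T.filter fun e => e.1 ∈ R'),
    ← Finset.filter_or, Finset.filter_true_of_mem (s := T) (p := fun e => e.1 ∈ R' ∨ e.2 ∈ C')]
  intro e he
  have := Finset.mem_product.1 (h.1 he)
  exact hc _ this.1 _ this.2 (h.2.1 e he)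

open Classical in
theorem IsTransversal.card_filter_fst_le (h : IsTransversal A R C T) (R' : Finset (Fin s)) :
    (T.filter fun e => e.1 ∈ R').card ≤ (R' ∩ T.image Prod.fst).card := by
  refine Finset.card_le_card_of_injOn Prod.fst ?_ (h.2.2.1.mono fun e he => (Finset.mem_filter.1 he).1)
  intro e he
  simp only [Finset.coe_filter, Set.mem_ofPred_eq] at he
  simp only [Finset.coe_inter, Set.mem_inter_iff, Finset.mem_coe, Finset.mem_image]
  exact ⟨he.2, e, he.1, rfl⟩

open Classical in
theorem IsTransversal.card_filter_snd_le (h : IsTransversal A R C T) (C' : Finset (Fin n)) :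
    (T.filter fun e => e.2 ∈ C').card ≤ C'.card := by
  refine Finset.card_le_card_of_injOn Prod.snd ?_ (h.2.2.2.mono fun e he => (Finset.mem_filter.1 he).1)
  intro e he
  simp only [Finset.coe_filter, Set.mem_ofPred_eq] at he
  exact he.2

theorem transversalNumber_le (hc : Covers A R C R' C') :
    transversalNumber A R C ≤ R'.card + C'.card := by
  classical
  obtain ⟨T, hT, h⟩ := exists_isTransversal_card A R C
  have h1 := hT.card_add_le hc
  have h2 := hT.card_filter_fst_le R'
  have h3 := hT.card_filter_snd_le C'
  have h4 : (R' ∩ T.image Prod.fst).card ≤ R'.card := Finset.card_le_card Finset.inter_subset_left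
  omega

theorem IsKonigCover.not_both (h : IsKonigCover A R C R' C') (hT : IsTransversal A R C T)
    (hcard : transversalNumber A R C ≤ T.card) {e : Fin s × Fin n} (he : e ∈ T) :
    ¬ (e.1 ∈ R' ∧ e.2 ∈ C') := by
  classical
  intro hb
  have h1 := hT.card_add_le h.2.2.1
  have h2 := hT.card_filter_fst_le R'
  have h3 := hT.card_filter_snd_le C'
  have h4 : (R' ∩ T.image Prod.fst).card ≤ R'.card := Finset.card_le_card Finset.inter_subset_left
  have h5 := h.2.2.2
  have h6 : 0 < (T.filter fun e => e.1 ∈ R' ∧ e.2 ∈ C').card :=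
    Finset.card_pos.2 ⟨e, Finset.mem_filter.2 ⟨he, hb⟩⟩
  omega

theorem IsKonigCover.exists_mem (h : IsKonigCover A R C R' C') (hT : IsTransversal A R C T)
    (hcard : transversalNumber A R C ≤ T.card) {i : Fin s} (hi : i ∈ R') :
    ∃ e ∈ T, e.1 = i := by
  classical
  by_contra hcon
  have h1 := hT.card_add_le h.2.2.1
  have h2 := hT.card_filter_fst_le R'
  have h3 := hT.card_filter_snd_le C'
  have h4 : (R' ∩ T.image Prod.fst).card < R'.card := by
    refine Finset.card_lt_card ⟨Finset.inter_subset_left, fun hs => ?_⟩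
    have := (Finset.mem_inter.1 (hs hi)).2
    exact hcon (by simpa using this)
  have h5 := h.2.2.2
  omega

theorem IsHK.unique {R₀ R₀' : Finset (Fin s)} {C₀ C₀' : Finset (Fin n)} (h : IsHK A R C R₀ C₀)
    (h' : IsHK A R C R₀' C₀') : R₀ = R₀' ∧ C₀ = C₀' :=
  ⟨(h'.2 _ _ h.1).1.antisymm (h.2 _ _ h'.1).1, (h.2 _ _ h'.1).2.antisymm (h'.2 _ _ h.1).2⟩

/-- Sets `X` of rows and `W` of columns closed under alternating paths from the rows in `ab`. -/
def AltClosed (A : Matrix (Fin s) (Fin n) (WithBot ℕ)) (C : Finset (Fin n)) (mate : Fin n → ℕ)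
    (ab X : Finset (Fin s)) (W : Finset (Fin n)) : Prop :=
  ab ⊆ X ∧ (∀ i ∈ X, ∀ j ∈ C, A i j = 0 → j ∈ W) ∧ ∀ j ∈ W, ∀ i : Fin s, mate j = i + 1 → i ∈ X

/-- The rows `X` and columns `W` are joined to `ab` by alternating paths. -/
structure AltReach (A : Matrix (Fin s) (Fin n) (WithBot ℕ)) (R : Finset (Fin s))
    (C : Finset (Fin n)) (mate : Fin n → ℕ) (ab X : Finset (Fin s)) (W G : Finset (Fin n)) :
    Prop where
  sub : ab ⊆ X
  subR : X ⊆ R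
  subC : W ⊆ C
  mate_mem : ∀ j ∈ W, ∃ i ∈ X, mate j = i + 1
  mem_cases : ∀ i ∈ X, i ∈ ab ∨ ∃ j ∈ W, mate j = i + 1
  subG : W ⊆ G
  least : ∀ X' W', AltClosed A C mate ab X' W' → X ⊆ X' ∧ W ⊆ W'

variable {mate lab : Fin n → ℕ} {ab X P : Finset (Fin s)} {W G : Finset (Fin n)} {L cur : ℕ}

theorem AltReach.init (h : ab ⊆ R) : AltReach A R C mate ab ab ∅ G where
  sub := subset_rfl
  subR := h
  subC := by simp
  mate_mem := by simp
  mem_cases i hi := Or.inl hi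
  subG := by simp
  least X' W' h := ⟨h.1, by simp⟩

/-- Bounds the number of passes of the search, since every pass except the last finds a new column.
-/
theorem AltReach.card_le (h : AltReach A R C mate ab X W G)
    (hm : MatchState A R P C L mate lab ab cur) : W.card ≤ R.card := by
  classical
  have : W.card ≤ (R.image fun i : Fin s => (i : ℕ) + 1).card := by
    apply Finset.card_le_card_of_injOn mate
    · intro j hj
      obtain ⟨i, hi, h3⟩ := h.mate_mem j hj
      simp only [Finset.coe_image, Set.mem_image]
      exact ⟨i, h.subR hi, h3.symm⟩
    · intro j hj j' hj' e
      obtain ⟨i, hi, h3⟩ := h.mate_mem j hj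
      exact hm.mate_inj j (h.subC hj) j' (h.subC hj') (by omega) e
  exact this.trans Finset.card_image_le

open Classical in
-- The barrier ensures that a reached column is matched, so the alternating path continues to its
-- mate; an unmatched column would end an augmenting path.
theorem AltReach.step (h : AltReach A R C mate ab X W G) (hG : IsBarrier A C mate ab G)
    (hm : MatchState A R P C L mate lab ab cur) {i : Fin s} {j : Fin n} (hi : i ∈ X) (hj : j ∈ C)
    (hA : A i j = 0) :
    ∃ i' ∈ R, mate j = i' + 1 ∧ AltReach A R C mate ab (insert i' X) (insert j W) G := by
  have hjG : j ∈ G := by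
    rcases h.mem_cases i hi with h1 | ⟨j', h1, h2⟩
    · exact hG.2.1 i h1 j hj hA
    · exact hG.2.2 j' (h.subG h1) i h2 j hj hA
  obtain ⟨i', hi', -, he, -⟩ := hm.mate_mem j hj (hG.1 j hjG)
  refine ⟨i', hi', he, ?_, ?_, ?_, ?_, ?_, ?_, ?_⟩
  · exact h.sub.trans (Finset.subset_insert _ _)
  · exact Finset.insert_subset hi' h.subR
  · exact Finset.insert_subset hj h.subC
  · intro j' hj'
    rcases Finset.mem_insert.1 hj' with rfl | hj'
    · exact ⟨i', by simp, he⟩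
    · obtain ⟨i'', h1, h2⟩ := h.mate_mem j' hj'
      exact ⟨i'', by simp [h1], h2⟩
  · intro i'' h1
    rcases Finset.mem_insert.1 h1 with rfl | h1
    · exact Or.inr ⟨j, by simp, he⟩
    · rcases h.mem_cases i'' h1 with h2 | ⟨j', h2, h3⟩
      · exact Or.inl h2
      · exact Or.inr ⟨j', by simp [h2], h3⟩
  · exact Finset.insert_subset hjG h.subG
  · intro X' W' hc
    obtain ⟨h1, h2⟩ := h.least X' W' hc
    have hjW : j ∈ W' := hc.2.1 i (h1 hi) j hj hA
    exact ⟨Finset.insert_subset (hc.2.2 j hjW i' he) h1, Finset.insert_subset hjW h2⟩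

/-- König's construction. Rows outside `X` are matched with columns outside `W`, and columns of `W`
with rows of `X`, so the cover is no larger than the transversal `T`, and both are optimal. For any
other König cover `(R', C')`, the pair `(R \ R', C')` is closed under alternating paths from the
abandoned rows, hence contains `(X, W)`; this gives the maximality of `R \ X` and the minimality of
`W`. -/
theorem isHK_of_altReach (hm : MatchState A R P C L mate lab ab 0) (hP : R ⊆ P)
    (h : AltReach A R C mate ab X W G) (hcl : ∀ i ∈ X, ∀ j ∈ C, A i j = 0 → j ∈ W) :
    IsHK A R C (R \ X) W := by
  classical
  set T : Finset (Fin s × Fin n) :=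
    (R ×ˢ C).filter fun e => mate e.2 = e.1 + 1 with hTdef
  have hTmem : ∀ i j, (i, j) ∈ T ↔ i ∈ R ∧ j ∈ C ∧ mate j = i + 1 := by
    intro i j; simp [hTdef, and_assoc]
  have hT : IsTransversal A R C T := by
    refine ⟨Finset.filter_subset _ _, ?_, ?_, ?_⟩
    · rintro ⟨i, j⟩ he
      obtain ⟨h1, h2, h3⟩ := (hTmem i j).1 he
      obtain ⟨i', -, -, h4, h5, -⟩ := hm.mate_mem j h2 (by omega)
      have : i = i' := by ext; omega
      rw [this]; exact h5
    · rintro ⟨i, j⟩ he ⟨i', j'⟩ he' e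
      obtain ⟨h1, h2, h3⟩ := (hTmem i j).1 he
      obtain ⟨h1', h2', h3'⟩ := (hTmem i' j').1 he'
      simp only at e
      subst e
      rw [hm.mate_inj j h2 j' h2' (by omega) (by omega)]
    · rintro ⟨i, j⟩ he ⟨i', j'⟩ he' e
      obtain ⟨h1, h2, h3⟩ := (hTmem i j).1 he
      obtain ⟨h1', h2', h3'⟩ := (hTmem i' j').1 he'
      simp only at e
      subst e
      have : i = i' := by ext; omega
      rw [this]
  have hcov : Covers A R C (R \ X) W := by
    intro i hi j hj hA
    by_cases hX : i ∈ X
    · exact Or.inr (hcl i hX j hj hA)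
    · exact Or.inl (Finset.mem_sdiff.2 ⟨hi, hX⟩)
  have hge : (R \ X).card + W.card ≤ T.card := by
    have h1 : (R \ X).card ≤ (T.filter fun e => e.2 ∉ W).card := by
      have : (R \ X) ⊆ (T.filter fun e => e.2 ∉ W).image Prod.fst := by
        intro i hi
        obtain ⟨hiR, hiX⟩ := Finset.mem_sdiff.1 hi
        rcases hm.row i hiR (hP hiR) with h2 | h2 | ⟨j, hj, h2⟩
        · exact absurd (h.sub h2) hiX
        · simp at h2
        · refine Finset.mem_image.2 ⟨(i, j), Finset.mem_filter.2 ⟨(hTmem i j).2 ⟨hiR, hj, h2⟩, ?_⟩,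
            rfl⟩
          intro hjW
          obtain ⟨i', h3, h4⟩ := h.mate_mem j hjW
          have : i = i' := by ext; omega
          exact hiX (this ▸ h3)
      exact (Finset.card_le_card this).trans Finset.card_image_le
    have h2 : W.card ≤ (T.filter fun e => e.2 ∈ W).card := by
      have : W ⊆ (T.filter fun e => e.2 ∈ W).image Prod.snd := by
        intro j hj
        obtain ⟨i, h3, h4⟩ := h.mate_mem j hj
        exact Finset.mem_image.2 ⟨(i, j), Finset.mem_filter.2
          ⟨(hTmem i j).2 ⟨h.subR h3, h.subC hj, h4⟩, hj⟩, rfl⟩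
      exact (Finset.card_le_card this).trans Finset.card_image_le
    have h3 := Finset.card_filter_add_card_filter_not (s := T) (fun e => e.2 ∈ W)
    omega
  have hle := transversalNumber_le hcov
  have hTle := hT.card_le
  have hmax : transversalNumber A R C ≤ T.card := by omega
  refine ⟨⟨Finset.sdiff_subset, h.subC, hcov, by omega⟩, ?_⟩
  intro R' C' hK
  -- Rows of `R'` are met by `T`, which excludes the abandoned rows; the mate of a column of `C'` is
  -- not in `R'`, because no element of `T` is covered twice.
  have hclosed : AltClosed A C mate ab (R \ R') C' := by
    refine ⟨?_, ?_, ?_⟩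
    · intro i hi
      refine Finset.mem_sdiff.2 ⟨hm.ab_sub hi, fun hi' => ?_⟩
      obtain ⟨⟨i', j⟩, he, rfl⟩ := hK.exists_mem hT hmax hi'
      obtain ⟨h1, h2, h3⟩ := (hTmem i' j).1 he
      obtain ⟨i'', -, -, h4, -, h5, -⟩ := hm.mate_mem j h2 (by omega)
      have : i' = i'' := by ext; omega
      exact h5 (this ▸ hi)
    · intro i hi j hj hA
      obtain ⟨h1, h2⟩ := Finset.mem_sdiff.1 hi
      exact (hK.2.2.1 i h1 j hj hA).resolve_left h2
    · intro j hj i hij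
      have hjC := hK.2.1 hj
      obtain ⟨i', h1, -, h4, -⟩ := hm.mate_mem j hjC (by omega)
      have : i = i' := by ext; omega
      subst this
      have := hK.not_both hT hmax ((hTmem i j).2 ⟨h1, hjC, hij⟩)
      exact Finset.mem_sdiff.2 ⟨h1, fun h => this ⟨h, hj⟩⟩
  obtain ⟨h1, h2⟩ := h.least _ _ hclosed
  refine ⟨?_, h2⟩
  intro i hi
  refine Finset.mem_sdiff.2 ⟨hK.1 hi, fun hX => ?_⟩
  exact (Finset.mem_sdiff.1 (h1 hX)).2 hi

end Konig

/-! ### The search along alternating paths and the program for `HK` -/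

section ClosureProgram

set_option linter.unusedSectionVars false

variable {F : Type} [Field F] {s n : ℕ}

/-- Examination of the columns with a zero in row `vI`, which can be reached. -/
def reachRow : Cmd :=
  Cmd.forCols (.ite (.conj (.pos (.get1 aC' (.var vJ))) (.conj
      (.eqc (.get aOrd (.var vI) (.var vJ)) 1) (.le (.get1 aZc (.var vJ)) (.const 0))))
    (.put1 aZc (.var vJ) (.const 1) ;;
      .put1 aZr (.minus (.get1 aMate (.var vJ)) (.const 1)) (.const 1) ;;
      .setN vGrow (.const 1)) .skip)

/-- Computation of the rows and columns that can be reached by alternating paths. -/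
def reachAll : Cmd :=
  .setN vGrow (.const 1) ;;
    .while (.pos (.var vGrow)) (.setN vGrow (.const 0) ;;
      Cmd.forRows (.ite (.pos (.get1 aZr (.var vI))) reachRow .skip))

variable {A : Matrix (Fin s) (Fin n) (WithBot ℕ)} {U R : Finset (Fin s)}
  {V C : Finset (Fin n)} {σ : Store F}

/-- The memory during the computation of the rows `X` and columns `W` that can be reached by
alternating paths; `X₀` and `W₀` are those known at the beginning of a pass, in which no row in `S`
has led to a new column unless `vGrow` is nonzero. -/
def PassMem (A : Matrix (Fin s) (Fin n) (WithBot ℕ)) (U R : Finset (Fin s))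
    (V C : Finset (Fin n)) (mate : Fin n → ℕ) (ab : Finset (Fin s)) (G : Finset (Fin n))
    (X₀ : Finset (Fin s)) (W₀ : Finset (Fin n)) (D : Finset (Fin s × Fin n)) (τ : Store F) : Prop :=
  ∃ X W, Flags τ aZr U X ∧ Flags τ aZc V W ∧ AltReach A R C mate ab X W G ∧ X₀ ⊆ X ∧
    ((τ.nvar vGrow = 0 ∧ X = X₀ ∧ W = W₀ ∧
        ∀ i j, (i, j) ∈ D → i ∈ X → j ∈ C → A i j = 0 → j ∈ W) ∨
      (τ.nvar vGrow ≠ 0 ∧ W₀.card < W.card))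

open Classical in
theorem wp_reachRow (h : Ctx A U R V C σ) {mate lab : Fin n → ℕ} {ab P : Finset (Fin s)}
    {G : Finset (Fin n)} {L cur : ℕ} {X₀ : Finset (Fin s)} {W₀ : Finset (Fin n)}
    {D : Finset (Fin s × Fin n)}
    (hmate : ∀ j : Fin n, σ.narr aMate 0 j = mate j) (hG : IsBarrier A C mate ab G)
    (hm : MatchState A R P C L mate lab ab cur) {i : Fin s} (hi : σ.nvar vI = i) (hiU : i ∈ U)
    (hI : PassMem A U R V C mate ab G X₀ W₀ D σ) (hiX : σ.narr aZr 0 i ≠ 0) :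
    WP reachRow σ (V.card * 54 + 8) (PassMem A U R V C mate ab G X₀ W₀ (D ∪ ({i} ×ˢ V))) := by
  -- The flag of row `i` is part of the invariant because the loop writes to `aZr` itself.
  refine (WP.forEach (T := 40) (fun S τ => τ.narr aZr 0 i ≠ 0 ∧
      PassMem A U R V C mate ab G X₀ W₀ (D ∪ ({i} ×ˢ S)) τ) h.cols rfl rfl rfl
    (by decide) (by decide) (by decide) ?_ ⟨hiX, by simpa using hI⟩ ?_ (by omega)).mono le_rfl
    fun τ h => h.2
  · intro S τ v w h; simpa [Store.setN, PassMem, Flags] using h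
  · rintro S hS j hj hjS τ ⟨hiX, X, W, hX, hW, hr, hX₀, hcase⟩ hτ hs
    have h' := h.of_same hs
    have e1 : τ.nvar vI = i := by rw [hs.nvar vI rfl, hi]
    have e2 : τ.narr aMate 0 j = mate j := by rw [hs.narr aMate rfl, hmate]
    refine WP.block ?_
    have ezc : τ.narr aZc 0 j ≤ 0 ↔ j ∉ W := by rw [← hW.2 j hj]; omega
    simp only [Cmd.run, Test.eval, Test.eval_pos, Test.eval_eqc, NExp.eval, hτ, e1, h'.ord i j,
      code_eq_one, h'.flagC.2 j hj, ezc]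
    have hiX' := (hX.2 i hiU).1 hiX
    split_ifs with hc
    · obtain ⟨hjC, hA, hjW⟩ := hc
      obtain ⟨i', hi', hmi', hr'⟩ := hr.step hG hm hiX' hjC hA
      have hfi : ∀ k : Fin s, ((k : ℕ) = i') ↔ k = i' := fun k => Fin.ext_iff.symm
      have hfj : ∀ k : Fin n, ((k : ℕ) = j) ↔ k = j := fun k => Fin.ext_iff.symm
      refine ⟨?_, insert i' X, insert j W, ⟨?_, ?_⟩, ⟨?_, ?_⟩, hr',
        hX₀.trans (Finset.subset_insert _ _), Or.inr ⟨?_, ?_⟩⟩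
      · simp only [Store.setN, Store.putN, hτ, e2, hmi']
        simp
        split_ifs <;> simp [hiX]
      · exact Finset.insert_subset (h.flagR.1 hi') hX.1
      · intro k hk
        have := hX.2 k hk
        simp only [Store.setN, Store.putN, hτ, e2, hmi', Finset.mem_insert]
        simp [hfi]
        by_cases hki : k = i' <;> simp [hki, ← this]
      · exact Finset.insert_subset hj hW.1
      · intro k hk
        have := hW.2 k hk
        simp only [Store.setN, Store.putN, hτ, e2, hmi', Finset.mem_insert]
        simp [hfj]
        by_cases hki : k = j <;> simp [hki, ← this]
      · simp [Store.setN]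
      · rw [Finset.card_insert_of_notMem hjW]
        rcases hcase with h1 | h1
        · rw [h1.2.2.1]; omega
        · omega
    · refine ⟨hiX, X, W, hX, hW, hr, hX₀, ?_⟩
      rcases hcase with ⟨h1, h2, h3, h4⟩ | h1
      · refine Or.inl ⟨h1, h2, h3, ?_⟩
        intro i'' j'' hD hiX'' hjC'' hA
        simp only [Finset.mem_union, Finset.mem_product, Finset.mem_singleton,
          Finset.mem_insert] at hD
        rcases hD with hD | ⟨rfl, rfl | hD⟩
        · exact h4 _ _ (by simp [hD]) hiX'' hjC'' hA
        · by_contra hcon; exact hc ⟨hjC'', hA, hcon⟩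
        · exact h4 _ _ (by simp [hD]) hiX'' hjC'' hA
      · exact Or.inr h1

open Classical in
-- Passes over the rows are repeated until one of them adds no column; the sets are closed then.
-- `aZr` flags the abandoned rows at the beginning and is extended in place to `X`. By
-- `AltReach.card_le` there are at most `R.card + 1` passes.
theorem wp_reachAll (h : Ctx A U R V C σ) {mate lab : Fin n → ℕ} {ab P : Finset (Fin s)}
    {L cur : ℕ} (hL : R.card < L)
    (hmate : ∀ j : Fin n, σ.narr aMate 0 j = mate j)
    (hm : MatchState A R P C L mate lab ab cur) (hz : Flags σ aZr U ab)
    (hzc : ∀ j ∈ V, σ.narr aZc 0 j = 0) :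
    WP reachAll σ ((U.card + 2) ^ 2 * (V.card * 54 + 100)) fun τ =>
      ∃ X W G, Flags τ aZr U X ∧ Flags τ aZc V W ∧ AltReach A R C mate ab X W G ∧
        ∀ i ∈ X, ∀ j ∈ C, A i j = 0 → j ∈ W := by
  obtain ⟨G, hGC, hG⟩ := hm.exists_barrier hL
  have hRU : R.card ≤ U.card := Finset.card_le_card h.flagR.1
  refine WP.seq (T₁ := 2) (T₂ := (R.card + 1) * (4 + (2 + (U.card * (V.card * 54 + 30) + 8))) + 4)
    (Q₁ := fun τ => τ.nvar vGrow = 1 ∧ τ.narr = σ.narr) (WP.block ?_) ?_ ?_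
  · simp [Cmd.run, NExp.eval, Store.setN]
  · rintro τ ⟨h1, h2⟩ hs
    have hctx := h.of_same hs
    refine (WP.while_measure (σ₀ := τ) (T := 2 + (U.card * (V.card * 54 + 30) + 8))
      (k := R.card + 1) (fun k υ => ∃ X W, Flags υ aZr U X ∧ Flags υ aZc V W ∧
        AltReach A R C mate ab X W G ∧
        (υ.nvar vGrow = 0 → ∀ i ∈ X, ∀ j ∈ C, A i j = 0 → j ∈ W) ∧
        k = R.card - W.card + (if υ.nvar vGrow = 0 then 0 else 1)) ?_ ?_
      (Same.refl _ _)).mono ?_ ?_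
    · rintro k υ ⟨X, W, hX, hW, hr, -, hk⟩ hb hυ
      have hb : υ.nvar vGrow ≠ 0 := by simpa [NExp.eval] using hb
      refine WP.seq (T₁ := 2) (T₂ := U.card * (V.card * 54 + 30) + 8)
        (Q₁ := fun ω => ω.nvar vGrow = 0 ∧ ω.narr = υ.narr) (WP.block ?_) ?_ le_rfl
      · simp [Cmd.run, NExp.eval, Store.setN]
      rintro ω ⟨h3, h4⟩ hs'
      have hctx' := hctx.of_same (hυ.trans hs'.seq_left)
      have hmate' : ω.narr aMate = σ.narr aMate := by
        rw [h4, hυ.narr aMate rfl, h2]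
      refine (WP.forEach (T := V.card * 54 + 16) (fun S τ =>
        PassMem A U R V C mate ab G X W (S ×ˢ V) τ) hctx'.rows rfl rfl rfl
        (by decide) (by decide) (by decide) ?_ ?_ ?_ ?_).mono le_rfl ?_
      · intro S τ v w h; simpa [Store.setN, PassMem, Flags] using h
      · exact ⟨X, W, by rwa [Flags, h4], by rwa [Flags, h4], hr, subset_rfl,
          Or.inl ⟨h3, rfl, rfl, by simp⟩⟩
      · intro S hS i hi hiS ρ hI hρ hsρ
        have hctxρ := hctx'.of_same hsρ
        refine WP.ite (T := V.card * 54 + 8) ?_ ?_ (by simp [Test.cost, Test.pos, NExp.cost]; omega)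
        · intro hpos
          have hpos : ρ.narr aZr 0 i ≠ 0 := by simpa [NExp.eval, hρ] using hpos
          have := wp_reachRow hctxρ (fun j => by rw [hsρ.narr aMate rfl, hmate', hmate]) hG hm hρ hi
            hI hpos
          convert this using 2
          ext ⟨a, b⟩; simp; tauto
        · intro hpos
          have hpos : ρ.narr aZr 0 i = 0 := by simpa [NExp.eval, hρ] using hpos
          refine (WP.block (T := 1) ?_).mono (by omega) fun _ h => h
          obtain ⟨X', W', hX', hW', hr', hX₀, hcase⟩ := hI
          refine ⟨X', W', hX', hW', hr', hX₀, ?_⟩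
          rcases hcase with ⟨h5, h6, h7, h8⟩ | h5
          · refine Or.inl ⟨h5, h6, h7, ?_⟩
            intro i' j' hD hiX' hjC hA
            simp only [Finset.mem_product, Finset.mem_insert] at hD
            rcases hD with ⟨rfl | hD, hjV⟩
            · exact absurd hpos ((hX'.2 _ hi).2 hiX')
            · exact h8 i' j' (by simp [hD, hjV]) hiX' hjC hA
          · exact Or.inr h5
      · ring_nf; omega
      · rintro ρ ⟨X', W', hX', hW', hr', hX₀, hcase⟩
        have hWR := hr'.card_le hm
        refine ⟨_, ?_, X', W', hX', hW', hr', ?_, rfl⟩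
        · rcases hcase with ⟨h5, h6, h7, h8⟩ | ⟨h5, h6⟩
          · simp [h5, h7, hk, hb]
          · simp [h5, hk, hb]; omega
        · intro h0 i hi j hj hA
          rcases hcase with ⟨h5, h6, h7, h8⟩ | ⟨h5, h6⟩
          · exact h8 i j (by simp [hX'.1 hi, h.flagC.1 hj]) hi hj hA
          · exact absurd h0 h5
    · refine ⟨ab, ∅, by rwa [Flags, h2], ⟨by simp, ?_⟩, AltReach.init hm.ab_sub, ?_, ?_⟩
      · intro j hj; simp [h2, hzc j hj]
      · simp [h1]
      · simp [h1]
    · simp [Test.cost, Test.pos, NExp.cost]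
    · rintro υ ⟨⟨k, X, W, hX, hW, hr, hcl, hk⟩, hb⟩
      refine ⟨X, W, G, hX, hW, hr, hcl ?_⟩
      simpa [NExp.eval] using hb
  · have : (R.card + 1) * (4 + (2 + (U.card * (V.card * 54 + 30) + 8))) ≤
      (U.card + 1) * (4 + (2 + (U.card * (V.card * 54 + 30) + 8))) := by gcongr
    nlinarith [Nat.zero_le (U.card * V.card), Nat.zero_le V.card, Nat.zero_le U.card,
      Nat.zero_le (U.card * U.card), Nat.zero_le (U.card * U.card * V.card)]

/-- The computation of `HK`. -/
def hkAll : Cmd := clearArrays ;; matchAll ;; reachAll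

theorem wp_hkAll (h : Ctx A U R V C σ) :
    WP hkAll σ ((U.card + 3) ^ 2 * (V.card + 2) * 200) fun τ =>
      (∀ i ∈ U, τ.narr aKer 0 i = 0 ∧ τ.narr aUsed 0 i = 0) ∧ (∀ j ∈ V, τ.narr aPiv 0 j = 0) ∧
      ∃ X W, Flags τ aZr U X ∧ Flags τ aZc V W ∧ X ⊆ R ∧ IsHK A R C (R \ X) W := by
  refine WP.seq (T₂ := (U.card + 3) ^ 2 * (V.card * 50 + 80) +
    (U.card + 2) ^ 2 * (V.card * 54 + 100)) (wp_clearArrays h) ?_ ?_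
  · rintro τ ⟨hτ1, hτ2⟩ hs
    have h' := h.of_same hs
    refine WP.seq (wp_matchAll h' (fun i hi => (hτ1 i hi).1)
      fun j hj => ⟨(hτ2 j hj).1, (hτ2 j hj).2.1⟩) ?_ le_rfl
    rintro υ ⟨ab, hfl, hst⟩ hs'
    have h'' := h'.of_same hs'
    refine (wp_reachAll h'' (by have := Finset.card_le_card h.flagR.1; omega) (fun j => rfl) hst hfl
      ?_).same.mono le_rfl ?_
    · intro j hj
      rw [hs'.narr aZc rfl]; exact (hτ2 j hj).2.2.1
    · rintro ω ⟨⟨X, W, G, hX, hW, hr, hcl⟩, hsω⟩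
      rw [hsω.narr aKer rfl, hsω.narr aUsed rfl, hsω.narr aPiv rfl, hs'.narr aKer rfl,
        hs'.narr aUsed rfl, hs'.narr aPiv rfl]
      exact ⟨fun i hi => (hτ1 i hi).2, fun j hj => (hτ2 j hj).2.2.2, X, W, hX, hW, hr.subR,
        isHK_of_altReach hst h.flagR.1 hr hcl⟩
  · nlinarith [Nat.zero_le (U.card * V.card), Nat.zero_le V.card, Nat.zero_le U.card,
      Nat.zero_le (U.card * U.card), Nat.zero_le (U.card * U.card * V.card)]

end ClosureProgram

/-! ### Linear relations between rows -/

section Elimination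

variable {F : Type} [Field F] {s n : ℕ}

/-- A minor does not vanish if and only if there is no linear relation between its rows. -/
theorem det_orderEmb_ne_zero_iff {J : Matrix (Fin s) (Fin n) F} {R : Finset (Fin s)}
    {Y : Finset (Fin n)} (h : Y.card = R.card) :
    Matrix.det (J.submatrix (R.orderEmbOfFin rfl) (Y.orderEmbOfFin h)) ≠ 0 ↔
      ∀ c : Fin s → F, (∀ j ∈ Y, ∑ i ∈ R, c i * J i j = 0) → ∀ i ∈ R, c i = 0 := by
  classical
  have hsum : ∀ f : Fin s → F, ∑ k, f (R.orderEmbOfFin rfl k) = ∑ i ∈ R, f i := by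
    intro f
    have := Finset.sum_map Finset.univ (R.orderEmbOfFin rfl).toEmbedding f
    rw [Finset.map_orderEmbOfFin_univ] at this
    exact this.symm
  rw [Ne, ← Matrix.exists_vecMul_eq_zero_iff]
  constructor
  · intro hn c hc i hi
    by_contra hne
    refine hn ⟨fun k => c (R.orderEmbOfFin rfl k), ?_, ?_⟩
    · intro h0
      obtain ⟨k, hk⟩ : i ∈ Set.range (R.orderEmbOfFin rfl) := by
        rw [Finset.range_orderEmbOfFin]; exact hi
      exact hne (by rw [← hk]; exact congrFun h0 k)
    · ext k
      have := hc (Y.orderEmbOfFin h k) (Finset.orderEmbOfFin_mem _ _ _)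
      rw [← hsum fun i => c i * J i (Y.orderEmbOfFin h k)] at this
      simpa [Matrix.vecMul, dotProduct] using this
  · rintro hc ⟨v, hv, hv0⟩
    apply hv
    set c : Fin s → F := fun i => if hi : ∃ k, R.orderEmbOfFin rfl k = i then v hi.choose else 0
      with hcdef
    have hck : ∀ k, c (R.orderEmbOfFin rfl k) = v k := by
      intro k
      have hi : ∃ k', R.orderEmbOfFin rfl k' = R.orderEmbOfFin rfl k := ⟨k, rfl⟩
      simp only [hcdef, dif_pos hi]
      exact congrArg v ((R.orderEmbOfFin rfl).injective hi.choose_spec)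
    ext k
    rw [← hck k]
    refine hc c ?_ _ (Finset.orderEmbOfFin_mem _ _ _)
    intro j hj
    obtain ⟨l, rfl⟩ : j ∈ Set.range (Y.orderEmbOfFin h) := by
      rw [Finset.range_orderEmbOfFin]; exact hj
    rw [← hsum fun i => c i * J i (Y.orderEmbOfFin h l)]
    simp only [hck]
    simpa [Matrix.vecMul, dotProduct] using congrFun hv0 l

/-- The state of the elimination by operations on the columns: `M` is the transformed matrix,
column `j` is the pivot column of row `i` if `piv j = i + 1`, `P` are the rows that have been
considered, and `D` those that have a pivot. -/
structure ElimState (J : Matrix (Fin s) (Fin n) F) (R : Finset (Fin s)) (C : Finset (Fin n))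
    (M : Fin s → Fin n → F) (piv : Fin n → ℕ) (P D : Finset (Fin s)) : Prop where
  piv_mem : ∀ j ∈ C, piv j ≠ 0 → ∃ i ∈ D, piv j = i + 1 ∧ M i j ≠ 0 ∧
    ∀ j' ∈ C, j' ≠ j → M i j' = 0
  subR : D ⊆ R
  subP : D ⊆ P
  used : ∀ i ∈ D, ∃ j ∈ C, piv j = i + 1
  unused : ∀ i ∈ R, i ∈ P → i ∉ D → ∀ j ∈ C, piv j = 0 → M i j = 0
  rel_piv : ∀ c : Fin s → F, (∀ j ∈ C, piv j ≠ 0 → ∑ i ∈ R, c i * M i j = 0) ↔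
    (∀ j ∈ C, piv j ≠ 0 → ∑ i ∈ R, c i * J i j = 0)
  rel_rest : ∀ c : Fin s → F, (∀ j ∈ C, piv j ≠ 0 → ∑ i ∈ R, c i * M i j = 0) →
    ∀ j ∈ C, piv j = 0 → ∑ i ∈ R, c i * M i j = ∑ i ∈ R, c i * J i j

variable {J : Matrix (Fin s) (Fin n) F} {R : Finset (Fin s)} {C : Finset (Fin n)}
  {M : Fin s → Fin n → F} {piv : Fin n → ℕ} {P D : Finset (Fin s)}

theorem ElimState.init (h : ∀ j ∈ C, piv j = 0) (hM : ∀ i ∈ R, ∀ j ∈ C, M i j = J i j) :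
    ElimState J R C M piv ∅ ∅ where
  piv_mem j hj h' := absurd (h j hj) h'
  subR := by simp
  subP := by simp
  used := by simp
  unused := by simp
  rel_piv c := ⟨fun _ j hj h' => absurd (h j hj) h', fun _ j hj h' => absurd (h j hj) h'⟩
  rel_rest c _ j hj _ := Finset.sum_congr rfl fun i hi => by rw [hM i hi j hj]

theorem ElimState.skip (h : ElimState J R C M piv P D) {i : Fin s}
    (hi : i ∈ R → ∀ j ∈ C, piv j = 0 → M i j = 0) : ElimState J R C M piv (insert i P) D where
  piv_mem := h.piv_mem
  subR := h.subR
  subP := h.subP.trans (Finset.subset_insert _ _)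
  used := h.used
  unused i' h1 h2 h3 := by
    rcases Finset.mem_insert.1 h2 with rfl | h2
    · exact hi h1
    · exact h.unused i' h1 h2 h3
  rel_piv := h.rel_piv
  rel_rest := h.rel_rest

/-- Multiples of column `b` are subtracted from all other columns to clear row `i`. Rows with an
earlier pivot, and rows found to have none, vanish in column `b` and do not change (`hrow`). Earlier
pivot columns may change, but a combination of rows that vanishes on column `b` takes the same
values before and after (`hdot`). -/
theorem ElimState.pivot (h : ElimState J R C M piv P D) {i : Fin s} {b : Fin n}
    {M' : Fin s → Fin n → F} {piv' : Fin n → ℕ} (hi : i ∈ R) (hP : i ∉ P)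
    (hb : b ∈ C) (hb0 : piv b = 0) (hMb : M i b ≠ 0) (hpb : piv' b = i + 1)
    (hp : ∀ j, j ≠ b → piv' j = piv j) (hM'b : ∀ i' ∈ R, M' i' b = M i' b)
    (hM' : ∀ i' ∈ R, ∀ j ∈ C, j ≠ b → M' i' j = M i' j - M i j / M i b * M i' b) :
    ElimState J R C M' piv' (insert i P) (insert i D) := by
  have hrow : ∀ i' ∈ R, M i' b = 0 → ∀ j ∈ C, M' i' j = M i' j := by
    intro i' hi' h0 j hj
    by_cases hjb : j = b
    · subst hjb; exact hM'b i' hi'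
    · rw [hM' i' hi' j hj hjb, h0]; ring
  have hdot : ∀ (c : Fin s → F), ∑ k ∈ R, c k * M k b = 0 → ∀ j ∈ C,
      ∑ k ∈ R, c k * M' k j = ∑ k ∈ R, c k * M k j := by
    intro c hc j hj
    by_cases hjb : j = b
    · subst hjb
      exact Finset.sum_congr rfl fun k hk => by rw [hM'b k hk]
    · have : ∑ k ∈ R, c k * M' k j =
          ∑ k ∈ R, c k * M k j - M i j / M i b * ∑ k ∈ R, c k * M k b := by
        rw [Finset.mul_sum, ← Finset.sum_sub_distrib]
        exact Finset.sum_congr rfl fun k hk => by rw [hM' k hk j hj hjb]; ring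
      rw [this, hc]; ring
  have hdotb : ∀ (c : Fin s → F), ∑ k ∈ R, c k * M' k b = ∑ k ∈ R, c k * M k b := fun c =>
    Finset.sum_congr rfl fun k hk => by rw [hM'b k hk]
  have hpne : piv' b ≠ 0 := by omega
  constructor
  · intro j hj hj0
    by_cases hjb : j = b
    · subst hjb
      refine ⟨i, by simp, hpb, by rwa [hM'b i hi], ?_⟩
      intro j' hj' hne
      rw [hM' i hi j' hj' hne]; field_simp; ring
    · rw [hp j hjb] at hj0 ⊢
      obtain ⟨p, h1, h2, h3, h4⟩ := h.piv_mem j hj hj0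
      have h5 : M p b = 0 := h4 b hb (Ne.symm hjb)
      refine ⟨p, by simp [h1], h2, ?_, ?_⟩
      · rwa [hrow p (h.subR h1) h5 j hj]
      · intro j' hj' hne
        rw [hrow p (h.subR h1) h5 j' hj']
        exact h4 j' hj' hne
  · exact Finset.insert_subset hi h.subR
  · exact Finset.insert_subset_insert _ h.subP
  · intro i' hi'
    rcases Finset.mem_insert.1 hi' with rfl | hi'
    · exact ⟨b, hb, hpb⟩
    · obtain ⟨j, hj, h1⟩ := h.used i' hi'
      have : j ≠ b := by rintro rfl; omega
      exact ⟨j, hj, by rw [hp j this, h1]⟩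
  · intro i' h1 h2 h3 j hj h0
    simp only [Finset.mem_insert, not_or] at h2 h3
    have h2' := h2.resolve_left h3.1
    have hjb : j ≠ b := by rintro rfl; omega
    rw [hrow i' h1 (h.unused i' h1 h2' h3.2 b hb hb0) j hj]
    exact h.unused i' h1 h2' h3.2 j hj (by rwa [hp j hjb] at h0)
  · intro c
    constructor
    · intro hc
      have hcb : ∑ k ∈ R, c k * M k b = 0 := by rw [← hdotb]; exact hc b hb hpne
      have hc' : ∀ j ∈ C, piv j ≠ 0 → ∑ k ∈ R, c k * M k j = 0 := by
        intro j hj h0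
        have hjb : j ≠ b := by rintro rfl; omega
        rw [← hdot c hcb j hj]
        exact hc j hj (by rwa [hp j hjb])
      intro j hj h0
      by_cases hjb : j = b
      · subst hjb
        rw [← h.rel_rest c hc' j hj hb0, hcb]
      · rw [hp j hjb] at h0
        exact (h.rel_piv c).1 hc' j hj h0
    · intro hc
      have hc' : ∀ j ∈ C, piv j ≠ 0 → ∑ k ∈ R, c k * M k j = 0 := by
        refine (h.rel_piv c).2 fun j hj h0 => ?_
        have hjb : j ≠ b := by rintro rfl; omega
        exact hc j hj (by rwa [hp j hjb])
      have hcb : ∑ k ∈ R, c k * M k b = 0 := by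
        rw [h.rel_rest c hc' b hb hb0]; exact hc b hb hpne
      intro j hj h0
      rw [hdot c hcb j hj]
      by_cases hjb : j = b
      · subst hjb; exact hcb
      · rw [hp j hjb] at h0
        exact hc' j hj h0
  · intro c hc j hj h0
    have hcb : ∑ k ∈ R, c k * M k b = 0 := by rw [← hdotb]; exact hc b hb hpne
    have hc' : ∀ j ∈ C, piv j ≠ 0 → ∑ k ∈ R, c k * M k j = 0 := by
      intro j hj h0
      have hjb : j ≠ b := by rintro rfl; omega
      rw [← hdot c hcb j hj]
      exact hc j hj (by rwa [hp j hjb])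
    have hjb : j ≠ b := by rintro rfl; omega
    rw [hdot c hcb j hj]
    exact h.rel_rest c hc' j hj (by rwa [hp j hjb] at h0)

/-- The two invariants combine to the usual fact that column operations preserve the relations
between rows. They are kept apart because `rel_piv` compares the pivot columns of `M` and `J` alone,
which is what the minor in `ElimState.pivot_columns` requires. -/
theorem ElimState.relation_iff (h : ElimState J R C M piv P D) (c : Fin s → F) :
    (∀ j ∈ C, ∑ i ∈ R, c i * M i j = 0) ↔ ∀ j ∈ C, ∑ i ∈ R, c i * J i j = 0 := by
  constructor
  · intro hc j hj
    by_cases h0 : piv j = 0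
    · rw [← h.rel_rest c (fun j hj _ => hc j hj) j hj h0]; exact hc j hj
    · exact (h.rel_piv c).1 (fun j hj _ => hc j hj) j hj h0
  · intro hc j hj
    have hc' := (h.rel_piv c).2 (fun j hj _ => hc j hj)
    by_cases h0 : piv j = 0
    · rw [h.rel_rest c hc' j hj h0]; exact hc j hj
    · exact hc' j hj h0

/-- A linear combination of rows of `M`, evaluated at the pivot column of row `p`. -/
theorem ElimState.dot_pivot (h : ElimState J R C M piv P D) (c : Fin s → F) {j : Fin n}
    (hj : j ∈ C) {p : Fin s} (hp : piv j = p + 1) :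
    ∑ i ∈ R, c i * M i j = c p * M p j + ∑ i ∈ R \ D, c i * M i j := by
  classical
  have hpD : p ∈ D := by
    obtain ⟨i, h1, h2, -⟩ := h.piv_mem j hj (by omega)
    have : p = i := by ext; omega
    rwa [this]
  rw [← Finset.sum_sdiff h.subR, add_comm]
  congr 1
  refine Finset.sum_eq_single_of_mem p hpD fun k hk hkp => ?_
  obtain ⟨j', hj', h1⟩ := h.used k hk
  obtain ⟨i, h2, h3, h4, h5⟩ := h.piv_mem j' hj' (by omega)
  have hik : i = k := by ext; omega
  subst hik
  rw [h5 j hj, mul_zero]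
  rintro rfl
  exact hkp (by ext; omega)

/-- A row without a pivot is zero outside the pivot columns, so it is the combination of the pivot
rows with coefficients `M i (col k) / M k (col k)`. -/
theorem ElimState.exists_relation (h : ElimState J R C M piv P D) (hP : R ⊆ P) {i : Fin s}
    (hi : i ∈ R) (hiD : i ∉ D) : ∃ c, IsRowRelation J R C c ∧ c i ≠ 0 ∧
      ∀ j ∈ C, ∀ p : Fin s, piv j = p + 1 → M i j ≠ 0 → c p ≠ 0 := by
  classical
  -- `choose!` requires an inhabited type of columns; if there is none, the indicator of row `i` is
  -- a relation.
  rcases isEmpty_or_nonempty (Fin n) with hn | hn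
  · exact ⟨fun k => if k = i then 1 else 0,
      ⟨fun k hk => if_neg (by rintro rfl; exact hk hi), fun j => isEmptyElim j⟩, by simp,
      fun j => isEmptyElim j⟩
  choose! col hcol hpcol using h.used
  have hMcol : ∀ k ∈ D, M k (col k) ≠ 0 ∧ ∀ j' ∈ C, j' ≠ col k → M k j' = 0 := by
    intro k hk
    obtain ⟨i', h2, h3, h4, h5⟩ := h.piv_mem _ (hcol k hk) (by have := hpcol k hk; omega)
    have hik : i' = k := by ext; have := hpcol k hk; omega
    subst hik
    exact ⟨h4, h5⟩
  set c : Fin s → F := fun k => if k = i then 1 else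
    if k ∈ D then -(M i (col k) / M k (col k)) else 0 with hc
  have hcD : ∀ k ∈ D, c k = -(M i (col k) / M k (col k)) := by
    intro k hk
    have : k ≠ i := by rintro rfl; exact hiD hk
    simp [hc, this, hk]
  have hrest : ∀ j, ∑ k ∈ R \ D, c k * M k j = M i j := by
    intro j
    rw [Finset.sum_eq_single_of_mem i (Finset.mem_sdiff.2 ⟨hi, hiD⟩)]
    · simp [hc]
    · intro k hk hki
      simp [hc, hki, (Finset.mem_sdiff.1 hk).2]
  refine ⟨c, ⟨?_, ?_⟩, by simp [hc], ?_⟩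
  · intro k hk
    have h1 : k ≠ i := by rintro rfl; exact hk hi
    have h2 : k ∉ D := fun h' => hk (h.subR h')
    simp [hc, h1, h2]
  · refine (h.relation_iff c).1 fun j hj => ?_
    by_cases h0 : piv j = 0
    · rw [← Finset.sum_sdiff h.subR, hrest, h.unused i hi (hP hi) hiD j hj h0, zero_add]
      refine Finset.sum_eq_zero fun k hk => ?_
      have : j ≠ col k := by rintro rfl; have := hpcol k hk; omega
      rw [(hMcol k hk).2 j hj this, mul_zero]
    · obtain ⟨p, h1, h2, h3, h4⟩ := h.piv_mem j hj h0
      rw [h.dot_pivot c hj h2, hrest, hcD p h1]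
      have : j = col p := by
        by_contra hne
        exact h3 ((hMcol p h1).2 j hj hne)
      rw [← this]
      field_simp; ring
  · intro j hj p hp hne
    obtain ⟨p', h1, h2, h3, h4⟩ := h.piv_mem j hj (by omega)
    have : p' = p := by ext; omega
    subst this
    rw [hcD p' h1]
    have : j = col p' := by
      by_contra hne
      exact h3 ((hMcol p' h1).2 j hj hne)
    rw [← this]
    exact neg_ne_zero.2 (div_ne_zero hne h3)

/-- The relations of `ElimState.exists_relation` show that the listed rows occur. Conversely, in the
pivot column of a row `k` with `c k ≠ 0`, the term of row `k` must be cancelled by rows without a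
pivot, one of which is therefore nonzero there. -/
theorem ElimState.mem_rowSupport (h : ElimState J R C M piv P D) (hP : R ⊆ P) (k : Fin s) :
    k ∈ rowSupport J R C ↔ (k ∈ R ∧ k ∉ D) ∨
      ∃ i ∈ R, i ∉ D ∧ ∃ j ∈ C, piv j = k + 1 ∧ M i j ≠ 0 := by
  classical
  simp only [rowSupport, Finset.mem_filter]
  constructor
  · rintro ⟨hk, c, hc, hck⟩
    by_cases hkD : k ∈ D
    · right
      obtain ⟨j, hj, h1⟩ := h.used k hkD
      have h2 := (h.relation_iff c).2 hc.2 j hj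
      rw [h.dot_pivot c hj h1] at h2
      obtain ⟨k', h3, h4, h5, -⟩ := h.piv_mem j hj (by omega)
      have : k' = k := by ext; omega
      subst this
      have h6 : ∑ i ∈ R \ D, c i * M i j ≠ 0 := by
        intro h0
        rw [h0, add_zero] at h2
        exact (mul_ne_zero hck h5) h2
      obtain ⟨i, hi, hne⟩ := Finset.exists_ne_zero_of_sum_ne_zero h6
      obtain ⟨h7, h8⟩ := Finset.mem_sdiff.1 hi
      exact ⟨i, h7, h8, j, hj, h1, fun h0 => hne (by rw [h0, mul_zero])⟩
    · exact Or.inl ⟨hk, hkD⟩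
  · rintro (⟨hk, hkD⟩ | ⟨i, hi, hiD, j, hj, hp, hne⟩)
    · obtain ⟨c, h1, h2, -⟩ := h.exists_relation hP hk hkD
      exact ⟨hk, c, h1, h2⟩
    · obtain ⟨c, h1, -, h3⟩ := h.exists_relation hP hi hiD
      obtain ⟨k', h4, h5, -⟩ := h.piv_mem j hj (by omega)
      have : k' = k := by ext; omega
      subst this
      exact ⟨h.subR h4, c, h1, h3 j hj k' hp hne⟩

/-- If the support is empty, all rows have a pivot. A relation on the pivot columns of `J` becomes
one on those of `M`, where each column has a single nonzero entry among the rows `R`. -/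
theorem ElimState.pivot_columns (h : ElimState J R C M piv P D) (hP : R ⊆ P)
    (hs : rowSupport J R C = ∅) {Y : Finset (Fin n)} (hY : ∀ j, j ∈ Y ↔ j ∈ C ∧ piv j ≠ 0) :
    ∃ hcard : Y.card = R.card,
      Matrix.det (J.submatrix (R.orderEmbOfFin rfl) (Y.orderEmbOfFin hcard)) ≠ 0 := by
  classical
  have hD : D = R := by
    refine h.subR.antisymm fun k hk => ?_
    by_contra hkD
    have := (h.mem_rowSupport hP k).2 (Or.inl ⟨hk, hkD⟩)
    simp [hs] at this
  have hcard : Y.card = R.card := by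
    have h1 : Y.card ≤ (R.image fun i : Fin s => (i : ℕ) + 1).card := by
      apply Finset.card_le_card_of_injOn piv
      · intro j hj
        obtain ⟨h1, h2⟩ := (hY j).1 hj
        obtain ⟨i, h3, h4, -⟩ := h.piv_mem j h1 h2
        simp only [Finset.coe_image, Set.mem_image]
        exact ⟨i, h.subR h3, h4.symm⟩
      · intro j hj j' hj' e
        obtain ⟨h1, h2⟩ := (hY j).1 hj
        obtain ⟨h1', h2'⟩ := (hY j').1 hj'
        obtain ⟨i, h3, h4, h5, h6⟩ := h.piv_mem j h1 h2
        obtain ⟨i', h3', h4', h5', h6'⟩ := h.piv_mem j' h1' h2'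
        have : i' = i := by ext; omega
        subst this
        by_contra hne
        exact h5' (h6 j' h1' (Ne.symm hne))
    have h2 : (R.image fun i : Fin s => (i : ℕ) + 1) ⊆ Y.image piv := by
      intro k hk
      obtain ⟨i, hi, rfl⟩ := Finset.mem_image.1 hk
      obtain ⟨j, hj, h1⟩ := h.used i (hD ▸ hi)
      exact Finset.mem_image.2 ⟨j, (hY j).2 ⟨hj, by omega⟩, h1⟩
    have h3 := (Finset.card_le_card h2).trans Finset.card_image_le
    have h4 : (R.image fun i : Fin s => (i : ℕ) + 1).card = R.card :=
      Finset.card_image_of_injective _ fun i i' e => by ext; simpa using e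
    omega
  refine ⟨hcard, (det_orderEmb_ne_zero_iff hcard).2 fun c hc i hi => ?_⟩
  obtain ⟨j, hj, h1⟩ := h.used i (hD ▸ hi)
  have h2 := (h.rel_piv c).2 (fun j hj h0 => hc j ((hY j).2 ⟨hj, h0⟩)) j hj (by omega)
  rw [h.dot_pivot c hj h1, hD] at h2
  obtain ⟨i', h3, h4, h5, -⟩ := h.piv_mem j hj (by omega)
  have : i' = i := by ext; omega
  subst this
  simpa [h5] using h2

end Elimination

/-! ### Programs for the elimination and the kernel supports -/

section KernelProgram

set_option linter.unusedSectionVars false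

variable {F : Type} [Field F] {s n : ℕ}

/-- Removal of the rows marked in the array `a`. -/
def removeRows (a : ℕ) : Cmd :=
  Cmd.forRows (.ite (.conj (.pos (.get1 a (.var vI))) (.pos (.get1 aR' (.var vI))))
    (.put1 aR' (.var vI) (.const 0) ;; .setN vChanged (.const 1)) .skip)

/-- Removal of the columns marked in the array `a`. -/
def removeCols (a : ℕ) : Cmd :=
  Cmd.forCols (.ite (.conj (.pos (.get1 a (.var vJ))) (.pos (.get1 aC' (.var vJ))))
    (.put1 aC' (.var vJ) (.const 0) ;; .setN vChanged (.const 1)) .skip)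

/-- Marking of the columns with a zero in a row of the kernel support. -/
def markCols : Cmd :=
  Cmd.forCols (.put1 aZc (.var vJ) (.const 0) ;;
    Cmd.forRows (.ite (.conj (.pos (.get1 aKer (.var vI)))
        (.eqc (.get aOrd (.var vI) (.var vJ)) 1))
      (.put1 aZc (.var vJ) (.const 1)) .skip))

/-- Copy of the submatrix of the Jacobian matrix. -/
def copyJac : Cmd :=
  Cmd.forRows (Cmd.forCols (.putF 1 (.var vI) (.var vJ) (.get 0 (.var vI) (.var vJ))))

/-- Search for a pivot in row `vI`. -/
def findPivot : Cmd :=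
  Cmd.forCols (.ite (.conj (.pos (.get1 aC' (.var vJ))) (.conj
      (.le (.get1 aPiv (.var vJ)) (.const 0))
      (.neg (.isZero (.get 1 (.var vI) (.var vJ))))))
    (.setN vPiv (.plus (.var vJ) (.const 1))) .skip)

/-- Elimination of the entries of row `vI` that are not in column `vPiv`. -/
def clearRow : Cmd :=
  Cmd.forCols (.ite (.neg (.conj (.le (.var vJ) (.var vPiv)) (.le (.var vPiv) (.var vJ))))
    (.setF 0 (.divide (.get 1 (.var vI) (.var vJ)) (.get 1 (.var vI) (.var vPiv))) ;;
      Cmd.forEach vPtr vNumU aRows vBest (.putF 1 (.var vBest) (.var vJ)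
        (.minus (.get 1 (.var vBest) (.var vJ))
          (.times (.var 0) (.get 1 (.var vBest) (.var vPiv)))))) .skip)

/-- Elimination by operations on the columns. -/
def eliminate : Cmd :=
  Cmd.forRows (.ite (.pos (.get1 aR' (.var vI)))
    (.setN vPiv (.const 0) ;; findPivot ;;
      .ite (.pos (.var vPiv))
        ((.put1 aUsed (.var vI) (.const 1) ;; .setN vPiv (.minus (.var vPiv) (.const 1)) ;;
          .put1 aPiv (.var vPiv) (.plus (.var vI) (.const 1))) ;; clearRow)
        .skip)
    .skip)

/-- Marking of the rows of the kernel support. -/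
def markKernel : Cmd :=
  Cmd.forRows (.ite (.conj (.pos (.get1 aR' (.var vI))) (.le (.get1 aUsed (.var vI)) (.const 0)))
    (.put1 aKer (.var vI) (.const 1) ;;
      Cmd.forCols (.ite (.conj (.pos (.get1 aC' (.var vJ))) (.conj (.pos (.get1 aPiv (.var vJ)))
          (.neg (.isZero (.get 1 (.var vI) (.var vJ))))))
        (.put1 aKer (.minus (.get1 aPiv (.var vJ)) (.const 1)) (.const 1)) .skip))
    .skip)

variable {A : Matrix (Fin s) (Fin n) (WithBot ℕ)} {J : Matrix (Fin s) (Fin n) F}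
  {U R : Finset (Fin s)} {V C : Finset (Fin n)} {σ : Store F}

/-- `vChanged` is only ever raised, and only when a row is actually lost; after several removals it
is still zero exactly if all of them were trivial. -/
theorem wp_removeRows (h : Ctx A U R V C σ) {a : ℕ} {X : Finset (Fin s)} (hX : Flags σ a U X)
    (ha : a ≠ aR') :
    WP (removeRows a) σ (U.card * 40 + 8) fun τ => Ctx A U (R \ X) V C τ ∧
      (τ.nvar vChanged = 0 ↔ σ.nvar vChanged = 0 ∧ R \ X = R) := by
  classical
  refine (WP.forEach (T := 26) (fun S τ => Flags τ aR' U (R \ (X ∩ S)) ∧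
      (τ.nvar vChanged = 0 ↔ σ.nvar vChanged = 0 ∧ ∀ i ∈ S, i ∈ R → i ∉ X))
    h.rows rfl rfl rfl (by decide) (by decide) (by decide) ?_ ?_ ?_ (by omega)).same.mono le_rfl ?_
  · intro S τ v w h; simpa [Store.setN, Flags] using h
  · simpa using h.flagR
  · rintro S hS i hi hiS τ ⟨hR, hch⟩ hτ hs
    refine WP.block ?_ rfl (by simp [Cmd.maxCost, Test.cost, Test.pos, NExp.cost])
    have e1 : τ.narr a = σ.narr a := hs.narr a (by
      simp [Cmd.forEach, Cmd.loop, Cmd.writesNArr, ha])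
    simp only [Cmd.run, Test.eval, Test.eval_pos, NExp.eval, hτ, e1, hX.2 i hi, hR.2 i hi]
    have hfi : ∀ k : Fin s, ((k : ℕ) = i) ↔ k = i := fun k => Fin.ext_iff.symm
    split_ifs with hc
    · have hiX := hc.1
      have hiR := (Finset.mem_sdiff.1 hc.2).1
      refine ⟨⟨Finset.sdiff_subset.trans h.flagR.1, ?_⟩, ?_⟩
      · intro k hk
        have := hR.2 k hk
        simp only [Finset.mem_sdiff, Finset.mem_inter] at this
        by_cases hki : k = i
        · subst hki
          simp [Store.setN, Store.putN, hiX]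
        · simp [Store.setN, Store.putN, hfi, hki, this]
      · simp only [Store.setN, Function.update_self, one_ne_zero, false_iff]
        rintro ⟨-, h2⟩
        exact h2 i (by simp) hiR hiX
    · refine ⟨⟨Finset.sdiff_subset.trans h.flagR.1, ?_⟩, ?_⟩
      · intro k hk
        rw [hR.2 k hk]
        simp only [Finset.mem_sdiff, Finset.mem_inter, Finset.mem_insert]
        by_cases hki : k = i
        · subst hki
          simp only [Finset.mem_sdiff, Finset.mem_inter] at hc
          tauto
        · simp [hki]
      · rw [hch]
        simp only [Finset.mem_sdiff, Finset.mem_inter] at hc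
        simp only [Finset.mem_insert, forall_eq_or_imp]
        tauto
  · rintro τ ⟨⟨hR, hch⟩, hs⟩
    have e : X ∩ U = X := Finset.inter_eq_left.2 hX.1
    rw [e] at hR
    refine ⟨⟨?_, ?_, ?_, hR, ?_⟩, ?_⟩
    · intro i j; rw [hs.narr aOrd rfl]; exact h.ord i j
    · rw [hs.nvar vNumU rfl]; exact h.rows.of_narr (hs.narr _ rfl)
    · rw [hs.nvar vNumV rfl]; exact h.cols.of_narr (hs.narr _ rfl)
    · exact h.flagC.of_narr (hs.narr _ rfl)
    · rw [hch, Finset.sdiff_eq_self_iff_disjoint, Finset.disjoint_left]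
      exact and_congr_right fun _ => ⟨fun h' i hi => h' i (h.flagR.1 hi) hi, fun h' i _ hi => h' hi⟩

theorem wp_removeCols (h : Ctx A U R V C σ) {a : ℕ} {X : Finset (Fin n)} (hX : Flags σ a V X)
    (ha : a ≠ aC') :
    WP (removeCols a) σ (V.card * 40 + 8) fun τ => Ctx A U R V (C \ X) τ ∧
      (τ.nvar vChanged = 0 ↔ σ.nvar vChanged = 0 ∧ C \ X = C) := by
  classical
  refine (WP.forEach (T := 26) (fun S τ => Flags τ aC' V (C \ (X ∩ S)) ∧
      (τ.nvar vChanged = 0 ↔ σ.nvar vChanged = 0 ∧ ∀ i ∈ S, i ∈ C → i ∉ X))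
    h.cols rfl rfl rfl (by decide) (by decide) (by decide) ?_ ?_ ?_ (by omega)).same.mono le_rfl ?_
  · intro S τ v w h; simpa [Store.setN, Flags] using h
  · simpa using h.flagC
  · rintro S hS i hi hiS τ ⟨hR, hch⟩ hτ hs
    refine WP.block ?_ rfl (by simp [Cmd.maxCost, Test.cost, Test.pos, NExp.cost])
    have e1 : τ.narr a = σ.narr a := hs.narr a (by
      simp [Cmd.forEach, Cmd.loop, Cmd.writesNArr, ha])
    simp only [Cmd.run, Test.eval, Test.eval_pos, NExp.eval, hτ, e1, hX.2 i hi, hR.2 i hi]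
    have hfi : ∀ k : Fin n, ((k : ℕ) = i) ↔ k = i := fun k => Fin.ext_iff.symm
    split_ifs with hc
    · have hiX := hc.1
      have hiR := (Finset.mem_sdiff.1 hc.2).1
      refine ⟨⟨Finset.sdiff_subset.trans h.flagC.1, ?_⟩, ?_⟩
      · intro k hk
        have := hR.2 k hk
        simp only [Finset.mem_sdiff, Finset.mem_inter] at this
        by_cases hki : k = i
        · subst hki
          simp [Store.setN, Store.putN, hiX]
        · simp [Store.setN, Store.putN, hfi, hki, this]
      · simp only [Store.setN, Function.update_self, one_ne_zero, false_iff]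
        rintro ⟨-, h2⟩
        exact h2 i (by simp) hiR hiX
    · refine ⟨⟨Finset.sdiff_subset.trans h.flagC.1, ?_⟩, ?_⟩
      · intro k hk
        rw [hR.2 k hk]
        simp only [Finset.mem_sdiff, Finset.mem_inter, Finset.mem_insert]
        by_cases hki : k = i
        · subst hki
          simp only [Finset.mem_sdiff, Finset.mem_inter] at hc
          tauto
        · simp [hki]
      · rw [hch]
        simp only [Finset.mem_sdiff, Finset.mem_inter] at hc
        simp only [Finset.mem_insert, forall_eq_or_imp]
        tauto
  · rintro τ ⟨⟨hR, hch⟩, hs⟩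
    have e : X ∩ V = X := Finset.inter_eq_left.2 hX.1
    rw [e] at hR
    refine ⟨⟨?_, ?_, ?_, ?_, hR⟩, ?_⟩
    · intro i j; rw [hs.narr aOrd rfl]; exact h.ord i j
    · rw [hs.nvar vNumU rfl]; exact h.rows.of_narr (hs.narr _ rfl)
    · rw [hs.nvar vNumV rfl]; exact h.cols.of_narr (hs.narr _ rfl)
    · exact h.flagR.of_narr (hs.narr _ rfl)
    · rw [hch, Finset.sdiff_eq_self_iff_disjoint, Finset.disjoint_left]
      exact and_congr_right fun _ => ⟨fun h' i hi => h' i (h.flagC.1 hi) hi, fun h' i _ hi => h' hi⟩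

open Classical in
-- The array `aZc`, which held the columns `C₀` of `HK`, is overwritten. Columns are marked in all
-- of `V`, whether or not they are still present.
theorem wp_markCols (h : Ctx A U R V C σ) {K : Finset (Fin s)} (hK : Flags σ aKer U K) :
    WP markCols σ (V.card * (U.card * 40 + 40) + 8) fun τ =>
      Flags τ aZc V (V.filter fun j => ∃ i ∈ K, A i j = 0) := by
  refine (WP.forEach (T := U.card * 40 + 20) (fun S τ => ∀ j ∈ S,
      (τ.narr aZc 0 j ≠ 0 ↔ ∃ i ∈ K, A i j = 0))
    h.cols rfl rfl rfl (by decide) (by decide) (by decide) ?_ ?_ ?_ ?_).mono le_rfl ?_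
  · intro S τ v w h; simpa [Store.setN] using h
  · simp
  · rintro S hS j hj hjS τ hI hτ hs
    have h' := h.of_same hs
    have hfj : ∀ k : Fin n, ((k : ℕ) = j) ↔ k = j := fun k => Fin.ext_iff.symm
    refine WP.seq (T₁ := 10) (T₂ := U.card * 40 + 8) (Q₁ := fun υ => υ.nvar = τ.nvar ∧
      υ.narr aZc 0 j = 0 ∧ ∀ j' ∈ S, υ.narr aZc 0 j' = τ.narr aZc 0 j') (WP.block ?_) ?_ (by omega)
    · refine ⟨rfl, by simp [Cmd.run, Store.putN, NExp.eval, hτ], ?_⟩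
      intro j' hj'
      have : j' ≠ j := by rintro rfl; exact hjS hj'
      simp [Cmd.run, Store.putN, NExp.eval, hτ, hfj, this]
    rintro υ ⟨h1, h2, h3⟩ hs'
    have h'' := h'.of_same hs'
    refine (WP.forEach (T := 26) (fun S' ω =>
      (ω.narr aZc 0 j ≠ 0 ↔ ∃ i ∈ S', i ∈ K ∧ A i j = 0) ∧
        ∀ j' ∈ S, ω.narr aZc 0 j' = τ.narr aZc 0 j')
      h''.rows rfl rfl rfl (by decide) (by decide) (by decide) ?_ ?_ ?_ ?_).mono le_rfl ?_
    · intro S τ v w h; simpa [Store.setN] using h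
    · simpa [h2] using h3
    · rintro S' hS' i hi hiS' ω ⟨h4, h5⟩ hω hsω
      have hω' := h''.of_same hsω
      have e1 : ω.narr aKer = σ.narr aKer := by
        rw [hsω.narr aKer rfl, hs'.narr aKer rfl, hs.narr aKer rfl]
      have e2 : ω.nvar vJ = j := by rw [hsω.nvar vJ rfl, h1, hτ]
      refine WP.block ?_
      simp only [Cmd.run, Test.eval, Test.eval_pos, Test.eval_eqc, NExp.eval, hω, e1, e2,
        hω'.ord i j, code_eq_one, hK.2 i hi]
      split_ifs with hc
      · refine ⟨?_, ?_⟩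
        · simp only [Store.putN]
          simp [hc]
        · intro j' hj'
          have : j' ≠ j := by rintro rfl; exact hjS hj'
          simp [Store.putN, hfj, this, h5 j' hj']
      · refine ⟨?_, h5⟩
        rw [h4]
        simp [Finset.mem_insert, hc]
    · omega
    · rintro ω ⟨h4, h5⟩ j' hj'
      rcases Finset.mem_insert.1 hj' with rfl | hj'
      · rw [h4]
        exact ⟨fun ⟨i, _, h⟩ => ⟨i, h⟩, fun ⟨i, h⟩ => ⟨i, hK.1 h.1, h⟩⟩
      · rw [h5 j' hj']; exact hI j' hj'
  · ring_nf; omega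
  · intro τ hτ
    refine ⟨Finset.filter_subset _ _, fun j hj => ?_⟩
    rw [hτ j hj]
    simp [hj]

/-- Field array `0` contains the Jacobian matrix. -/
def HoldsJac (J : Matrix (Fin s) (Fin n) F) (σ : Store F) : Prop :=
  ∀ (i : Fin s) (j : Fin n), σ.farr 0 i j = J i j

theorem wp_copyJac (h : Ctx A U R V C σ) (hJ : HoldsJac J σ) :
    WP copyJac σ (U.card * (V.card * 30 + 30) + 8) fun τ =>
      ∀ i ∈ U, ∀ j ∈ V, τ.farr 1 i j = J i j := by
  refine (WP.forEach (T := V.card * 30 + 8) (fun S τ => (∀ i ∈ S, ∀ j ∈ V, τ.farr 1 i j = J i j) ∧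
      τ.farr 0 = σ.farr 0)
    h.rows rfl rfl rfl (by decide) (by decide) (by decide) ?_ ?_ ?_ ?_).mono le_rfl fun τ h => h.1
  · intro S τ v w h; simpa [Store.setN] using h
  · simp
  · rintro S hS i hi hiS τ ⟨hI, hF⟩ hτ hs
    have h' := h.of_same hs
    refine (WP.forEach (T := 16) (fun S' υ => (∀ i' ∈ S, ∀ j ∈ V, υ.farr 1 i' j = J i' j) ∧
      (∀ j ∈ S', υ.farr 1 i j = J i j) ∧ υ.farr 0 = σ.farr 0)
      h'.cols rfl rfl rfl (by decide) (by decide) (by decide) ?_ ?_ ?_ (by omega)).mono le_rfl ?_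
    · intro S τ v w h; simpa [Store.setN] using h
    · simpa [hF] using hI
    · rintro S' hS' j hj hjS' υ ⟨h1, h2, h3⟩ hυ hsυ
      have e2 : υ.nvar vI = i := by rw [hsυ.nvar vI rfl, hτ]
      have hfi : ∀ k : Fin s, ((k : ℕ) = i) ↔ k = i := fun k => Fin.ext_iff.symm
      have hfj : ∀ k : Fin n, ((k : ℕ) = j) ↔ k = j := fun k => Fin.ext_iff.symm
      refine WP.block ?_
      simp only [Cmd.run, NExp.eval, FExp.eval, hυ, e2, h3, hJ i j]
      refine ⟨?_, ?_, ?_⟩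
      · intro i' hi' j' hj'
        have : i' ≠ i := by rintro rfl; exact hiS hi'
        simp [Store.putF, hfi, this, h1 i' hi' j' hj']
      · intro j' hj'
        by_cases hjj : j' = j
        · simp [Store.putF, hjj]
        · simp [Store.putF, hfj, hjj, h2 j' ((Finset.mem_insert.1 hj').resolve_left hjj)]
      · funext a b; simp [Store.putF, h3]
    · rintro υ ⟨h1, h2, h3⟩
      refine ⟨?_, h3⟩
      intro i' hi'
      rcases Finset.mem_insert.1 hi' with rfl | hi'
      · exact h2
      · exact h1 i' hi'
  · ring_nf; omega

open Classical in
theorem wp_findPivot (h : Ctx A U R V C σ) {i : Fin s} (hi : σ.nvar vI = i)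
    (h0 : σ.nvar vPiv = 0) :
    WP findPivot σ (V.card * 50 + 8) fun τ =>
      (τ.nvar vPiv = 0 ∧ ∀ j ∈ C, σ.narr aPiv 0 j = 0 → σ.farr 1 i j = 0) ∨
      ∃ b ∈ C, τ.nvar vPiv = b + 1 ∧ σ.narr aPiv 0 b = 0 ∧ σ.farr 1 i b ≠ 0 := by
  refine (WP.forEach (T := 36) (fun S τ =>
      (τ.nvar vPiv = 0 ∧ ∀ j ∈ C, j ∈ S → σ.narr aPiv 0 j = 0 → σ.farr 1 i j = 0) ∨
      ∃ b ∈ C, τ.nvar vPiv = b + 1 ∧ σ.narr aPiv 0 b = 0 ∧ σ.farr 1 i b ≠ 0)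
    h.cols rfl rfl rfl (by decide) (by decide) (by decide) ?_ ?_ ?_ (by omega)).mono le_rfl ?_
  · intro S τ v w h; simpa [Store.setN] using h
  · left; simp [h0]
  · rintro S hS j hj hjS τ hI hτ hs
    have h' := h.of_same hs
    have e1 : τ.nvar vI = i := by rw [hs.nvar vI rfl, hi]
    refine WP.block ?_
    simp only [Cmd.run, Test.eval, Test.eval_pos, NExp.eval, FExp.eval, hτ, e1, h'.flagC.2 j hj,
      hs.narr aPiv rfl, hs.farr 1 rfl, Nat.le_zero]
    split_ifs with hc
    · exact Or.inr ⟨j, hc.1, by simp [Store.setN], hc.2.1, hc.2.2⟩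
    · rcases hI with ⟨h1, h2⟩ | hI
      · refine Or.inl ⟨h1, fun j' hj' hS' hp => ?_⟩
        rcases Finset.mem_insert.1 hS' with rfl | hS'
        · by_contra hne; exact hc ⟨hj', hp, hne⟩
        · exact h2 j' hj' hS' hp
      · exact Or.inr hI
  · rintro τ (⟨h1, h2⟩ | h1)
    · exact Or.inl ⟨h1, fun j hj => h2 j hj (h.flagC.1 hj)⟩
    · exact Or.inr h1

open Classical in
-- Column `b` is left alone, so the pivot and the column to be subtracted keep their initial values.
-- The factor for column `j` is stored in field variable `0` before the entry in row `i`, from which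
-- it is computed, is overwritten.
theorem wp_clearRow (h : Ctx A U R V C σ) {i : Fin s} {b : Fin n} (hi : σ.nvar vI = i)
    (hb : σ.nvar vPiv = b) (hiU : i ∈ U) :
    WP clearRow σ (V.card * (U.card * 40 + 60) + 8) fun τ => ∀ i' ∈ U,
      τ.farr 1 i' b = σ.farr 1 i' b ∧ ∀ j ∈ V, j ≠ b →
        τ.farr 1 i' j = σ.farr 1 i' j - σ.farr 1 i j / σ.farr 1 i b * σ.farr 1 i' b := by
  refine (WP.forEach (T := U.card * 40 + 40) (fun S τ => ∀ i' ∈ U, ∀ j : Fin n,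
      τ.farr 1 i' j = if j ∈ S ∧ j ≠ b then
        σ.farr 1 i' j - σ.farr 1 i j / σ.farr 1 i b * σ.farr 1 i' b else σ.farr 1 i' j)
    h.cols rfl rfl rfl (by decide) (by decide) (by decide) ?_ ?_ ?_ ?_).mono le_rfl ?_
  · intro S τ v w h; simpa [Store.setN] using h
  · simp
  · rintro S hS j hj hjS τ hI hτ hs
    have h' := h.of_same hs
    have e1 : τ.nvar vI = i := by rw [hs.nvar vI rfl, hi]
    have e2 : τ.nvar vPiv = b := by rw [hs.nvar vPiv rfl, hb]
    have hfj : ∀ k : Fin n, ((k : ℕ) = j) ↔ k = j := fun k => Fin.ext_iff.symm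
    refine WP.ite (T := U.card * 40 + 30) ?_ ?_ (by simp [Test.cost, NExp.cost]; omega)
    · intro hne
      have hne : j ≠ b := by
        rintro rfl
        simp [Test.eval, NExp.eval, hτ, e2] at hne
      refine WP.seq (T₁ := 10) (T₂ := U.card * 40 + 8) (Q₁ := fun υ => υ.nvar = τ.nvar ∧
        υ.farr = τ.farr ∧ υ.fvar 0 = σ.farr 1 i j / σ.farr 1 i b) (WP.block ?_) ?_ (by omega)
      · refine ⟨rfl, rfl, ?_⟩
        have h1 := hI i hiU j
        have h2 := hI i hiU b
        simp only [hjS, false_and, if_false] at h1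
        simp only [ne_eq, not_true_eq_false, and_false, if_false] at h2
        simp [Cmd.run, Store.setF, FExp.eval, NExp.eval, hτ, e1, e2, h1, h2]
      rintro υ ⟨h1, h2, h3⟩ hs'
      have h'' := h'.of_same hs'
      refine (WP.forEach (T := 26) (fun S' ω => ω.fvar 0 = σ.farr 1 i j / σ.farr 1 i b ∧
        ∀ i' ∈ U, ∀ j' : Fin n, ω.farr 1 i' j' = if (j' ∈ S ∧ j' ≠ b) ∨ (j' = j ∧ i' ∈ S') then
          σ.farr 1 i' j' - σ.farr 1 i j' / σ.farr 1 i b * σ.farr 1 i' b else σ.farr 1 i' j')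
        h''.rows rfl rfl rfl (by decide) (by decide) (by decide) ?_ ?_ ?_ (by omega)).mono le_rfl ?_
      · intro S τ v w h; simpa [Store.setN] using h
      · exact ⟨h3, by simpa [h2] using hI⟩
      · rintro S' hS' i' hi' hiS' ω ⟨h4, h5⟩ hω hsω
        have e3 : ω.nvar vJ = j := by rw [hsω.nvar vJ rfl, h1, hτ]
        have e4 : ω.nvar vPiv = b := by rw [hsω.nvar vPiv rfl, h1, e2]
        have hfi : ∀ k : Fin s, ((k : ℕ) = i') ↔ k = i' := fun k => Fin.ext_iff.symm
        refine WP.block ?_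
        have h6 := h5 i' hi' j
        have h7 := h5 i' hi' b
        simp only [hjS, false_and, hiS', and_false, or_self, if_false] at h6
        simp only [ne_eq, not_true_eq_false, and_false, false_or, hiS', if_false] at h7
        refine ⟨h4, fun k hk j' => ?_⟩
        simp only [Cmd.run, NExp.eval, FExp.eval, hω, e3, e4, h4, h6, h7, Store.putF, hfi, hfj,
          true_and]
        by_cases hjj : j' = j
        · subst hjj
          by_cases hki : k = i'
          · subst hki; simp
          · have := h5 k hk j'
            simp only [hjS, false_and, false_or, true_and] at this
            simp [hki, this, hjS]
        · have := h5 k hk j'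
          simp only [hjj, false_and, or_false] at this
          simp [hjj, this]
      · rintro ω ⟨h4, h5⟩ i' hi' j'
        rw [h5 i' hi' j']
        have : ((j' ∈ S ∧ j' ≠ b) ∨ (j' = j ∧ i' ∈ U)) ↔ (j' ∈ insert j S ∧ j' ≠ b) := by
          rw [Finset.mem_insert]
          constructor
          · rintro (h | ⟨rfl, -⟩)
            · exact ⟨Or.inr h.1, h.2⟩
            · exact ⟨Or.inl rfl, hne⟩
          · rintro ⟨rfl | h, h'⟩
            · exact Or.inr ⟨rfl, hi'⟩
            · exact Or.inl ⟨h, h'⟩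
        simp only [this]
    · intro he
      have he : j = b := by
        simp only [Test.eval, NExp.eval, hτ, e2, not_not] at he
        ext; omega
      subst he
      refine (WP.block (T := 1) ?_).mono (by omega) fun _ h => h
      intro i' hi' j'
      rw [Cmd.run, hI i' hi' j']
      have : (j' ∈ S ∧ j' ≠ j) ↔ (j' ∈ insert j S ∧ j' ≠ j) := by
        rw [Finset.mem_insert]; tauto
      simp only [this]
  · ring_nf; omega
  · intro τ hτ i' hi'
    refine ⟨by simp [hτ i' hi' b], fun j hj hne => ?_⟩
    rw [hτ i' hi' j, if_pos ⟨hj, hne⟩]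

open Classical in
-- Each row leads to one search for a pivot and at most one clearing of all of `U × V`, whence the
-- dominant term `U.card ^ 2 * V.card`. The operations on entries outside `(R, C)` are harmless, as
-- the state refers to `(R, C)` only.
theorem wp_eliminate (h : Ctx A U R V C σ) (hM : ∀ i ∈ U, ∀ j ∈ V, σ.farr 1 i j = J i j)
    (hp : ∀ j ∈ V, σ.narr aPiv 0 j = 0) (hu : ∀ i ∈ U, σ.narr aUsed 0 i = 0) :
    WP eliminate σ (U.card * (V.card * (U.card * 40 + 110) + 100) + 8) fun τ =>
      ∃ D, Flags τ aUsed U D ∧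
        ElimState J R C (fun i j => τ.farr 1 i j) (fun j => τ.narr aPiv 0 j) U D := by
  refine (WP.forEach (T := V.card * (U.card * 40 + 110) + 80) (fun S τ => ∃ D, Flags τ aUsed U D ∧
        ElimState J R C (fun i j => τ.farr 1 i j) (fun j => τ.narr aPiv 0 j) S D)
    h.rows rfl rfl rfl (by decide) (by decide) (by decide) ?_ ?_ ?_ ?_).mono le_rfl fun τ h => h
  · intro S τ v w h; simpa [Store.setN, Flags] using h
  · refine ⟨∅, ⟨by simp, fun i hi => by simp [hu i hi]⟩, ElimState.init ?_ ?_⟩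
    · exact fun j hj => hp j (h.flagC.1 hj)
    · exact fun i hi j hj => hM i (h.flagR.1 hi) j (h.flagC.1 hj)
  · rintro S hS i hi hiS τ ⟨D, hD, hst⟩ hτ hs
    have h' := h.of_same hs
    refine WP.ite (T := V.card * (U.card * 40 + 110) + 70) ?_ ?_
      (by simp [Test.cost, Test.pos, NExp.cost]; omega)
    · intro hiR
      have hiR : i ∈ R := by
        rw [← h'.flagR.2 i hi]
        simpa [NExp.eval, hτ] using hiR
      refine WP.seq (T₁ := 2) (T₂ := V.card * (U.card * 40 + 110) + 68) (Q₁ := fun υ =>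
        υ.nvar vI = i ∧ υ.nvar vPiv = 0 ∧ υ.narr = τ.narr ∧ υ.farr = τ.farr) (WP.block ?_) ?_
        (by omega)
      · exact ⟨by simp [Cmd.run, Store.setN, hτ], by simp [Cmd.run, Store.setN, NExp.eval], rfl, rfl⟩
      rintro υ ⟨h1, h2, h3, h4⟩ hs'
      have h'' := h'.of_same hs'
      refine WP.seq (T₁ := V.card * 50 + 8) (T₂ := V.card * (U.card * 40 + 60) + 60)
        (wp_findPivot h'' h1 h2) ?_ (by ring_nf; omega)
      rintro ω hω hsω
      have hω' := h''.of_same hsω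
      have e1 : ω.nvar vI = i := by rw [hsω.nvar vI rfl, h1]
      rw [h3, h4] at hω
      have e2 : ω.narr aPiv = τ.narr aPiv := by rw [hsω.narr aPiv rfl, h3]
      have e3 : ω.narr aUsed = τ.narr aUsed := by rw [hsω.narr aUsed rfl, h3]
      have e4 : ω.farr 1 = τ.farr 1 := by rw [hsω.farr 1 rfl, h4]
      refine WP.ite (T := V.card * (U.card * 40 + 60) + 50) ?_ ?_
        (by simp [Test.cost, Test.pos, NExp.cost]; omega)
      · intro hpos
        have hpos : ω.nvar vPiv ≠ 0 := by simpa [NExp.eval] using hpos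
        obtain ⟨b, hb, hb1, hb2, hb3⟩ := hω.resolve_left fun h => hpos h.1
        refine WP.seq (T₁ := 30) (T₂ := V.card * (U.card * 40 + 60) + 8) (Q₁ := fun ρ =>
          ρ.nvar vI = i ∧ ρ.nvar vPiv = b ∧ ρ.farr = ω.farr ∧
          Flags ρ aUsed U (insert i D) ∧ ρ.narr aPiv 0 b = i + 1 ∧
          ∀ j : Fin n, j ≠ b → ρ.narr aPiv 0 j = τ.narr aPiv 0 j) (WP.block ?_) ?_ (by omega)
        · have hfi : ∀ k : Fin s, ((k : ℕ) = i) ↔ k = i := fun k => Fin.ext_iff.symm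
          have hfj : ∀ k : Fin n, ((k : ℕ) = b) ↔ k = b := fun k => Fin.ext_iff.symm
          refine ⟨by simp [Cmd.run, Store.setN, Store.putN, e1],
            by simp [Cmd.run, Store.setN, Store.putN, NExp.eval, hb1], rfl,
            ⟨Finset.insert_subset hi hD.1, ?_⟩, ?_, ?_⟩
          · intro k hk
            have := hD.2 k hk
            by_cases hki : k = i
            · simp [Cmd.run, Store.setN, Store.putN, NExp.eval, e1, hki]
            · simp [Cmd.run, Store.setN, Store.putN, NExp.eval, e1, hfi, hki, e3, ← this]
          · simp [Cmd.run, Store.setN, Store.putN, NExp.eval, hb1, e1]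
          · intro j hj
            simp [Cmd.run, Store.setN, Store.putN, NExp.eval, hb1, hfj, hj, e2]
        rintro ρ ⟨h5, h6, h7, h8, h9, h10⟩ hsρ
        have hρ := hω'.of_same hsρ
        refine (wp_clearRow hρ h5 h6 hi).same.mono le_rfl ?_
        rintro χ ⟨hχ, hsχ⟩
        rw [h7, e4] at hχ
        refine ⟨insert i D, h8.of_narr (hsχ.narr _ rfl), ?_⟩
        rw [hsχ.narr aPiv rfl]
        exact hst.pivot hiR hiS hb hb2 hb3 h9 h10 (fun i' hi' => (hχ i' (h.flagR.1 hi')).1)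
          fun i' hi' j hj hne => (hχ i' (h.flagR.1 hi')).2 j (h.flagC.1 hj) hne
      · intro hpos
        have hpos : ω.nvar vPiv = 0 := by simpa [NExp.eval] using hpos
        obtain ⟨-, h5⟩ := hω.resolve_right (by rintro ⟨b, -, hb, -⟩; omega)
        refine (WP.block (T := 1) ?_).mono (by omega) fun _ h => h
        refine ⟨D, hD.of_narr e3, ?_⟩
        rw [Cmd.run, e2, e4]
        exact hst.skip fun _ => h5
    · intro hiR
      have hiR : i ∉ R := by
        rw [← h'.flagR.2 i hi]
        simpa [NExp.eval, hτ] using hiR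
      refine (WP.block (T := 1) ?_).mono (by omega) fun _ h => h
      exact ⟨D, hD, hst.skip fun h => absurd h hiR⟩
  · ring_nf; omega

open Classical in
-- This is the criterion `ElimState.mem_rowSupport` in the form of a double loop. Columns without a
-- pivot are excluded by the test, so that subtracting one from `aPiv` always gives a row.
theorem wp_markKernel (h : Ctx A U R V C σ) {D : Finset (Fin s)} (hD : Flags σ aUsed U D)
    (hst : ElimState J R C (fun i j => σ.farr 1 i j) (fun j => σ.narr aPiv 0 j) U D)
    (hk : ∀ i ∈ U, σ.narr aKer 0 i = 0) :
    WP markKernel σ (U.card * (V.card * 50 + 60) + 8) fun τ =>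
      Flags τ aKer U (rowSupport J R C) := by
  have hsup := hst.mem_rowSupport h.flagR.1
  refine (WP.forEach (T := V.card * 50 + 40) (fun S τ => ∀ k ∈ U, (τ.narr aKer 0 k ≠ 0 ↔
      (k ∈ S ∧ k ∈ R ∧ k ∉ D) ∨ ∃ i ∈ S, i ∈ R ∧ i ∉ D ∧ ∃ j ∈ C, σ.narr aPiv 0 j = k + 1 ∧
        σ.farr 1 i j ≠ 0))
    h.rows rfl rfl rfl (by decide) (by decide) (by decide) ?_ ?_ ?_ ?_).mono le_rfl ?_
  · intro S τ v w h; simpa [Store.setN] using h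
  · intro k hk'; simp [hk k hk']
  · rintro S hS i hi hiS τ hI hτ hs
    have h' := h.of_same hs
    have hfi : ∀ k : Fin s, ((k : ℕ) = i) ↔ k = i := fun k => Fin.ext_iff.symm
    have hcond : (Test.conj (.pos (.get1 aR' (.var vI)))
        (.le (.get1 aUsed (.var vI)) (.const 0))).eval τ ↔ i ∈ R ∧ i ∉ D := by
      have e : τ.narr aUsed 0 i ≤ 0 ↔ i ∉ D := by
        rw [hs.narr aUsed rfl, ← hD.2 i hi]; omega
      simp only [Test.eval, Test.eval_pos, NExp.eval, hτ, h'.flagR.2 i hi, e]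
    refine WP.ite (T := V.card * 50 + 20) ?_ ?_ (by simp [Test.cost, Test.pos, NExp.cost]; omega)
    · intro hc
      rw [hcond] at hc
      refine WP.seq (T₁ := 10) (T₂ := V.card * 50 + 8) (Q₁ := fun υ => υ.nvar = τ.nvar ∧
        ∀ k : Fin s, υ.narr aKer 0 k = if k = i then 1 else τ.narr aKer 0 k) (WP.block ?_) ?_
        (by omega)
      · refine ⟨rfl, fun k => ?_⟩
        simp [Cmd.run, Store.putN, NExp.eval, hτ, hfi]
      rintro υ ⟨h1, h2⟩ hs'
      have h'' := h'.of_same hs'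
      refine (WP.forEach (T := 36) (fun S' ω => ∀ k ∈ U, (ω.narr aKer 0 k ≠ 0 ↔
        υ.narr aKer 0 k ≠ 0 ∨ ∃ j ∈ S', j ∈ C ∧ σ.narr aPiv 0 j = k + 1 ∧ σ.farr 1 i j ≠ 0))
        h''.cols rfl rfl rfl (by decide) (by decide) (by decide) ?_ ?_ ?_ (by omega)).mono le_rfl ?_
      · intro S τ v w h; simpa [Store.setN] using h
      · simp
      · rintro S' hS' j hj hjS' ω h3 hω hsω
        have e1 : ω.nvar vI = i := by rw [hsω.nvar vI rfl, h1, hτ]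
        have e2 : ω.narr aPiv = σ.narr aPiv := by
          rw [hsω.narr aPiv rfl, hs'.narr aPiv rfl, hs.narr aPiv rfl]
        have e3 : ω.farr 1 = σ.farr 1 := by
          rw [hsω.farr 1 rfl, hs'.farr 1 rfl, hs.farr 1 rfl]
        have hω' := h''.of_same hsω
        refine WP.block ?_
        simp only [Cmd.run, Test.eval, Test.eval_pos, NExp.eval, FExp.eval, hω, e1, e2, e3,
          hω'.flagC.2 j hj]
        split_ifs with hc'
        · intro k hk'
          obtain ⟨p, hp1, hp2, -⟩ := hst.piv_mem j hc'.1 hc'.2.1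
          have := h3 k hk'
          have hfp : ∀ k : Fin s, ((k : ℕ) = p) ↔ k = p := fun k => Fin.ext_iff.symm
          simp only [Store.putN, hp2, Nat.add_sub_cancel, hfp, true_and]
          by_cases hkp : k = p
          · subst hkp
            simp only [if_true, ne_eq, one_ne_zero, not_false_eq_true, true_iff]
            exact Or.inr ⟨j, by simp, hc'.1, hp2, hc'.2.2⟩
          · simp only [hkp, if_false]
            rw [this]
            have hjk : σ.narr aPiv 0 j ≠ k + 1 := by
              rw [hp2]; intro e; exact hkp (by ext; omega)
            simp [Finset.mem_insert, hjk]
        · intro k hk'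
          rw [h3 k hk']
          refine or_congr_right ⟨?_, ?_⟩
          · rintro ⟨j', h4, h5⟩; exact ⟨j', by simp [h4], h5⟩
          · rintro ⟨j', h4, h5, h6, h7⟩
            rcases Finset.mem_insert.1 h4 with rfl | h4
            · exact absurd ⟨h5, by omega, h7⟩ hc'
            · exact ⟨j', h4, h5, h6, h7⟩
      · intro ω hω k hk'
        rw [hω k hk', h2 k]
        by_cases hki : k = i
        · subst hki; simp [hc]
        · simp only [hki, if_false, hI k hk', Finset.mem_insert, false_or]
          constructor
          · rintro ((h4 | ⟨i', h4, h5⟩) | ⟨j, h4, h5, h6⟩)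
            · exact Or.inl h4
            · exact Or.inr ⟨i', Or.inr h4, h5⟩
            · exact Or.inr ⟨i, Or.inl rfl, hc.1, hc.2, j, h5, h6⟩
          · rintro (h4 | ⟨i', rfl | h4, h5, h6, j, h7, h8⟩)
            · exact Or.inl (Or.inl h4)
            · exact Or.inr ⟨j, h.flagC.1 h7, h7, h8⟩
            · exact Or.inl (Or.inr ⟨i', h4, h5, h6, j, h7, h8⟩)
    · intro hc
      rw [hcond] at hc
      refine (WP.block (T := 1) ?_).mono (by omega) fun _ h => h
      intro k hk'
      rw [Cmd.run, hI k hk']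
      refine or_congr ⟨?_, ?_⟩ ⟨?_, ?_⟩
      · rintro ⟨h1, h2⟩; exact ⟨by simp [h1], h2⟩
      · rintro ⟨h1, h2⟩
        rcases Finset.mem_insert.1 h1 with rfl | h1
        · exact absurd h2 hc
        · exact ⟨h1, h2⟩
      · rintro ⟨i', h1, h2⟩; exact ⟨i', by simp [h1], h2⟩
      · rintro ⟨i', h1, h2, h3, h4⟩
        rcases Finset.mem_insert.1 h1 with rfl | h1
        · exact absurd ⟨h2, h3⟩ hc
        · exact ⟨i', h1, h2, h3, h4⟩
  · ring_nf; omega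
  · intro τ hτ
    have hsub : rowSupport J R C ⊆ U := by
      unfold rowSupport
      exact (Finset.filter_subset _ _).trans h.flagR.1
    refine ⟨hsub, fun k hk' => ?_⟩
    rw [hτ k hk', hsup k]
    refine or_congr ⟨?_, ?_⟩ ⟨?_, ?_⟩
    · rintro ⟨-, h1⟩; exact h1
    · rintro h1; exact ⟨hk', h1⟩
    · rintro ⟨i, -, h1⟩; exact ⟨i, h1⟩
    · rintro ⟨i, h1, h2⟩; exact ⟨i, h.flagR.1 h1, h1, h2⟩

end KernelProgram

/-! ### The process `Seq` -/

section SeqFacts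

variable {s n : ℕ} {F : Type} [Field F] {A : Matrix (Fin s) (Fin n) (WithBot ℕ)}
  {J : Matrix (Fin s) (Fin n) F} {R R₁ : Finset (Fin s)} {C C₁ : Finset (Fin n)} {q c : ℕ}

theorem SeqRun.subset (h : SeqRun A J R C R₁ C₁ q c) : R₁ ⊆ R ∧ C₁ ⊆ C := by
  induction h with
  | done R R₀ C C₀ hHK hR hC => exact ⟨subset_rfl, subset_rfl⟩
  | next R R₀ R₁ C C₀ C₁ q c hHK hne hrec ih =>
    exact ⟨ih.1.trans (Finset.sdiff_subset.trans hHK.1.1),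
      ih.2.trans (Finset.sdiff_subset.trans Finset.sdiff_subset)⟩

theorem SeqRun.one_le (h : SeqRun A J R C R₁ C₁ q c) : 1 ≤ q := by
  cases h <;> omega

/-- The columns that are kept by `Seq` have no zero in the rows that are removed. -/
theorem SeqRun.eq_bot (h : SeqRun A J R C R₁ C₁ q c)
    (hB : ∀ i ∈ R, ∀ j ∈ C, A i j = ⊥ ∨ A i j = 0) :
    ∀ i ∈ R, i ∉ R₁ → ∀ j ∈ C₁, A i j = ⊥ := by
  induction h with
  | done R R₀ C C₀ hHK hR hC => exact fun i hi hi' => absurd hi hi'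
  | next R R₀ R₁ C C₀ C₁ q c hHK hne hrec ih =>
    intro i hi hi' j hj
    have hj' := hrec.subset.2 hj
    have hj1 := Finset.mem_sdiff.1 hj'
    have hj2 := Finset.mem_sdiff.1 hj1.1
    refine (hB i hi j hj2.1).resolve_right fun h0 => ?_
    have hi0 : i ∈ R₀ := (hHK.1.2.2.1 i hi j hj2.1 h0).resolve_right hj2.2
    have hi1 : i ∉ rowSupport J R₀ (C \ C₀) := by
      intro hs
      exact hj1.2 (Finset.mem_filter.2 ⟨hj1.1, i, hs, h0⟩)
    have := ih (fun i hi j hj => hB i (hHK.1.1 (Finset.mem_sdiff.1 hi).1) j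
      (Finset.mem_sdiff.1 (Finset.mem_sdiff.1 hj).1).1) i (Finset.mem_sdiff.2 ⟨hi0, hi1⟩) hi' j hj
    rw [this] at h0
    simp at h0

theorem SeqRun.of_le_one (h : SeqRun A J R C R₁ C₁ q c) (hq : q ≤ 1) : R₁ = R ∧ C₁ = C := by
  cases h with
  | done R R₀ C C₀ hHK hR hC => exact ⟨rfl, rfl⟩
  | next R R₀ R₁ C C₀ C₁ q c hHK hne hrec =>
    have := hrec.one_le
    omega

/-- If `B` is empty, the term `q * d ^ 2 * n` of the bound vanishes; `q = 1` lets the remaining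
constant costs be charged to `s * n`. -/
theorem SeqRun.of_empty (h : SeqRun A J ∅ ∅ R₁ C₁ q c) : q = 1 := by
  cases h with
  | done => rfl
  | next R R₀ R₁ C C₀ C₁ q c hHK hne hrec =>
    exfalso
    have h0 : R₀ = ∅ := Finset.subset_empty.1 hHK.1.1
    refine hne ⟨by simp [h0], by simp⟩

theorem rowSupport_subset (J : Matrix (Fin s) (Fin n) F) (R : Finset (Fin s))
    (C : Finset (Fin n)) : rowSupport J R C ⊆ R := by
  classical
  exact Finset.filter_subset _ _

/-- The extremal König cover is unique, and the rest of an iteration is a function of it. -/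
theorem SeqRun.unique {R₁' : Finset (Fin s)} {C₁' : Finset (Fin n)} {q' c' : ℕ}
    (h : SeqRun A J R C R₁ C₁ q c) (h' : SeqRun A J R C R₁' C₁' q' c') :
    R₁ = R₁' ∧ C₁ = C₁' ∧ q = q' ∧ c = c' := by
  induction h generalizing q' c' with
  | done R R₀ C C₀ hHK hR hC =>
    cases h' with
    | done _ R₀' _ C₀' hHK' =>
      obtain ⟨rfl, rfl⟩ := hHK.unique hHK'
      exact ⟨rfl, rfl, rfl, rfl⟩
    | next _ R₀' _ _ C₀' _ q c hHK' hne =>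
      obtain ⟨rfl, rfl⟩ := hHK.unique hHK'
      exact absurd ⟨hR, hC⟩ hne
  | next R R₀ R₁ C C₀ C₁ q c hHK hne hrec ih =>
    cases h' with
    | done _ R₀' _ C₀' hHK' hR hC =>
      obtain ⟨rfl, rfl⟩ := hHK.unique hHK'
      exact absurd ⟨hR, hC⟩ hne
    | next _ R₀' _ _ C₀' _ q' c' hHK' hne' hrec' =>
      obtain ⟨rfl, rfl⟩ := hHK.unique hHK'
      obtain ⟨h1, h2, h3, h4⟩ := ih hrec'
      exact ⟨h1, h2, by rw [h3], by rw [h4]⟩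

end SeqFacts

/-! ### The program for `Seq` and its cost -/

section SeqProgram

set_option linter.unusedSectionVars false

variable {F : Type} [Field F] {s n : ℕ}

/-- One iteration of `Seq`. -/
def seqIter : Cmd :=
  .setN vChanged (.const 0) ;; hkAll ;; removeRows aZr ;; removeCols aZc ;; copyJac ;; eliminate ;;
    markKernel ;; removeRows aKer ;; markCols ;; removeCols aZc

variable {A : Matrix (Fin s) (Fin n) (WithBot ℕ)} {J : Matrix (Fin s) (Fin n) F}
  {U R : Finset (Fin s)} {V C : Finset (Fin n)} {σ : Store F}

/-- All four removals shrink the sets, so the iteration changes nothing exactly if each of them is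
trivial, which is what `vChanged` records. The state of the elimination is part of the postcondition
because the pivots of the last iteration provide the columns of the minor. -/
theorem wp_seqIter (h : Ctx A U R V C σ) (hJ : HoldsJac J σ) :
    WP seqIter σ ((U.card + 3) ^ 2 * (V.card + 2) * 1000) fun τ => ∃ R₀ C₀ D,
      IsHK A R C R₀ C₀ ∧
      Ctx A U (R₀ \ rowSupport J R₀ (C \ C₀)) V ((C \ C₀) \ colSupport A J R₀ (C \ C₀)) τ ∧
      (τ.nvar vChanged = 0 ↔ R₀ \ rowSupport J R₀ (C \ C₀) = R ∧
        (C \ C₀) \ colSupport A J R₀ (C \ C₀) = C) ∧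
      ElimState J R₀ (C \ C₀) (fun i j => τ.farr 1 i j) (fun j => τ.narr aPiv 0 j) U D := by
  classical
  refine WP.seq (T₁ := 2) (T₂ := (U.card + 3) ^ 2 * (V.card + 2) * 200 + ((U.card * 40 + 8) +
    ((V.card * 40 + 8) + ((U.card * (V.card * 30 + 30) + 8) +
    ((U.card * (V.card * (U.card * 40 + 110) + 100) + 8) + ((U.card * (V.card * 50 + 60) + 8) +
    ((U.card * 40 + 8) + ((V.card * (U.card * 40 + 40) + 8) + (V.card * 40 + 8)))))))))
    (Q₁ := fun τ => τ.nvar vChanged = 0 ∧ τ.narr = σ.narr ∧ τ.farr = σ.farr) (WP.block ?_) ?_ ?_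
  · exact ⟨by simp [Cmd.run, Store.setN, NExp.eval], rfl, rfl⟩
  rintro σ₁ ⟨a1, a2, a3⟩ s1
  have c1 := h.of_same s1
  refine WP.seq (wp_hkAll c1) ?_ le_rfl
  rintro σ₂ ⟨b1, b2, X, W, b3, b4, b5, b6⟩ s2
  have c2 := c1.of_same s2
  refine WP.seq (wp_removeRows c2 b3 (by decide)) ?_ le_rfl
  rintro σ₃ ⟨c3, d1⟩ s3
  refine WP.seq (wp_removeCols c3 (b4.of_narr (s3.narr _ rfl)) (by decide)) ?_ le_rfl
  rintro σ₄ ⟨c4, d2⟩ s4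
  have hJ4 : HoldsJac J σ₄ := by
    intro i j
    rw [s4.farr 0 rfl, s3.farr 0 rfl, s2.farr 0 rfl, a3]; exact hJ i j
  refine WP.seq (wp_copyJac c4 hJ4) ?_ le_rfl
  rintro σ₅ d3 s5
  have c5 := c4.of_same s5
  refine WP.seq (wp_eliminate c5 d3 ?_ ?_) ?_ le_rfl
  · intro j hj
    rw [s5.narr aPiv rfl, s4.narr aPiv rfl, s3.narr aPiv rfl]; exact b2 j hj
  · intro i hi
    rw [s5.narr aUsed rfl, s4.narr aUsed rfl, s3.narr aUsed rfl]; exact (b1 i hi).2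
  rintro σ₆ ⟨D, d4, d5⟩ s6
  have c6 := c5.of_same s6
  refine WP.seq (wp_markKernel c6 d4 d5 ?_) ?_ le_rfl
  · intro i hi
    rw [s6.narr aKer rfl, s5.narr aKer rfl, s4.narr aKer rfl, s3.narr aKer rfl]; exact (b1 i hi).1
  rintro σ₇ d6 s7
  have c7 := c6.of_same s7
  refine WP.seq (wp_removeRows c7 d6 (by decide)) ?_ le_rfl
  rintro σ₈ ⟨c8, d7⟩ s8
  refine WP.seq (wp_markCols c8 (d6.of_narr (s8.narr _ rfl))) ?_ le_rfl
  rintro σ₉ d8 s9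
  have c9 := c8.of_same s9
  refine (wp_removeCols c9 d8 (by decide)).same.mono le_rfl ?_
  rintro τ ⟨⟨c10, d9⟩, s10⟩
  -- The marks were made in all of `V`, while `colSupport` looks at `C \ W` only; after the set
  -- difference the two agree.
  have hcs : (C \ W) \ (V.filter fun j => ∃ i ∈ rowSupport J (R \ X) (C \ W), A i j = 0) =
      (C \ W) \ colSupport A J (R \ X) (C \ W) := by
    ext j
    simp only [colSupport, Finset.mem_sdiff, Finset.mem_filter, not_and]
    constructor
    · rintro ⟨h1, h2⟩; exact ⟨h1, fun _ => h2 (h.flagC.1 h1.1)⟩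
    · rintro ⟨h1, h2⟩; exact ⟨h1, fun _ => h2 h1⟩
  rw [hcs] at c10 d9
  refine ⟨R \ X, W, D, b6, c10, ?_, ?_⟩
  · rw [d9, s9.nvar vChanged rfl, d7, s7.nvar vChanged rfl, s6.nvar vChanged rfl,
      s5.nvar vChanged rfl, d2, d1, s2.nvar vChanged rfl]
    simp only [a1, true_and]
    constructor
    · rintro ⟨⟨⟨h1, h2⟩, h3⟩, h4⟩
      exact ⟨h3.trans h1, h4.trans h2⟩
    · rintro ⟨h1, h2⟩
      have e1 : R \ X = R := Finset.sdiff_subset.antisymm (h1.symm.subset.trans Finset.sdiff_subset)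
      have e2 : C \ W = C := Finset.sdiff_subset.antisymm (h2.symm.subset.trans Finset.sdiff_subset)
      rw [e1, e2] at h1 h2 ⊢
      exact ⟨⟨⟨rfl, rfl⟩, h1⟩, h2⟩
  · rw [s10.narr aPiv rfl, s9.narr aPiv rfl, s8.narr aPiv rfl, s7.narr aPiv rfl, s10.farr 1 rfl,
      s9.farr 1 rfl, s8.farr 1 rfl, s7.farr 1 rfl]
    exact d5
  · nlinarith [Nat.zero_le (U.card * V.card), Nat.zero_le V.card, Nat.zero_le U.card,
      Nat.zero_le (U.card * U.card), Nat.zero_le (U.card * U.card * V.card)]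

/-- The process `Seq`. -/
def seqLoop : Cmd := .while (.pos (.var vChanged)) seqIter

/-- The run of `Seq` is built along with the execution, by induction on the number of rows and
columns, which an iteration that changes something lowers. The last iteration changes nothing, so
its elimination concerns exactly the sets that are returned, and their kernel support is empty. -/
theorem wp_seqLoop (h : Ctx A U R V C σ) (hJ : HoldsJac J σ) (hch : σ.nvar vChanged ≠ 0) :
    ∃ R₁ C₁ q c, SeqRun A J R C R₁ C₁ q c ∧
      WP seqLoop σ (q * ((U.card + 3) ^ 2 * (V.card + 2) * 1000 + 4) + 4) fun τ =>
        Ctx A U R₁ V C₁ τ ∧ rowSupport J R₁ C₁ = ∅ ∧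
        ∃ D, ElimState J R₁ C₁ (fun i j => τ.farr 1 i j) (fun j => τ.narr aPiv 0 j) U D := by
  induction hN : R.card + C.card using Nat.strong_induction_on generalizing R C σ with
  | _ N ih =>
    obtain ⟨τ, t, he, ht, R₀, C₀, D, h1, h2, h3, h4⟩ := wp_seqIter h hJ
    have hb : (Test.pos (.var vChanged)).eval σ := by simpa [NExp.eval] using hch
    by_cases hdone : R₀ \ rowSupport J R₀ (C \ C₀) = R ∧
        (C \ C₀) \ colSupport A J R₀ (C \ C₀) = C
    · refine ⟨R, C, 1, C₀.card, SeqRun.done R R₀ C C₀ h1 hdone.1 hdone.2, ?_⟩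
      have e1 : R₀ = R := h1.1.1.antisymm (hdone.1.symm.subset.trans Finset.sdiff_subset)
      have e2 : C \ C₀ = C := Finset.sdiff_subset.antisymm (hdone.2.symm.subset.trans Finset.sdiff_subset)
      refine WP.while_step (Q₁ := fun υ => υ = τ) (T₂ := 4) hb ⟨τ, t, he, ht, rfl⟩ ?_ ?_
      · rintro υ rfl hs
        have h0 := h3.2 hdone
        refine WP.while_exit (by simpa [NExp.eval] using h0) ?_
          (by simp [Test.cost, Test.pos, NExp.cost])
        rw [hdone.1, hdone.2] at h2
        rw [e1, e2] at h4
        refine ⟨h2, ?_, D, h4⟩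
        have := hdone.1
        rw [e1, e2, Finset.sdiff_eq_self_iff_disjoint] at this
        have hsub := rowSupport_subset J R C
        exact Finset.disjoint_self_iff_empty _ |>.1 (this.mono_left hsub)
      · simp [Test.cost, Test.pos, NExp.cost]; omega
    · have hsR : R₀ \ rowSupport J R₀ (C \ C₀) ⊆ R := Finset.sdiff_subset.trans h1.1.1
      have hsC : (C \ C₀) \ colSupport A J R₀ (C \ C₀) ⊆ C :=
        Finset.sdiff_subset.trans Finset.sdiff_subset
      have hlt : (R₀ \ rowSupport J R₀ (C \ C₀)).card +
          ((C \ C₀) \ colSupport A J R₀ (C \ C₀)).card < N := by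
        rw [← hN]
        by_cases e : R₀ \ rowSupport J R₀ (C \ C₀) = R
        · have := Finset.card_lt_card (hsC.ssubset_of_ne fun e' => hdone ⟨e, e'⟩)
          have := Finset.card_le_card hsR
          omega
        · have := Finset.card_lt_card (hsR.ssubset_of_ne e)
          have := Finset.card_le_card hsC
          omega
      have hJ' : HoldsJac J τ := by
        intro i j; rw [he.same.farr 0 rfl]; exact hJ i j
      obtain ⟨R₁, C₁, q, c, h5, h6⟩ := ih _ hlt h2 hJ' (fun e => hdone (h3.1 e)) rfl
      refine ⟨R₁, C₁, q + 1, max C₀.card c, SeqRun.next R R₀ R₁ C C₀ C₁ q c h1 hdone h5, ?_⟩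
      refine WP.while_step (Q₁ := fun υ => υ = τ) hb ⟨τ, t, he, ht, rfl⟩ ?_ ?_
        (T₂ := q * ((U.card + 3) ^ 2 * (V.card + 2) * 1000 + 4) + 4)
      · rintro υ rfl hs
        exact h6
      · simp [Test.cost, Test.pos, NExp.cost]; ring_nf; omega

end SeqProgram

/-! ### The main program -/

section MainProgram

set_option linter.unusedSectionVars false

variable {F : Type} [Field F] {s n : ℕ}

/-- Computation of the columns of `B`. -/
def scanCols : Cmd :=
  (.setN vCount (.const 0) ;; .setN vNumV (.const 0)) ;;
    Cmd.loop vJ 1 (.ite (.pos (.get1 aC (.var vJ)))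
      (.setN vCount (.plus (.var vCount) (.const 1)) ;;
        .ite (.pos (.get1 aLive (.var vJ)))
          (.ite (.pos (.get1 aPos (.var vJ))) .skip
            (.put1 aCols (.var vNumV) (.var vJ) ;; .setN vNumV (.plus (.var vNumV) (.const 1)) ;;
              .put1 aC' (.var vJ) (.const 1)))
          (.put1 aC (.var vJ) (.const 0))) .skip)

/-- Computation of the nontrivial rows of `B`. -/
def scanRows : Cmd :=
  .setN vNumU (.const 0) ;;
    Cmd.loop vI 0 (.ite (.pos (.get1 aR (.var vI)))
      (.setN vFlag (.const 0) ;;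
        Cmd.forCols (.ite (.eqc (.get aOrd (.var vI) (.var vJ)) 1) (.setN vFlag (.const 1)) .skip) ;;
        .ite (.pos (.var vFlag))
          (.put1 aRows (.var vNumU) (.var vI) ;; .setN vNumU (.plus (.var vNumU) (.const 1)) ;;
            .put1 aR' (.var vI) (.const 1)) .skip)
      .skip)

/-- Change of the numbers of elements and of positive elements of a column. -/
def adjustCol (op : NExp → NExp → NExp) : Cmd :=
  .ite (.pos (.get aOrd (.var vI) (.var vJ)))
      (.put1 aLive (.var vJ) (op (.get1 aLive (.var vJ)) (.const 1))) .skip ;;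
    .ite (.le (.const 2) (.get aOrd (.var vI) (.var vJ)))
      (.put1 aPos (.var vJ) (op (.get1 aPos (.var vJ)) (.const 1))) .skip

/-- Removal of the rows kept by `Seq` from the set of equations. -/
def updateRows : Cmd :=
  .setN vFlag (.const 0) ;;
    Cmd.forRows (.ite (.pos (.get1 aR' (.var vI)))
      ((.setN vFlag (.const 1) ;; .put1 aR (.var vI) (.const 0) ;;
        .setN vRem (.minus (.var vRem) (.const 1))) ;;
        Cmd.loop vJ 1 (adjustCol .minus))
      .skip)

/-- Removal of the columns kept by `Seq` from the set of variables; the pivot columns become part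
of the result. -/
def updateCols : Cmd :=
  Cmd.forCols (.ite (.pos (.get1 aC' (.var vJ)))
    (.put1 aC (.var vJ) (.const 0) ;;
      .ite (.pos (.get1 aPiv (.var vJ))) (.put1 aOut (.var vJ) (.const 1)) .skip) .skip)

/-- One call of `Ō-reg`. -/
def callBody : Cmd :=
  scanCols ;; .ite (.le (.var vRem) (.var vCount))
    (scanRows ;; .setN vChanged (.const 1) ;; seqLoop ;; updateRows ;; updateCols ;;
      .ite (.pos (.var vFlag)) .skip (.setN vOk (.const 0)))
    (.setN vOk (.const 0))

/-- The calls of `Ō-reg`. -/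
def mainLoop : Cmd := .while (.conj (.pos (.var vOk)) (.pos (.var vRem))) callBody

/-- Initialization of the sets of equations and variables. -/
def initArrays : Cmd :=
  Cmd.loop vI 0 (.put1 aR (.var vI) (.const 1)) ;;
    Cmd.loop vJ 1 (.put1 aC (.var vJ) (.const 1) ;;
      Cmd.loop vI 0 (adjustCol .plus))

/-- Rejection of the systems with more equations than variables or with a row of `-∞`. -/
def initCheck : Cmd :=
  (.setN vOk (.const 1) ;; .setN vRem (.var 0)) ;;
    Cmd.loop vI 0 (.setN vFlag (.const 0) ;;
      Cmd.loop vJ 1 (.ite (.pos (.get aOrd (.var vI) (.var vJ))) (.setN vFlag (.const 1)) .skip) ;;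
      .ite (.pos (.var vFlag)) .skip (.setN vOk (.const 0))) ;;
    .ite (.le (.var 0) (.var 1)) .skip (.setN vOk (.const 0))

/-- An implementation of `Ō-reg`. -/
def oregProgram : Cmd := initArrays ;; initCheck ;; mainLoop

/-- The part of the memory that depends on the set `R` of equations only. -/
structure RowMem (A : Matrix (Fin s) (Fin n) (WithBot ℕ)) (R : Finset (Fin s)) (σ : Store F) :
    Prop where
  rem : σ.nvar vRem = R.card
  flagR : ∀ i : Fin s, σ.narr aR 0 i ≠ 0 ↔ i ∈ R
  live : ∀ j : Fin n, σ.narr aLive 0 j = (R.filter fun i => A i j ≠ ⊥).card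
  pos : ∀ j : Fin n, σ.narr aPos 0 j = (R.filter fun i => A i j ≠ ⊥ ∧ A i j ≠ 0).card

/-- The memory before a call of `Ō-reg` for the equations `R` and the variables `C`; `Y` are the
variables that have been chosen before. -/
structure MainMem (A : Matrix (Fin s) (Fin n) (WithBot ℕ)) (J : Matrix (Fin s) (Fin n) F)
    (R : Finset (Fin s)) (C Y : Finset (Fin n)) (σ : Store F) : Prop extends RowMem A R σ where
  ord : HoldsOrd A σ
  jac : HoldsJac J σ
  nrows : σ.nvar 0 = s
  ncols : σ.nvar 1 = n
  flagC : ∀ j : Fin n, σ.narr aC 0 j ≠ 0 ↔ j ∈ C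
  out : ∀ j : Fin n, σ.narr aOut 0 j ≠ 0 ↔ j ∈ Y

variable {A : Matrix (Fin s) (Fin n) (WithBot ℕ)} {J : Matrix (Fin s) (Fin n) F}
  {R : Finset (Fin s)} {C Y : Finset (Fin n)} {σ : Store F}

theorem RowMem.live_iff (h : RowMem A R σ) {j : Fin n} (hj : j ∈ C) :
    σ.narr aLive 0 j ≠ 0 ↔ j ∈ liveCols A R C := by
  classical
  rw [h.live j, Finset.card_ne_zero]
  constructor
  · rintro ⟨i, hi⟩
    exact Finset.mem_filter.2 ⟨hj, i, Finset.mem_filter.1 hi⟩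
  · intro hl
    obtain ⟨-, i, hi⟩ := Finset.mem_filter.1 hl
    exact ⟨i, Finset.mem_filter.2 hi⟩

theorem RowMem.pos_iff (h : RowMem A R σ) {j : Fin n} (hj : j ∈ liveCols A R C) :
    σ.narr aPos 0 j = 0 ↔ j ∈ bCols A R C := by
  classical
  rw [h.pos j, Finset.card_eq_zero, Finset.filter_eq_empty_iff]
  constructor
  · intro hp
    refine Finset.mem_filter.2 ⟨hj, fun i hi => ?_⟩
    have := hp hi
    tauto
  · intro hb i hi
    have := (Finset.mem_filter.1 hb).2 i hi
    tauto

theorem bCols_subset_liveCols (A : Matrix (Fin s) (Fin n) (WithBot ℕ)) (R : Finset (Fin s))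
    (C : Finset (Fin n)) : bCols A R C ⊆ liveCols A R C := by
  classical
  exact Finset.filter_subset _ _

theorem liveCols_subset (A : Matrix (Fin s) (Fin n) (WithBot ℕ)) (R : Finset (Fin s))
    (C : Finset (Fin n)) : liveCols A R C ⊆ C := by
  classical
  exact Finset.filter_subset _ _

theorem bRows_subset (A : Matrix (Fin s) (Fin n) (WithBot ℕ)) (R : Finset (Fin s))
    (C : Finset (Fin n)) : bRows A R C ⊆ R := by
  classical
  exact Finset.filter_subset _ _

open Classical in
-- The counters `aLive` and `aPos` decide each column in constant time. `vCount` counts the columns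
-- before those of `-∞` are dropped, because the comparison of `R` and `C` precedes that removal.
theorem wp_scanCols (h : MainMem A J R C Y σ) :
    WP scanCols σ (n * 90 + 20) fun τ =>
      τ.nvar vCount = C.card ∧ Lists τ aCols (τ.nvar vNumV) (bCols A R C) ∧
      (∀ j : Fin n, τ.narr aC 0 j ≠ 0 ↔ j ∈ liveCols A R C) ∧
      Flags τ aC' (bCols A R C) (bCols A R C) := by
  refine WP.seq (T₁ := 4) (T₂ := n * 90 + 8) (Q₁ := fun τ => τ.nvar vCount = 0 ∧
    τ.nvar vNumV = 0 ∧ τ.nvar 1 = n ∧ τ.narr = σ.narr) (WP.block ?_) ?_ (by omega)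
  · exact ⟨by simp [Cmd.run, Store.setN, NExp.eval], by simp [Cmd.run, Store.setN, NExp.eval],
      by simp [Cmd.run, Store.setN, h.ncols], rfl⟩
  rintro σ₁ ⟨h1, h2, h3, h4⟩ -
  refine (WP.loopFin (N := n) (T := 80) (fun S τ => τ.nvar vCount = (C ∩ S).card ∧
      Lists τ aCols (τ.nvar vNumV) (bCols A R C ∩ S) ∧
      (∀ j : Fin n, τ.narr aC 0 j ≠ 0 ↔ j ∈ C ∧ (j ∈ S → j ∈ liveCols A R C)) ∧
      ∀ j ∈ bCols A R C ∩ S, τ.narr aC' 0 j ≠ 0)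
    h3 rfl rfl (by decide) ?_ ?_ ?_ (by omega)).mono le_rfl ?_
  · intro S τ v h; simpa [Store.setN, Lists] using h
  · refine ⟨by simp [h1], ?_, ?_, by simp⟩
    · rw [h2, Finset.inter_empty]; exact Lists.empty _ _
    · intro j; rw [h4]; simpa using h.flagC j
  · rintro S j hjS τ ⟨a1, a2, a3, a4⟩ hτ hs
    have hlive : τ.narr aLive = σ.narr aLive := by rw [hs.narr _ rfl, h4]
    have hpos : τ.narr aPos = σ.narr aPos := by rw [hs.narr _ rfl, h4]
    have hc : τ.narr aC 0 j ≠ 0 ↔ j ∈ C := by rw [a3 j]; simp [hjS]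
    have hfj : ∀ k : Fin n, ((k : ℕ) = j) ↔ k = j := fun k => Fin.ext_iff.symm
    have hbC : bCols A R C ⊆ C := (bCols_subset_liveCols A R C).trans (liveCols_subset A R C)
    refine WP.block ?_
    simp only [Cmd.run, Test.eval_pos, NExp.eval, Store.setN, ne_eq,
      Nat.reduceEqDiff, not_false_eq_true, Function.update_of_ne, hτ, hlive, hpos]
    by_cases hjC : j ∈ C
    · have e1 : (C ∩ insert j S) = insert j (C ∩ S) := Finset.inter_insert_of_mem hjC
      have hcard : (C ∩ insert j S).card = (C ∩ S).card + 1 := by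
        rw [e1, Finset.card_insert_of_notMem (by simp [hjS])]
      rw [if_pos (by simpa using hc.2 hjC)]
      by_cases hjl : j ∈ liveCols A R C
      · rw [if_pos (by simpa using (h.live_iff hjC).2 hjl)]
        have hcase3 : ∀ k : Fin n, (k ∈ C ∧ (k ∈ insert j S → k ∈ liveCols A R C)) ↔
            (k ∈ C ∧ (k ∈ S → k ∈ liveCols A R C)) := by
          intro k
          rw [Finset.mem_insert]
          constructor
          · rintro ⟨h1, h2⟩; exact ⟨h1, fun h => h2 (Or.inr h)⟩
          · rintro ⟨h1, h2⟩; exact ⟨h1, fun h => h.elim (fun e => e ▸ hjl) h2⟩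
        by_cases hjb : j ∈ bCols A R C
        · rw [if_neg (by simpa using (h.pos_iff hjl).2 hjb)]
          have e2 : bCols A R C ∩ insert j S = insert j (bCols A R C ∩ S) :=
            Finset.inter_insert_of_mem hjb
          refine ⟨?_, ?_, ?_, ?_⟩
          · simp [Store.putN, a1, hcard]
          · rw [e2]
            have := a2.insert (i := j) (by simp [hjS])
            simp only [Store.putN, ne_eq, Nat.reduceEqDiff,
              not_false_eq_true, Function.update_of_ne, Function.update_self]
            refine this.of_narr ?_
            funext a b
            simp [Store.putN]
          · intro k
            rw [hcase3 k, ← a3 k]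
            simp [Store.putN]
          · intro k hk
            rw [e2, Finset.mem_insert] at hk
            by_cases hkj : k = j
            · simp [Store.putN, hkj, hτ]
            · have := a4 k (hk.resolve_left hkj)
              simp [Store.putN, hfj, hkj, hτ, this]
        · rw [if_pos (by simpa using fun h0 => hjb ((h.pos_iff hjl).1 h0))]
          have e2 : bCols A R C ∩ insert j S = bCols A R C ∩ S :=
            Finset.inter_insert_of_notMem hjb
          rw [e2]
          refine ⟨?_, ?_, ?_, a4⟩
          · simp [a1, hcard]
          · exact a2
          · intro k
            rw [hcase3 k, ← a3 k]
      · rw [if_neg (by simpa using fun h0 => hjl ((h.live_iff hjC).1 h0))]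
        have hjb : j ∉ bCols A R C := fun h => hjl (bCols_subset_liveCols A R C h)
        have e2 : bCols A R C ∩ insert j S = bCols A R C ∩ S :=
          Finset.inter_insert_of_notMem hjb
        rw [e2]
        refine ⟨?_, ?_, ?_, ?_⟩
        · simp [Store.putN, a1, hcard]
        · refine Lists.of_narr (σ := τ) a2 ?_
          funext a b; simp [Store.putN]
        · intro k
          rw [Finset.mem_insert]
          by_cases hkj : k = j
          · simp [Store.putN, hkj, hjl]
          · have := a3 k
            simp [Store.putN, hfj, hkj] at this ⊢
            exact this
        · intro k hk
          have := a4 k hk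
          simpa [Store.putN] using this
    · rw [if_neg (by simpa using fun h0 => hjC (hc.1 h0))]
      have hjb : j ∉ bCols A R C := fun h => hjC (hbC h)
      rw [Finset.inter_insert_of_notMem hjC, Finset.inter_insert_of_notMem hjb]
      refine ⟨a1, a2, fun k => (a3 k).trans ?_, a4⟩
      rw [Finset.mem_insert]
      constructor
      · rintro ⟨h1, h2⟩; exact ⟨h1, fun h => h.elim (fun e => absurd (e ▸ h1) hjC) h2⟩
      · rintro ⟨h1, h2⟩; exact ⟨h1, fun h => h2 (Or.inr h)⟩
  · rintro τ ⟨a1, a2, a3, a4⟩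
    simp only [Finset.inter_univ] at a1 a2 a4
    refine ⟨a1, a2, fun j => ?_, subset_rfl, fun j hj => ⟨fun _ => hj, fun _ => a4 j hj⟩⟩
    rw [a3 j]
    exact ⟨fun h => h.2 (Finset.mem_univ _), fun h => ⟨liveCols_subset A R C h, fun _ => h⟩⟩

open Classical in
-- Only the columns of `B` are inspected. The cost is thus `s` times their number and not `s * n`,
-- which is needed for the costs of successive calls to add up in the case `q ≤ 1`.
theorem wp_scanRows (hord : HoldsOrd A σ) (hs : σ.nvar 0 = s)
    (hR : ∀ i : Fin s, σ.narr aR 0 i ≠ 0 ↔ i ∈ R)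
    (hV : Lists σ aCols (σ.nvar vNumV) (bCols A R C)) :
    WP scanRows σ (s * ((bCols A R C).card * 40 + 80) + 12) fun τ =>
      Lists τ aRows (τ.nvar vNumU) (bRows A R C) ∧ Flags τ aR' (bRows A R C) (bRows A R C) := by
  refine WP.seq (T₁ := 2) (T₂ := s * ((bCols A R C).card * 40 + 80) + 8) (Q₁ := fun τ =>
    τ.nvar vNumU = 0 ∧ τ.nvar 0 = s ∧ τ.nvar vNumV = σ.nvar vNumV ∧ τ.narr = σ.narr)
    (WP.block ?_) ?_ (by omega)
  · exact ⟨by simp [Cmd.run, Store.setN, NExp.eval], by simp [Cmd.run, Store.setN, hs],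
      by simp [Cmd.run, Store.setN], rfl⟩
  rintro σ₁ ⟨h1, h2, h3, h4⟩ -
  refine (WP.loopFin (N := s) (T := (bCols A R C).card * 40 + 70) (fun S τ =>
      Lists τ aRows (τ.nvar vNumU) (bRows A R C ∩ S) ∧
      ∀ i ∈ bRows A R C ∩ S, τ.narr aR' 0 i ≠ 0)
    h2 rfl rfl (by decide) ?_ ?_ ?_ (le_of_eq (by ring))).mono le_rfl ?_
  · intro S τ v h; simpa [Store.setN, Lists] using h
  · refine ⟨?_, by simp⟩
    rw [h1, Finset.inter_empty]; exact Lists.empty _ _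
  · rintro S i hiS τ ⟨a1, a2⟩ hτ hsτ
    have hc : τ.narr aR 0 i ≠ 0 ↔ i ∈ R := by rw [hsτ.narr aR rfl, h4, hR]
    have hVτ : Lists τ aCols (τ.nvar vNumV) (bCols A R C) := by
      rw [hsτ.nvar vNumV rfl, h3]
      exact hV.of_narr (by rw [hsτ.narr _ rfl, h4])
    have hordτ : HoldsOrd A τ := by
      intro i j; rw [hsτ.narr aOrd rfl, h4]; exact hord i j
    refine WP.ite (T := (bCols A R C).card * 40 + 60) ?_ ?_
      (by simp [Test.cost, Test.pos, NExp.cost]; omega)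
    · intro hiR
      have hiR : i ∈ R := by simpa [NExp.eval, hτ, hc] using hiR
      refine WP.seq (T₁ := 2) (T₂ := (bCols A R C).card * 40 + 50) (Q₁ := fun υ =>
        υ = τ.setN vFlag 0) (WP.block rfl) ?_ (by omega)
      rintro υ rfl hsυ
      refine WP.seq (T₁ := (bCols A R C).card * 40 + 8) (T₂ := 40) (WP.forEach (T := 26)
        (U := bCols A R C) (fun S' ω => ω.nvar vFlag ≠ 0 ↔ ∃ j ∈ S', A i j = 0)
        ?_ rfl rfl rfl (by decide) (by decide) (by decide) ?_ ?_ ?_ (by omega)) ?_ (by omega)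
      · have e0 : (τ.setN vFlag 0).nvar vNumV = τ.nvar vNumV := by simp [Store.setN]
        exact e0 ▸ hVτ.of_narr (τ := τ.setN vFlag 0) rfl
      · intro S τ v w h; simpa [Store.setN] using h
      · simp [Store.setN]
      · rintro S' hS' j hj hjS' ω hω hωj hsω
        have e1 : ω.nvar vI = i := by rw [hsω.nvar vI rfl]; simp [Store.setN, hτ]
        have e2 : ω.narr aOrd i j = code (A i j) := by rw [hsω.narr aOrd rfl]; exact hordτ i j
        refine WP.block ?_
        simp only [Cmd.run, Test.eval_eqc, NExp.eval, e1, hωj, e2, code_eq_one]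
        split_ifs with h0
        · simp [Store.setN, h0]
        · rw [hω]; simp [h0]
      · rintro ω hω hsω
        have hbr : (∃ j ∈ bCols A R C, A i j = 0) ↔ i ∈ bRows A R C := by
          simp [bRows, hiR]
        rw [hbr] at hω
        have e1 : ω.nvar vI = i := by rw [hsω.nvar vI rfl]; simp [Store.setN, hτ]
        have e2 : ω.nvar vNumU = τ.nvar vNumU := by rw [hsω.nvar vNumU rfl]; simp [Store.setN]
        have e3 : ω.narr aRows = τ.narr aRows := by rw [hsω.narr aRows rfl]; rfl
        have e4 : ω.narr aR' = τ.narr aR' := by rw [hsω.narr aR' rfl]; rfl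
        have hfi : ∀ k : Fin s, ((k : ℕ) = i) ↔ k = i := fun k => Fin.ext_iff.symm
        refine WP.block ?_
        simp only [Cmd.run, Test.eval_pos, NExp.eval, hω]
        split_ifs with h0
        · rw [Finset.inter_insert_of_mem h0]
          have a1' : Lists ω aRows (ω.nvar vNumU) (bRows A R C ∩ S) := by
            rw [e2]; exact a1.of_narr e3
          have := a1'.insert (i := i) (by simp [hiS])
          refine ⟨?_, ?_⟩
          · simp only [Store.putN, Store.setN, Function.update_self]
            refine this.of_narr ?_
            funext a b
            simp [Store.putN, e1]
          · intro k hk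
            by_cases hki : k = i
            · simp [Store.putN, Store.setN, hki, e1]
            · have := a2 k ((Finset.mem_insert.1 hk).resolve_left hki)
              simp [Store.putN, Store.setN, hfi, hki, e1, e4, this]
        · rw [Finset.inter_insert_of_notMem h0, e2, e4]
          exact ⟨a1.of_narr e3, a2⟩
    · intro hiR
      have hiR : i ∉ R := by simpa [NExp.eval, hτ, ← hc] using hiR
      refine (WP.block (T := 1) ?_).mono (by omega) fun _ h => h
      rw [Finset.inter_insert_of_notMem fun h => hiR (bRows_subset A R C h)]
      exact ⟨a1, a2⟩
  · rintro τ ⟨a1, a2⟩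
    simp only [Finset.inter_univ] at a1 a2
    exact ⟨a1, subset_rfl, fun j hj => ⟨fun _ => hj, fun _ => a2 j hj⟩⟩

open Classical in
theorem card_filter_erase_add {ι : Type*} {R : Finset ι} {i : ι} (hi : i ∈ R) (p : ι → Prop) :
    (R.filter p).card = ((R.erase i).filter p).card + if p i then 1 else 0 := by
  conv_lhs => rw [← Finset.insert_erase hi, Finset.filter_insert]
  split_ifs with h
  · rw [Finset.card_insert_of_notMem (by simp)]
  · rfl

open Classical in
-- The operation is a parameter since the same code fills the counters at the beginning and lowers
-- them when a row is removed.
theorem adjustCol_run {op : NExp → NExp → NExp} {f : ℕ → ℕ → ℕ} {σ : Store F}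
    (hop : ∀ (σ : Store F) e e', (op e e').eval σ = f (e.eval σ) (e'.eval σ)) {i : Fin s}
    {j : Fin n} (hi : σ.nvar vI = i) (hj : σ.nvar vJ = j) (hA : HoldsOrd A σ) (k : Fin n) :
    ((adjustCol op).run σ).narr aLive 0 k =
        (if k = j ∧ A i j ≠ ⊥ then f (σ.narr aLive 0 k) 1 else σ.narr aLive 0 k) ∧
      ((adjustCol op).run σ).narr aPos 0 k =
        (if k = j ∧ A i j ≠ ⊥ ∧ A i j ≠ 0 then f (σ.narr aPos 0 k) 1 else σ.narr aPos 0 k) := by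
  have hfj : ((k : ℕ) = j) ↔ k = j := Fin.ext_iff.symm
  have hcode : σ.narr aOrd i j = code (A i j) := hA i j
  set τ := (Cmd.ite (.pos (.get aOrd (.var vI) (.var vJ)))
      (.put1 aLive (.var vJ) (op (.get1 aLive (.var vJ)) (.const 1))) .skip).run σ with hτ
  have h1 : τ.narr aLive 0 k =
      (if k = j ∧ A i j ≠ ⊥ then f (σ.narr aLive 0 k) 1 else σ.narr aLive 0 k) := by
    simp only [hτ, Cmd.run, Test.eval_pos, NExp.eval, hi, hj, hcode, ne_eq, code_eq_zero]
    by_cases hb : A i j = ⊥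
    · simp [hb]
    · by_cases hk : k = j
      · subst hk; simp [hb, Store.putN, hop, NExp.eval, hj]
      · simp [hb, Store.putN, hk, hfj]
  have h2 : τ.narr aPos 0 k = σ.narr aPos 0 k ∧ τ.narr aOrd = σ.narr aOrd ∧
      τ.nvar = σ.nvar := by
    simp only [hτ, Cmd.run]
    split_ifs <;> simp [Store.putN]
  have h3 : (adjustCol op).run σ = (Cmd.ite (.le (.const 2) (.get aOrd (.var vI) (.var vJ)))
      (.put1 aPos (.var vJ) (op (.get1 aPos (.var vJ)) (.const 1))) .skip).run τ := rfl
  rw [h3]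
  have hc2 : ((Test.le (.const 2) (.get aOrd (.var vI) (.var vJ))).eval τ) ↔
      A i j ≠ ⊥ ∧ A i j ≠ 0 := by
    simp only [Test.eval, NExp.eval, h2, hi, hj, hcode]
    exact two_le_code
  have hi' : τ.nvar vI = i := by rw [h2.2.2, hi]
  have hj' : τ.nvar vJ = j := by rw [h2.2.2, hj]
  refine ⟨Eq.trans ?_ h1, ?_⟩
  · simp only [Cmd.run]
    split_ifs <;> simp [Store.putN]
  · simp only [Cmd.run, hc2]
    by_cases hb : A i j ≠ ⊥ ∧ A i j ≠ 0
    · by_cases hk : k = j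
      · subst hk
        simp [hb, Store.putN, hop, NExp.eval, hj', h2.1]
      · simp [hb, Store.putN, NExp.eval, hk, hfj, hj', h2.1]
    · rw [if_neg hb, if_neg fun h => hb h.2]
      exact h2.1

open Classical in
-- A removed row costs `O(n)` to correct the counters of all columns. As a row is removed at most
-- once, this amounts to `O(s n)` over a whole execution.
theorem wp_updateRows {U R₁ : Finset (Fin s)} {V C₁ : Finset (Fin n)} (h : Ctx A U R₁ V C₁ σ)
    (hrow : RowMem A R σ) (hn : σ.nvar 1 = n) (hR₁ : R₁ ⊆ R) :
    WP updateRows σ (U.card * (n * 60 + 70) + 12) fun τ => RowMem A (R \ R₁) τ ∧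
      (τ.nvar vFlag = 0 ↔ R₁ = ∅) := by
  refine WP.seq (T₁ := 2) (T₂ := U.card * (n * 60 + 70) + 8) (Q₁ := fun τ => τ = σ.setN vFlag 0)
    (WP.block rfl) ?_ (by omega)
  rintro τ rfl hs₁
  have h₁ := h.of_same hs₁
  refine (WP.forEach (T := n * 60 + 50) (fun S τ => RowMem A (R \ (R₁ ∩ S)) τ ∧
      (τ.nvar vFlag = 0 ↔ R₁ ∩ S = ∅)) h₁.rows rfl rfl rfl (by decide) (by decide) (by decide)
      ?_ ?_ ?_ ?_).mono le_rfl ?_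
  · rintro S τ v w ⟨⟨a1, a2, a3, a4⟩, a5⟩
    exact ⟨⟨by simpa [Store.setN] using a1, a2, a3, a4⟩, by simpa [Store.setN] using a5⟩
  · obtain ⟨a1, a2, a3, a4⟩ := hrow
    rw [Finset.inter_empty, Finset.sdiff_empty]
    exact ⟨⟨by simpa [Store.setN] using a1, a2, a3, a4⟩, by simp [Store.setN]⟩
  · rintro S hS i hi hiS τ ⟨hmem, hfl⟩ hτ hs
    have hτctx := h₁.of_same hs
    refine WP.ite (T := n * 60 + 40) ?_ ?_ (by simp [Test.cost, Test.pos, NExp.cost]; omega)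
    · intro hiR
      have hiR : i ∈ R₁ := by
        rw [← hτctx.flagR.2 i hi]
        simpa [NExp.eval, hτ] using hiR
      set R' := R \ (R₁ ∩ S) with hR'
      have hiR' : i ∈ R' := by simp [hR', hR₁ hiR, hiS]
      have e : R \ (R₁ ∩ insert i S) = R'.erase i := by
        rw [Finset.inter_insert_of_mem hiR, Finset.sdiff_insert]
      rw [e]
      refine WP.seq (T₁ := 20) (T₂ := n * 60 + 8) (Q₁ := fun υ => υ.nvar vI = i ∧
        υ.nvar 1 = n ∧ υ.nvar vFlag = 1 ∧ υ.nvar vRem = (R'.erase i).card ∧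
        (∀ k : Fin s, υ.narr aR 0 k ≠ 0 ↔ k ∈ R'.erase i) ∧
        υ.narr aLive = τ.narr aLive ∧ υ.narr aPos = τ.narr aPos) (WP.block ?_) ?_ (by omega)
      · have hn' : τ.nvar 1 = n := by rw [hs.nvar 1 rfl]; simpa [Store.setN] using hn
        have hfi : ∀ k : Fin s, ((k : ℕ) = i) ↔ k = i := fun k => Fin.ext_iff.symm
        refine ⟨by simp [Cmd.run, Store.setN, Store.putN, hτ],
          by simp [Cmd.run, Store.setN, Store.putN, hn'],
          by simp [Cmd.run, Store.setN, Store.putN, NExp.eval], ?_, ?_, ?_, ?_⟩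
        · rw [Finset.card_erase_of_mem hiR']
          simp [Cmd.run, Store.setN, Store.putN, NExp.eval, hmem.rem]
        · intro k
          have := hmem.flagR k
          by_cases hki : k = i
          · simp [Cmd.run, Store.setN, Store.putN, NExp.eval, hki, hτ]
          · simp [Cmd.run, Store.setN, Store.putN, NExp.eval, hki, hfi, hτ, ← this]
        · funext a b; simp [Cmd.run, Store.setN, Store.putN]
        · funext a b; simp [Cmd.run, Store.setN, Store.putN]
      rintro υ ⟨b1, b2, b3, b4, b5, b6, b7⟩ hsυ
      have hυctx := hτctx.of_eq (τ := υ) (hsυ.narr _ rfl) (hsυ.narr _ rfl) (hsυ.narr _ rfl)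
        (hsυ.narr _ rfl) (hsυ.narr _ rfl) (hsυ.nvar _ rfl) (hsυ.nvar _ rfl)
      refine (WP.loopFin (N := n) (T := 50) (fun S' ω => ∀ j : Fin n,
          (ω.narr aLive 0 j = ((if j ∈ S' then R'.erase i else R').filter
            fun i => A i j ≠ ⊥).card) ∧
          (ω.narr aPos 0 j = ((if j ∈ S' then R'.erase i else R').filter
            fun i => A i j ≠ ⊥ ∧ A i j ≠ 0).card))
        b2 rfl rfl (by decide) ?_ ?_ ?_ (by omega)).same.mono le_rfl ?_
      · intro S τ v h; simpa [Store.setN] using h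
      · intro j
        rw [b6, b7]
        simpa using ⟨hmem.live j, hmem.pos j⟩
      · rintro S' j hj ω hω hωj hsω
        have e1 : ω.nvar vI = i := by rw [hsω.nvar vI rfl, b1]
        have e2 : HoldsOrd A ω := by
          intro i j; rw [hsω.narr aOrd rfl]; exact hυctx.ord i j
        have c1 : (R'.filter fun i => A i j ≠ ⊥).card =
            ((R'.erase i).filter fun i => A i j ≠ ⊥).card + if A i j ≠ ⊥ then 1 else 0 := by
          convert card_filter_erase_add hiR' fun i => A i j ≠ ⊥
        have c2 : (R'.filter fun i => A i j ≠ ⊥ ∧ A i j ≠ 0).card =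
            ((R'.erase i).filter fun i => A i j ≠ ⊥ ∧ A i j ≠ 0).card +
              if A i j ≠ ⊥ ∧ A i j ≠ 0 then 1 else 0 := by
          convert card_filter_erase_add hiR' fun i => A i j ≠ ⊥ ∧ A i j ≠ 0
        refine WP.block ?_
        intro k
        obtain ⟨r1, r2⟩ := adjustCol_run (op := .minus) (f := fun a b => a - b)
          (fun _ _ _ => rfl) e1 hωj e2 k
        rw [r1, r2, (hω k).1, (hω k).2]
        by_cases hkj : k = j
        · subst hkj
          simp only [Finset.mem_insert_self, if_true, hj, if_false, true_and]
          constructor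
          · rw [c1]; split_ifs <;> simp
          · rw [c2]; split_ifs <;> simp
        · simp [hkj]
      · rintro ω ⟨hω, hsω⟩
        simp only [Finset.mem_univ, if_true] at hω
        refine ⟨⟨?_, ?_, fun j => (hω j).1, fun j => (hω j).2⟩, ?_⟩
        · rw [hsω.nvar vRem rfl, b4]
        · rw [hsω.narr aR rfl]; exact b5
        · rw [hsω.nvar vFlag rfl, b3, Finset.inter_insert_of_mem hiR]
          simp
    · intro hiR
      have hiR : i ∉ R₁ := by
        rw [← hτctx.flagR.2 i hi]
        simpa [NExp.eval, hτ] using hiR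
      refine (WP.block (T := 1) ?_).mono (by omega) fun _ h => h
      rw [Finset.inter_insert_of_notMem hiR]
      exact ⟨hmem, hfl⟩
  · ring_nf; omega
  · intro τ hτ
    rwa [Finset.inter_eq_left.2 h.flagR.1] at hτ

open Classical in
theorem wp_updateCols {U R₁ : Finset (Fin s)} {V C₁ C Y : Finset (Fin n)} (h : Ctx A U R₁ V C₁ σ)
    (hC : ∀ j : Fin n, σ.narr aC 0 j ≠ 0 ↔ j ∈ C) (hY : ∀ j : Fin n, σ.narr aOut 0 j ≠ 0 ↔ j ∈ Y) :
    WP updateCols σ (V.card * 60 + 8) fun τ => (∀ j : Fin n, τ.narr aC 0 j ≠ 0 ↔ j ∈ C \ C₁) ∧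
      ∀ j : Fin n, τ.narr aOut 0 j ≠ 0 ↔ j ∈ Y ∪ C₁.filter fun j => σ.narr aPiv 0 j ≠ 0 := by
  refine (WP.forEach (T := 46) (fun S τ =>
      (∀ j : Fin n, τ.narr aC 0 j ≠ 0 ↔ j ∈ C \ (C₁ ∩ S)) ∧
      ∀ j : Fin n, τ.narr aOut 0 j ≠ 0 ↔ j ∈ Y ∪ (C₁ ∩ S).filter fun j => σ.narr aPiv 0 j ≠ 0)
    h.cols rfl rfl rfl (by decide) (by decide) (by decide) ?_ ?_ ?_ (by omega)).mono le_rfl ?_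
  · intro S τ v w h; simpa [Store.setN] using h
  · simpa using ⟨hC, hY⟩
  · rintro S hS j hj hjS τ ⟨a1, a2⟩ hτ hs
    have h' := h.of_same hs
    have hfj : ∀ k : Fin n, ((k : ℕ) = j) ↔ k = j := fun k => Fin.ext_iff.symm
    have e1 : τ.narr aPiv = σ.narr aPiv := hs.narr _ rfl
    refine WP.block ?_
    simp only [Cmd.run, Test.eval_pos, NExp.eval, hτ, h'.flagC.2 j hj]
    split_ifs with h1 h2
    · simp only [Store.putN, hτ] at h2
      simp [e1] at h2
      rw [Finset.inter_insert_of_mem h1]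
      refine ⟨fun k => ?_, fun k => ?_⟩
      · have := a1 k
        by_cases hkj : k = j
        · simp [Store.putN, hτ, hkj]
        · simp [Store.putN, hτ, hfj, hkj] at this ⊢
          exact this
      · have := a2 k
        by_cases hkj : k = j
        · simp [Store.putN, hτ, hkj, h2]
        · simp [Store.putN, hτ, hfj, hkj] at this ⊢
          exact this
    · simp only [Store.putN, hτ] at h2
      simp [e1] at h2
      rw [Finset.inter_insert_of_mem h1]
      refine ⟨fun k => ?_, fun k => ?_⟩
      · have := a1 k
        by_cases hkj : k = j
        · simp [Store.putN, hkj]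
        · simp [Store.putN, hfj, hkj] at this ⊢
          exact this
      · have := a2 k
        by_cases hkj : k = j
        · subst hkj
          simp [Store.putN, h2] at this ⊢
          rw [this]
        · simp [Store.putN, hkj] at this ⊢
          exact this
    · rw [Finset.inter_insert_of_notMem h1]
      exact ⟨a1, a2⟩
  · intro τ hτ
    rwa [Finset.inter_eq_left.2 h.flagC.1] at hτ

end MainProgram

/-! ### The main loop and the sum of its costs -/

section MainLoop

set_option linter.unusedSectionVars false

variable {F : Type} [Field F] {s n : ℕ} {A : Matrix (Fin s) (Fin n) (WithBot ℕ)}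
  {J : Matrix (Fin s) (Fin n) F} {R R₁ : Finset (Fin s)} {C C₁ Y : Finset (Fin n)} {q c : ℕ}
  {σ τ : Store F}

theorem WP.seq_exec {b b' : Cmd} {t T T₂ : ℕ} {Q : Store F → Prop} (h : Exec b σ τ t)
    (h' : WP b' τ T₂ Q) (hT : t + T₂ ≤ T) : WP (b ;; b') σ T Q := by
  obtain ⟨υ, t', he, ht, hq⟩ := h'
  exact ⟨υ, t + t', Exec.seq _ _ _ _ _ _ _ h he, by omega, hq⟩

theorem RowMem.of_eq (h : RowMem A R σ) (h1 : τ.nvar vRem = σ.nvar vRem)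
    (h2 : τ.narr aR = σ.narr aR) (h3 : τ.narr aLive = σ.narr aLive)
    (h4 : τ.narr aPos = σ.narr aPos) : RowMem A R τ :=
  ⟨h1.trans h.rem, by rw [h2]; exact h.flagR, by rw [h3]; exact h.live, by rw [h4]; exact h.pos⟩

theorem eq_bot_or_zero_of_mem_bCols {i : Fin s} {j : Fin n} (hi : i ∈ R) (hj : j ∈ bCols A R C) :
    A i j = ⊥ ∨ A i j = 0 := by
  classical
  exact (Finset.mem_filter.1 hj).2 i hi

/-- The columns kept by `Seq` consist of `-∞` in the equations that remain. -/
theorem eq_bot_of_mem_sdiff (h : SeqRun A J (bRows A R C) (bCols A R C) R₁ C₁ q c) {i : Fin s}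
    {j : Fin n} (hi : i ∈ R \ R₁) (hj : j ∈ C₁) : A i j = ⊥ := by
  classical
  obtain ⟨hi, hi'⟩ := Finset.mem_sdiff.1 hi
  by_cases hib : i ∈ bRows A R C
  · exact h.eq_bot (fun i hi j hj => eq_bot_or_zero_of_mem_bCols (bRows_subset A R C hi) hj)
      i hib hi' j hj
  · refine (eq_bot_or_zero_of_mem_bCols hi (h.subset.2 hj)).resolve_right fun h0 => hib ?_
    exact Finset.mem_filter.2 ⟨hi, j, h.subset.2 hj, h0⟩

/-- The columns that disappear consist of `-∞` in the remaining rows. Rows of `-∞` therefore cannot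
arise later, and the program looks for them only once. -/
theorem exists_ne_bot_of_mem_sdiff (h : SeqRun A J (bRows A R C) (bCols A R C) R₁ C₁ q c)
    (hl : ∀ i ∈ R, ∃ j ∈ C, A i j ≠ ⊥) :
    ∀ i ∈ R \ R₁, ∃ j ∈ liveCols A R C \ C₁, A i j ≠ ⊥ := by
  classical
  intro i hi
  obtain ⟨j, hj, hij⟩ := hl i (Finset.mem_sdiff.1 hi).1
  refine ⟨j, Finset.mem_sdiff.2 ⟨Finset.mem_filter.2 ⟨hj, i, (Finset.mem_sdiff.1 hi).1, hij⟩,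
    fun hj₁ => hij (eq_bot_of_mem_sdiff h hi hj₁)⟩, hij⟩

/-- A bound for the number of operations of a call of `Ō-reg`. -/
def callCost (s n m d q : ℕ) : ℕ :=
  n * 90 + s * (m * 40 + 80) + q * ((d + 3) ^ 2 * (m + 2) * 1000 + 4) + d * (n * 60 + 70) +
    m * 60 + 100

theorem wp_callBody_reject (h : MainMem A J R C Y σ) (hc : C.card < R.card) (m d q : ℕ) :
    WP callBody σ (callCost s n m d q) fun τ => τ.nvar vOk = 0 := by
  refine WP.seq (T₂ := 20) (wp_scanCols h) ?_ (by unfold callCost; omega)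
  rintro τ ⟨h1, -⟩ hs
  have hb : ¬ (Test.le (.var vRem) (.var vCount)).eval τ := by
    have e : τ.nvar vRem = σ.nvar vRem := hs.nvar _ rfl
    simp only [Test.eval, NExp.eval, e, h.rem, h1]
    omega
  refine WP.ite (T := 2) (fun h => absurd h hb) (fun _ => WP.block ?_) (by decide)
  simp [Cmd.run, Store.setN, NExp.eval]

/-- The columns `Y₁` are read off from the pivots that the last iteration of `Seq` has left in
memory; `ElimState.pivot_columns` provides their number and the nonvanishing minor, so no second
elimination is made. -/
theorem wp_callBody (h : MainMem A J R C Y σ) (hc : R.card ≤ C.card) :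
    ∃ R₁ C₁ q c, SeqRun A J (bRows A R C) (bCols A R C) R₁ C₁ q c ∧
      WP callBody σ (callCost s n (bCols A R C).card (bRows A R C).card q) fun τ =>
        (R₁ = ∅ → τ.nvar vOk = 0) ∧
        (R₁.Nonempty → τ.nvar vOk = σ.nvar vOk ∧ ∃ Y₁ ⊆ C₁, ∃ hcard : Y₁.card = R₁.card,
          Matrix.det (J.submatrix (R₁.orderEmbOfFin rfl) (Y₁.orderEmbOfFin hcard)) ≠ 0 ∧
          MainMem A J (R \ R₁) (liveCols A R C \ C₁) (Y ∪ Y₁) τ) := by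
  classical
  obtain ⟨σ₁, t₁, he₁, ht₁, a1, a2, a3, a4⟩ := wp_scanCols h
  have s1 := he₁.same
  have hord₁ : HoldsOrd A σ₁ := by intro i j; rw [s1.narr aOrd rfl]; exact h.ord i j
  obtain ⟨σ₂, t₂, he₂, ht₂, b1, b2⟩ := wp_scanRows hord₁
    ((s1.nvar 0 rfl).trans h.nrows) (by rw [s1.narr aR rfl]; exact h.flagR) a2
  have s2 := he₂.same
  have hord₂ : HoldsOrd A σ₂ := by intro i j; rw [s2.narr aOrd rfl]; exact hord₁ i j
  have c2 : Ctx A (bRows A R C) (bRows A R C) (bCols A R C) (bCols A R C) σ₂ := by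
    refine ⟨hord₂, b1, ?_, b2, a4.of_narr (s2.narr _ rfl)⟩
    rw [s2.nvar vNumV rfl]
    exact a2.of_narr (s2.narr _ rfl)
  have he₃ : Exec (.setN vChanged (.const 1)) σ₂ (σ₂.setN vChanged 1) 2 := Exec.setN _ _ _
  set σ₃ := σ₂.setN vChanged 1
  have s3 := he₃.same
  have c3 := c2.of_same s3
  have hJ₃ : HoldsJac J σ₃ := by
    intro i j; rw [s3.farr 0 rfl, s2.farr 0 rfl, s1.farr 0 rfl]; exact h.jac i j
  obtain ⟨R₁, C₁, q, c, hseq, σ₄, t₄, he₄, ht₄, c4, hker, D, helim⟩ :=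
    wp_seqLoop c3 hJ₃ (by simp [σ₃, Store.setN])
  have s4 := he₄.same
  refine ⟨R₁, C₁, q, c, hseq, ?_⟩
  refine WP.seq_exec he₁
    (T₂ := s * ((bCols A R C).card * 40 + 80) + 12 + (2 +
      (q * (((bRows A R C).card + 3) ^ 2 * ((bCols A R C).card + 2) * 1000 + 4) + 4 +
      ((bRows A R C).card * (n * 60 + 70) + 12 + ((bCols A R C).card * 60 + 8 + 10)))) + 10) ?_
      (by unfold callCost; omega)
  have hb : (Test.le (.var vRem) (.var vCount)).eval σ₁ := by
    have e : σ₁.nvar vRem = σ.nvar vRem := s1.nvar _ rfl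
    simp only [Test.eval, NExp.eval, e, h.rem, a1]
    omega
  refine WP.ite (T := s * ((bCols A R C).card * 40 + 80) + 12 + (2 +
      (q * (((bRows A R C).card + 3) ^ 2 * ((bCols A R C).card + 2) * 1000 + 4) + 4 +
      ((bRows A R C).card * (n * 60 + 70) + 12 + ((bCols A R C).card * 60 + 8 + 10)))))
    (fun _ => ?_) (fun h => absurd hb h) ?_
  swap
  · simp only [Test.cost, NExp.cost]; omega
  refine WP.seq_exec he₂ ?_ (by gcongr)
    (T₂ := 2 +
      (q * (((bRows A R C).card + 3) ^ 2 * ((bCols A R C).card + 2) * 1000 + 4) + 4 +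
      ((bRows A R C).card * (n * 60 + 70) + 12 + ((bCols A R C).card * 60 + 8 + 10))))
  refine WP.seq_exec he₃ ?_ le_rfl
  refine WP.seq_exec he₄ ?_ (by gcongr)
  have hrow : RowMem A R σ₄ := by
    refine h.toRowMem.of_eq ?_ ?_ ?_ ?_
    · rw [s4.nvar vRem rfl, s3.nvar vRem rfl, s2.nvar vRem rfl, s1.nvar vRem rfl]
    · rw [s4.narr aR rfl, s3.narr aR rfl, s2.narr aR rfl, s1.narr aR rfl]
    · rw [s4.narr aLive rfl, s3.narr aLive rfl, s2.narr aLive rfl, s1.narr aLive rfl]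
    · rw [s4.narr aPos rfl, s3.narr aPos rfl, s2.narr aPos rfl, s1.narr aPos rfl]
  have hn : σ₄.nvar 1 = n := by
    rw [s4.nvar 1 rfl, s3.nvar 1 rfl, s2.nvar 1 rfl, s1.nvar 1 rfl, h.ncols]
  refine WP.seq (wp_updateRows c4 hrow hn (hseq.subset.1.trans (bRows_subset A R C))) ?_ le_rfl
  rintro σ₅ ⟨d1, d2⟩ s5
  have c5 := c4.of_same s5
  have hpiv : σ₅.narr aPiv = σ₄.narr aPiv := s5.narr _ rfl
  refine WP.seq (wp_updateCols (C := liveCols A R C) (Y := Y) c5 ?_ ?_) ?_ le_rfl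
  · rw [s5.narr aC rfl, s4.narr aC rfl, s3.narr aC rfl, s2.narr aC rfl]; exact a3
  · rw [s5.narr aOut rfl, s4.narr aOut rfl, s3.narr aOut rfl, s2.narr aOut rfl, s1.narr aOut rfl]
    exact h.out
  rintro σ₆ ⟨e1, e2⟩ s6
  have hfl : σ₆.nvar vFlag = 0 ↔ R₁ = ∅ := by rw [s6.nvar vFlag rfl]; exact d2
  have hok : σ₆.nvar vOk = σ.nvar vOk := by
    rw [s6.nvar vOk rfl, s5.nvar vOk rfl, s4.nvar vOk rfl, s3.nvar vOk rfl, s2.nvar vOk rfl,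
      s1.nvar vOk rfl]
  refine WP.block ?_
  simp only [Cmd.run, Test.eval_pos, NExp.eval, ne_eq, hfl]
  split_ifs with hR₁
  · exact ⟨fun _ => by simp [Store.setN], fun h => absurd hR₁ h.ne_empty⟩
  · refine ⟨fun h => absurd h hR₁, fun _ => ⟨hok, C₁.filter fun j => σ₅.narr aPiv 0 j ≠ 0,
      Finset.filter_subset _ _, ?_⟩⟩
    obtain ⟨hcard, hdet⟩ := helim.pivot_columns hseq.subset.1 hker
      (Y := C₁.filter fun j => σ₅.narr aPiv 0 j ≠ 0)
      (fun j => by rw [hpiv, Finset.mem_filter])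
    refine ⟨hcard, hdet, ⟨d1.of_eq (s6.nvar _ rfl) (s6.narr _ rfl) (s6.narr _ rfl) (s6.narr _ rfl),
      ?_, ?_, ?_, ?_, e1, e2⟩⟩
    · intro i j; rw [s6.narr aOrd rfl]; exact c5.ord i j
    · intro i j; rw [s6.farr 0 rfl, s5.farr 0 rfl, s4.farr 0 rfl]; exact hJ₃ i j
    · rw [s6.nvar 0 rfl, s5.nvar 0 rfl, s4.nvar 0 rfl, s3.nvar 0 rfl, s2.nvar 0 rfl,
        s1.nvar 0 rfl, h.nrows]
    · rw [s6.nvar 1 rfl, s5.nvar 1 rfl, hn]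

/-- The numbers `m` and `d` vanish together. If they do, then `q = 1` and the constants are absorbed
by `s * n ≥ 1`; otherwise by `d ^ 2 * n ≥ 1`. -/
theorem callCost_le {m d q : ℕ} (hm : m ≤ n) (hd : d ≤ s) (hs : 1 ≤ s) (hn : 1 ≤ n)
    (hmd : m = 0 ↔ d = 0) (hmq : m = 0 → q = 1) :
    20 + callCost s n m d q ≤ 100000 * ((q * d ^ 2 + s) * n) := by
  have hsn : 1 ≤ s * n := Nat.mul_pos hs hn
  have h1 : n ≤ s * n := Nat.le_mul_of_pos_left _ hs
  have h2 : s ≤ s * n := Nat.le_mul_of_pos_right _ hn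
  have h3 : s * m ≤ s * n := Nat.mul_le_mul_left _ hm
  have h4 : d * n ≤ s * n := Nat.mul_le_mul_right _ hd
  have e : callCost s n m d q = n * 90 + s * m * 40 + s * 80 +
      q * ((d + 3) ^ 2 * (m + 2) * 1000 + 4) + d * n * 60 + d * 70 + m * 60 + 100 := by
    unfold callCost; ring
  have e' : 100000 * ((q * d ^ 2 + s) * n) = 100000 * (q * (d ^ 2 * n)) + 100000 * (s * n) := by
    ring
  have key : q * ((d + 3) ^ 2 * (m + 2) * 1000 + 4) ≤ 100000 * (q * (d ^ 2 * n)) + 20000 := by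
    rcases Nat.eq_zero_or_pos m with hm0 | hm0
    · have hd0 := hmd.1 hm0
      rw [hmq hm0, hm0, hd0]
      norm_num
    · have hd0 : 1 ≤ d := Nat.pos_of_ne_zero fun h => hm0.ne' (hmd.2 h)
      have k1 : (d + 3) ^ 2 ≤ 16 * d ^ 2 := by nlinarith
      have k2 : m + 2 ≤ 3 * n := by omega
      have k3 : (d + 3) ^ 2 * (m + 2) ≤ 16 * d ^ 2 * (3 * n) := Nat.mul_le_mul k1 k2
      have k4 : 1 ≤ d ^ 2 * n := Nat.mul_pos (Nat.pow_pos hd0) hn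
      have k5 : (d + 3) ^ 2 * (m + 2) * 1000 + 4 ≤ 100000 * (d ^ 2 * n) := by nlinarith
      calc _ ≤ q * (100000 * (d ^ 2 * n)) := Nat.mul_le_mul_left _ k5
        _ ≤ _ := by rw [Nat.mul_left_comm]; omega
  omega

/-- The right side is arranged so as to telescope: `m` columns and `d` rows leave the system when
`Seq` makes a single iteration. -/
theorem callCost_one_le {m d : ℕ} (hm : m ≤ n) (hsn : s ≤ n)
    (hmd : m = 0 ↔ d = 0) :
    20 + callCost s n m d 1 ≤ 50000 * (d ^ 2 * m + s * m + (d + 1) * (n + 1)) := by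
  have e : callCost s n m d 1 = n * 90 + s * m * 40 + s * 80 +
      ((d + 3) ^ 2 * (m + 2) * 1000 + 4) + d * n * 60 + d * 70 + m * 60 + 100 := by
    unfold callCost; ring
  have e' : 50000 * (d ^ 2 * m + s * m + (d + 1) * (n + 1)) = 50000 * (d ^ 2 * m) +
      50000 * (s * m) + 50000 * (d * n) + 50000 * d + 50000 * n + 50000 := by ring
  have key : (d + 3) ^ 2 * (m + 2) * 1000 + 4 ≤ 50000 * (d ^ 2 * m) + 20000 := by
    rcases Nat.eq_zero_or_pos m with hm0 | hm0
    · have hd0 := hmd.1 hm0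
      rw [hm0, hd0]
      norm_num
    · have hd0 : 1 ≤ d := Nat.pos_of_ne_zero fun h => hm0.ne' (hmd.2 h)
      have k1 : (d + 3) ^ 2 ≤ 16 * d ^ 2 := by nlinarith
      have k2 : m + 2 ≤ 3 * m := by omega
      have k3 : (d + 3) ^ 2 * (m + 2) ≤ 16 * d ^ 2 * (3 * m) := Nat.mul_le_mul k1 k2
      nlinarith
  omega

theorem card_bCols_eq_zero_iff : (bCols A R C).card = 0 ↔ (bRows A R C).card = 0 := by
  classical
  rw [Finset.card_eq_zero, Finset.card_eq_zero]
  constructor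
  · intro h
    simp [bRows, h]
  · intro h
    refine Finset.eq_empty_of_forall_notMem fun j hj => ?_
    obtain ⟨-, i, hi, hij⟩ := Finset.mem_filter.1 (bCols_subset_liveCols A R C hj)
    have : i ∈ bRows A R C := Finset.mem_filter.2 ⟨hi, j, hj,
      (eq_bot_or_zero_of_mem_bCols hi hj).resolve_left hij⟩
    rw [h] at this
    simp at this

/-- A single iteration of `Seq` keeps all of `B`, so every row and column of `B` leaves the system.
-/
theorem card_sdiff_of_seqRun (h : SeqRun A J (bRows A R C) (bCols A R C) R₁ C₁ q c) (hq : q ≤ 1) :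
    (R \ R₁).card + (bRows A R C).card = R.card ∧
      (liveCols A R C \ C₁).card + (bCols A R C).card ≤ C.card := by
  obtain ⟨rfl, rfl⟩ := h.of_le_one hq
  refine ⟨Finset.card_sdiff_add_card_eq_card (bRows_subset A R C), ?_⟩
  rw [Finset.card_sdiff_add_card_eq_card (bCols_subset_liveCols A R C)]
  exact Finset.card_le_card (liveCols_subset A R C)

/-- The run is built along with the execution, by induction on `R.card`. For the first bound each
call is charged the largest possible cost, which gives the factor `p`. For the second, `d ^ 2 *
C.card + s * C.card + (R.card + 1) * (n + 1)` serves as a credit: what a call removes from `R` and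
`C` lowers it enough to pay for that call. -/
theorem wp_mainLoop (hsn : s ≤ n) (h : MainMem A J R C Y σ) (hok : σ.nvar vOk ≠ 0)
    (hl : ∀ i ∈ R, ∃ j ∈ C, A i j ≠ ⊥) :
    ∃ out st T, ORegRun A J R C out st ∧
      WP mainLoop σ T (fun τ => outputOf n τ = out.map fun Y' => Y ∪ Y') ∧
      T ≤ 100000 * (st.p * ((st.q * st.d ^ 2 + s) * n) + 1) ∧
      (st.q ≤ 1 →
        T ≤ 100000 * (st.d ^ 2 * C.card + s * C.card + (R.card + 1) * (n + 1))) := by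
  classical
  induction hN : R.card using Nat.strong_induction_on generalizing R C Y σ with
  | _ N ih =>
  have hcost : (Test.conj (.pos (.var vOk)) (.pos (.var vRem))).cost + 1 ≤ 12 := by decide
  rcases R.eq_empty_or_nonempty with rfl | hR
  · refine ⟨_, _, 12, .nil C, WP.while_exit ?_ ?_ hcost, by simp, fun _ => ?_⟩
    · have := h.rem
      simp [Test.eval, NExp.eval, this]
    · rw [outputOf, if_neg hok]
      simp only [Option.map_some, Finset.union_empty, Option.some.injEq]
      ext j
      simpa using h.out j
    · have : 0 ≤ s * C.card + (N + 1) * n := Nat.zero_le _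
      nlinarith
  have hRc := hR.card_pos
  have hs1 : 1 ≤ s := by
    have := R.card_le_univ
    rw [Fintype.card_fin] at this
    omega
  have hb : (Test.conj (.pos (.var vOk)) (.pos (.var vRem))).eval σ := by
    have := h.rem
    simp only [Test.eval, Test.eval_pos, NExp.eval]
    exact ⟨hok, by omega⟩
  have hdone : ∀ τ : Store F, τ.nvar vOk = 0 → WP mainLoop τ 12 (fun τ => outputOf n τ = none) := by
    intro τ hτ
    refine WP.while_exit ?_ ?_ hcost
    · simp [Test.eval, NExp.eval, hτ]
    · rw [outputOf, if_pos hτ]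
  have hd := Finset.card_le_univ (bRows A R C)
  have hm := Finset.card_le_univ (bCols A R C)
  rw [Fintype.card_fin] at hd hm
  by_cases hc : C.card < R.card
  · have hcc : 24 + callCost s n 0 0 1 ≤ 50000 * (n + 1) := by
      unfold callCost; omega
    refine ⟨_, _, 24 + callCost s n 0 0 1, .reject R C hR (Or.inl hc),
      WP.while_step hb (wp_callBody_reject h hc 0 0 1) (fun τ hτ _ => hdone τ hτ) (by omega), ?_,
      fun _ => ?_⟩
    · have : n ≤ s * n := Nat.le_mul_of_pos_left _ hs1
      simp only
      nlinarith
    · have : (N + 1) * (n + 1) = N * n + N + n + 1 := by ring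
      omega
  obtain ⟨R₁, C₁, q, c, hseq, τ, t, he, ht, hz, hnz⟩ := wp_callBody h (not_lt.1 hc)
  have hrej : ¬ (C.card < R.card ∨ ∃ i ∈ R, ∀ j ∈ C, A i j = ⊥) := by
    rintro (h' | ⟨i, hi, h'⟩)
    · exact hc h'
    · obtain ⟨j, hj, hij⟩ := hl i hi
      exact hij (h' j hj)
  have hmd : (bCols A R C).card = 0 ↔ (bRows A R C).card = 0 := card_bCols_eq_zero_iff
  have hmq : (bCols A R C).card = 0 → q = 1 := by
    intro h0
    have h1 := hmd.1 h0
    rw [Finset.card_eq_zero] at h0 h1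
    rw [h0, h1] at hseq
    exact hseq.of_empty
  have hcall := callCost_le hm hd hs1 (hs1.trans hsn) hmd hmq
  have hcall' := callCost_one_le hm hsn hmd
  set m := (bCols A R C).card with hmdef
  set d := (bRows A R C).card with hddef
  have hmC : m ≤ C.card :=
    Finset.card_le_card ((bCols_subset_liveCols A R C).trans (liveCols_subset A R C))
  rcases R₁.eq_empty_or_nonempty with rfl | hR₁
  · refine ⟨_, _, 24 + callCost s n m d q, .seqFailed R C C₁ q c hR hrej hseq,
      WP.while_step (Q₁ := fun υ => υ = τ) hb ⟨τ, t, he, ht, rfl⟩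
        (fun υ hυ _ => hdone υ (hυ ▸ hz rfl)) (by omega), ?_, fun hq => ?_⟩
    · simp only [one_mul, ← hddef]
      omega
    · simp only at hq ⊢
      have hq1 : q = 1 := le_antisymm hq hseq.one_le
      have h1 := card_sdiff_of_seqRun hseq hq
      -- The only iteration has changed nothing, so an empty result means that `B` was already
      -- empty.
      have hd0 : d = 0 := by
        have := h1.1
        rw [Finset.sdiff_empty] at this
        omega
      have hm0 := hmd.2 hd0
      rw [hq1]
      rw [hd0, hm0] at hcall' ⊢
      have : (N + 1) * (n + 1) = N * n + N + n + 1 := by ring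
      omega
  · obtain ⟨hok', Y₁, hY₁, hcard, hdet, hmem⟩ := hnz hR₁
    have hR₁R : R₁ ⊆ R := hseq.subset.1.trans (bRows_subset A R C)
    have hlt : (R \ R₁).card < N := by
      have h1 := Finset.card_sdiff_add_card_eq_card hR₁R
      have h2 := hR₁.card_pos
      omega
    obtain ⟨out, st, T, hrun, hwp, hT, hT'⟩ := ih _ hlt hmem (hok'.trans_ne hok)
      (exists_ne_bot_of_mem_sdiff hseq hl) rfl
    refine ⟨_, _, 20 + callCost s n m d q + T, .step R R₁ C C₁ Y₁ q c out st hR hrej hseq hR₁ hY₁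
      hcard hdet hrun, WP.while_step (Q₁ := fun υ => υ = τ) hb ⟨τ, t, he, ht, rfl⟩
        (T₂ := T) ?_ (by omega), ?_, ?_⟩
    · rintro υ rfl -
      refine hwp.mono le_rfl fun υ hυ => hυ.trans ?_
      rw [Option.map_map]
      congr 1
      funext Y'
      exact Finset.union_assoc _ _ _
    · simp only [← hddef]
      have k1 : (q * d ^ 2 + s) * n ≤ (max q st.q * (max d st.d) ^ 2 + s) * n := by
        gcongr
        · exact le_max_left _ _
        · exact le_max_left _ _
      have k2 : st.p * ((st.q * st.d ^ 2 + s) * n) ≤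
          st.p * ((max q st.q * (max d st.d) ^ 2 + s) * n) := by
        gcongr
        · exact le_max_right _ _
        · exact le_max_right _ _
      rw [Nat.add_mul, one_mul]
      omega
    · simp only
      intro hq
      have hq0 : q ≤ 1 := (le_max_left _ _).trans hq
      have hq1 : q = 1 := le_antisymm hq0 hseq.one_le
      have hT2 := hT' ((le_max_right _ _).trans hq)
      obtain ⟨h1, h2⟩ := card_sdiff_of_seqRun hseq hq0
      have hR₁' := hR₁.card_pos
      rw [(hseq.of_le_one hq0).1, ← hddef] at hR₁'
      set D := max d st.d with hD
      have k1 : st.d ^ 2 * (liveCols A R C \ C₁).card + d ^ 2 * m ≤ D ^ 2 * C.card := by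
        calc _ ≤ D ^ 2 * (liveCols A R C \ C₁).card + D ^ 2 * m := by
              gcongr
              · exact le_max_right _ _
              · exact le_max_left _ _
          _ = D ^ 2 * ((liveCols A R C \ C₁).card + m) := by ring
          _ ≤ _ := by gcongr
      have k2 : s * (liveCols A R C \ C₁).card + s * m ≤ s * C.card := by
        rw [← Nat.mul_add]; gcongr
      have k3 : ((R \ R₁).card + 1) * (n + 1) + d * (n + 1) = (N + 1) * (n + 1) := by
        rw [← hN, ← h1]; ring
      -- Here `d ≥ 1`, since `R₁` is nonempty. This factor 2 is the reason for passing from 50000 to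
      -- 100000.
      have k4 : (d + 1) * (n + 1) ≤ 2 * (d * (n + 1)) := by nlinarith
      rw [hq1]
      omega

end MainLoop

/-! ### Initialization and the complete program -/

section Program

set_option linter.unusedSectionVars false

variable {F : Type} [Field F] {s n : ℕ} {A : Matrix (Fin s) (Fin n) (WithBot ℕ)}
  {J : Matrix (Fin s) (Fin n) F} {σ τ : Store F}

theorem card_filter_insert {ι : Type*} [DecidableEq ι] {S : Finset ι} {i : ι} (hi : i ∉ S)
    (p : ι → Prop) [DecidablePred p] :
    ((insert i S).filter p).card = if p i then (S.filter p).card + 1 else (S.filter p).card := by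
  rw [Finset.filter_insert]
  split_ifs with h
  · rw [Finset.card_insert_of_notMem (by simp [hi])]
  · rfl

open Classical in
theorem wp_initArrays (hord : HoldsOrd A σ) (hs : σ.nvar 0 = s) (hn : σ.nvar 1 = n)
    (hlive : ∀ j : Fin n, σ.narr aLive 0 j = 0) (hpos : ∀ j : Fin n, σ.narr aPos 0 j = 0) :
    WP initArrays σ (s * 20 + n * (s * 60 + 40) + 20) fun τ =>
      (∀ i : Fin s, τ.narr aR 0 i ≠ 0) ∧ (∀ j : Fin n, τ.narr aC 0 j ≠ 0) ∧
      (∀ j : Fin n, τ.narr aLive 0 j = (Finset.univ.filter fun i => A i j ≠ ⊥).card) ∧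
      ∀ j : Fin n, τ.narr aPos 0 j = (Finset.univ.filter fun i => A i j ≠ ⊥ ∧ A i j ≠ 0).card := by
  refine WP.seq (T₁ := s * 20 + 8) (T₂ := n * (s * 60 + 40) + 8) (WP.loopFin (N := s) (T := 10)
    (fun S τ => ∀ i ∈ S, τ.narr aR 0 (i : ℕ) ≠ 0) hs rfl rfl (by decide) ?_ (by simp) ?_
    (by omega)) ?_ (by omega)
  · intro S τ v h; simpa [Store.setN] using h
  · intro S i _ τ h hτ _
    refine WP.block fun k hk => ?_
    have hfi : ((k : ℕ) = i) ↔ k = i := Fin.ext_iff.symm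
    by_cases hki : k = i
    · simp [Cmd.run, Store.putN, NExp.eval, hki, hτ]
    · have := h k ((Finset.mem_insert.1 hk).resolve_left hki)
      simpa [Cmd.run, Store.putN, NExp.eval, hki, hτ, hfi] using this
  rintro σ₁ h1 s1
  refine (WP.loopFin (N := n) (T := s * 60 + 30) (fun S τ => ∀ k : Fin n,
      (k ∈ S → τ.narr aC 0 k ≠ 0) ∧
      (τ.narr aLive 0 k = if k ∈ S then (Finset.univ.filter fun i => A i k ≠ ⊥).card else 0) ∧
      (τ.narr aPos 0 k =
        if k ∈ S then (Finset.univ.filter fun i => A i k ≠ ⊥ ∧ A i k ≠ 0).card else 0))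
    ((s1.nvar 1 rfl).trans hn) rfl rfl (by decide) ?_ ?_ ?_ (le_of_eq (by ring))).same.mono
    le_rfl ?_
  · intro S τ v h; simpa [Store.setN] using h
  · intro k
    rw [s1.narr aLive rfl, s1.narr aPos rfl]
    simpa using ⟨hlive k, hpos k⟩
  · rintro S j hj τ h hτ hsτ
    refine WP.seq (T₁ := 10) (T₂ := s * 60 + 8) (Q₁ := fun υ => υ = τ.putN aC 0 j 1)
      (WP.block ?_) ?_ (by omega)
    · simp [Cmd.run, NExp.eval, hτ]
    rintro υ rfl sυ
    have hs' : (τ.putN aC 0 j 1).nvar 0 = s := by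
      rw [sυ.nvar 0 rfl, hsτ.nvar 0 rfl, s1.nvar 0 rfl, hs]
    have hfj : ∀ k : Fin n, ((k : ℕ) = j) ↔ k = j := fun k => Fin.ext_iff.symm
    refine (WP.loopFin (N := s) (T := 50) (fun S' ω => ∀ k : Fin n,
        (k ∈ insert j S → ω.narr aC 0 k ≠ 0) ∧
        (ω.narr aLive 0 k = if k = j then (S'.filter fun i => A i k ≠ ⊥).card else
          τ.narr aLive 0 k) ∧
        (ω.narr aPos 0 k = if k = j then (S'.filter fun i => A i k ≠ ⊥ ∧ A i k ≠ 0).card else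
          τ.narr aPos 0 k)) hs' rfl rfl (by decide) ?_ ?_ ?_ (by omega)).mono le_rfl ?_
    · intro S τ v h; simpa [Store.setN] using h
    · intro k
      refine ⟨fun hk => ?_, ?_, ?_⟩
      · by_cases hkj : k = j
        · simp [Store.putN, hkj]
        · have := (h k).1 ((Finset.mem_insert.1 hk).resolve_left hkj)
          simpa [Store.putN, hkj, hfj] using this
      · have := (h k).2.1
        by_cases hkj : k = j
        · subst hkj; simpa [Store.putN, hj] using this
        · simp [Store.putN, hkj]
      · have := (h k).2.2
        by_cases hkj : k = j
        · subst hkj; simpa [Store.putN, hj] using this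
        · simp [Store.putN, hkj]
    · rintro S' i hi ω hω hωi hsω
      have e1 : ω.nvar vJ = j := by rw [hsω.nvar vJ rfl, sυ.nvar vJ rfl, hτ]
      have e2 : HoldsOrd A ω := by
        intro i j
        rw [hsω.narr aOrd rfl, sυ.narr aOrd rfl, hsτ.narr aOrd rfl, s1.narr aOrd rfl]
        exact hord i j
      obtain ⟨υ, t, he, ht, rfl⟩ : WP (adjustCol .plus) ω 50
        (fun υ => υ = (adjustCol .plus).run ω) := WP.block rfl
      refine ⟨_, t, he, ht, fun k => ?_⟩
      obtain ⟨r1, r2⟩ := adjustCol_run (op := .plus) (f := fun a b => a + b)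
        (fun _ _ _ => rfl) hωi e1 e2 k
      rw [r1, r2, he.same.narr aC rfl]
      refine ⟨(hω k).1, ?_, ?_⟩
      · rw [(hω k).2.1]
        by_cases hkj : k = j
        · subst hkj
          rw [card_filter_insert hi]
          split_ifs <;> simp_all
        · simp [hkj]
      · rw [(hω k).2.2]
        by_cases hkj : k = j
        · subst hkj
          rw [card_filter_insert hi]
          split_ifs <;> simp_all
        · simp [hkj]
    · intro ω hω k
      refine ⟨(hω k).1, ?_, ?_⟩
      · rw [(hω k).2.1, (h k).2.1]
        by_cases hkj : k = j <;> simp [hkj]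
      · rw [(hω k).2.2, (h k).2.2]
        by_cases hkj : k = j <;> simp [hkj]
  · rintro τ ⟨h, hsτ⟩
    refine ⟨fun i => ?_, fun j => (h j).1 (Finset.mem_univ j), fun j => ?_, fun j => ?_⟩
    · rw [hsτ.narr aR rfl]; exact h1 i (Finset.mem_univ i)
    · simpa using (h j).2.1
    · simpa using (h j).2.2

open Classical in
theorem wp_initCheck (hord : HoldsOrd A σ) (hs : σ.nvar 0 = s) (hn : σ.nvar 1 = n) :
    WP initCheck σ (s * (n * 40 + 60) + 40) fun τ => τ.nvar vRem = s ∧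
      (τ.nvar vOk ≠ 0 ↔ s ≤ n ∧ ∀ i, ∃ j, A i j ≠ ⊥) := by
  refine WP.seq (T₁ := 4) (T₂ := s * (n * 40 + 60) + 36) (Q₁ := fun τ =>
    τ.nvar vRem = s ∧ τ.nvar vOk = 1) (WP.block ?_) ?_ (by omega)
  · exact ⟨by simp [Cmd.run, Store.setN, NExp.eval, hs], by simp [Cmd.run, Store.setN, NExp.eval]⟩
  rintro σ₁ ⟨h1, h2⟩ s1
  have hs1 : σ₁.nvar 0 = s := (s1.nvar 0 rfl).trans hs
  have hn1 : σ₁.nvar 1 = n := (s1.nvar 1 rfl).trans hn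
  refine WP.seq (T₁ := s * (n * 40 + 60) + 8) (T₂ := 20) (WP.loopFin (N := s)
    (T := n * 40 + 50) (fun S τ => τ.nvar vOk ≠ 0 ↔ ∀ i ∈ S, ∃ j, A i j ≠ ⊥) hs1 rfl rfl
    (by decide) ?_ ?_ ?_ (le_of_eq (by ring))) ?_ (by omega)
  · intro S τ v h; simpa [Store.setN] using h
  · simp [h2]
  · rintro S i hi τ h hτ hsτ
    refine WP.seq (T₁ := 2) (T₂ := n * 40 + 48) (Q₁ := fun υ => υ = τ.setN vFlag 0)
      (WP.block rfl) ?_ (by omega)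
    rintro υ rfl sυ
    have hn' : (τ.setN vFlag 0).nvar 1 = n := by
      rw [sυ.nvar 1 rfl, hsτ.nvar 1 rfl, hn1]
    refine WP.seq (T₁ := n * 40 + 8) (T₂ := 20) (WP.loopFin (N := n) (T := 30)
      (fun S' ω => ω.nvar vFlag ≠ 0 ↔ ∃ j ∈ S', A i j ≠ ⊥) hn' rfl rfl (by decide) ?_ ?_ ?_
      (by omega)) ?_ (by omega)
    · intro S τ v h; simpa [Store.setN] using h
    · simp [Store.setN]
    · rintro S' j hj ω hω hωj hsω
      have e1 : ω.nvar vI = i := by rw [hsω.nvar vI rfl, sυ.nvar vI rfl, hτ]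
      have e2 : ω.narr aOrd i j = code (A i j) := by
        rw [hsω.narr aOrd rfl, sυ.narr aOrd rfl, hsτ.narr aOrd rfl, s1.narr aOrd rfl]
        exact hord i j
      refine WP.block ?_
      simp only [Cmd.run, Test.eval_pos, NExp.eval, e1, hωj, e2, ne_eq, code_eq_zero]
      split_ifs with h0
      · rw [← ne_eq, hω]; simp [h0]
      · simp [Store.setN, h0]
    · rintro ω hω hsω
      have e1 : ω.nvar vOk = τ.nvar vOk := by rw [hsω.nvar vOk rfl, sυ.nvar vOk rfl]
      simp only [Finset.mem_univ, true_and] at hω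
      refine WP.block ?_
      simp only [Cmd.run, Test.eval_pos, NExp.eval, hω]
      split_ifs with h0
      · rw [e1, h]
        simp [h0]
      · simp only [Store.setN, Function.update_self, ne_eq, not_true_eq_false, false_iff]
        exact fun h' => h0 (h' i (Finset.mem_insert_self _ _))
  · rintro τ h hsτ
    have e0 : τ.nvar 0 = s := (hsτ.nvar 0 rfl).trans hs1
    have e1 : τ.nvar 1 = n := (hsτ.nvar 1 rfl).trans hn1
    have e2 : τ.nvar vRem = s := (hsτ.nvar vRem rfl).trans h1
    refine WP.block ?_
    simp only [Cmd.run, Test.eval, NExp.eval, e0, e1]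
    split_ifs with h0
    · refine ⟨e2, h.trans ?_⟩
      simp [h0]
    · simp [Store.setN, e2, h0]

theorem ORegRun.one_le_p {R : Finset (Fin s)} {C : Finset (Fin n)} {out : Option (Finset (Fin n))}
    {st : Stats} (h : ORegRun A J R C out st) (hR : R.Nonempty) : 1 ≤ st.p := by
  cases h with
  | nil => simp at hR
  | reject => exact le_rfl
  | seqFailed => exact le_rfl
  | step => exact Nat.le_add_left _ _

/-- The program `oregProgram` computes a result of `Ō-reg`. -/
theorem wp_oregProgram (hs : 1 ≤ s) (hn : 1 ≤ n) :
    ∃ out st T, ORegRun A J Finset.univ Finset.univ out st ∧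
      WP oregProgram (inputStore A J) T (fun τ => outputOf n τ = out) ∧
      T ≤ 1000000 * (st.p * ((st.q * st.d ^ 2 + s) * n)) ∧
      (st.q ≤ 1 → T ≤ 1000000 * ((st.d ^ 2 + s) * n)) := by
  classical
  have hord : HoldsOrd A (inputStore A J) := by
    intro i j
    simp [inputStore, code]
  have hjac : HoldsJac J (inputStore A J) := by
    intro i j
    simp [inputStore]
  obtain ⟨σ₁, t₁, he₁, ht₁, a1, a2, a3, a4⟩ := wp_initArrays hord (by simp [inputStore])
    (by simp [inputStore]) (by simp [inputStore]) (by simp [inputStore])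
  have s1 := he₁.same
  have hord₁ : HoldsOrd A σ₁ := by intro i j; rw [s1.narr aOrd rfl]; exact hord i j
  have hs1 : σ₁.nvar 0 = s := by rw [s1.nvar 0 rfl]; simp [inputStore]
  have hn1 : σ₁.nvar 1 = n := by rw [s1.nvar 1 rfl]; simp [inputStore]
  obtain ⟨σ₂, t₂, he₂, ht₂, b1, b2⟩ := wp_initCheck hord₁ hs1 hn1
  have s2 := he₂.same
  have hsn1 : 1 ≤ s * n := Nat.mul_pos hs hn
  have h1 : n ≤ s * n := Nat.le_mul_of_pos_left _ hs
  have h2 : s ≤ s * n := Nat.le_mul_of_pos_right _ hn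
  have ht : t₁ + t₂ ≤ 400 * (s * n) := by
    have e1 : n * (s * 60 + 40) = s * n * 60 + n * 40 := by ring
    have e2 : s * (n * 40 + 60) = s * n * 40 + s * 60 := by ring
    omega
  have hne : (Finset.univ : Finset (Fin s)).Nonempty := ⟨⟨0, hs⟩, Finset.mem_univ _⟩
  by_cases hok : σ₂.nvar vOk = 0
  · have hrej : Fintype.card (Fin n) < Fintype.card (Fin s) ∨
        ∃ i ∈ (Finset.univ : Finset (Fin s)), ∀ j ∈ (Finset.univ : Finset (Fin n)), A i j = ⊥ := by
      by_contra hcon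
      push Not at hcon
      refine b2.2 ⟨by simpa using hcon.1, fun i => ?_⟩ hok
      obtain ⟨j, -, hj⟩ := hcon.2 i (Finset.mem_univ i)
      exact ⟨j, hj⟩
    refine ⟨_, _, t₁ + (t₂ + 12), .reject _ _ hne hrej, WP.seq_exec he₁ (WP.seq_exec he₂
      (WP.while_exit ?_ ?_ (by decide)) le_rfl) le_rfl, ?_, fun _ => ?_⟩
    · simp [Test.eval, NExp.eval, hok]
    · rw [outputOf, if_pos hok]
    · simp only [one_mul, zero_mul, zero_add]
      omega
    · simp only [ne_eq, OfNat.ofNat_ne_zero, not_false_eq_true, zero_pow, zero_add]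
      omega
  · have hcond := b2.1 hok
    have hmem : MainMem A J Finset.univ Finset.univ ∅ σ₂ := by
      refine ⟨⟨by simpa using b1, fun i => ?_, fun j => ?_, fun j => ?_⟩, ?_, ?_, ?_, ?_,
        fun j => ?_, fun j => ?_⟩
      · rw [s2.narr aR rfl]; simpa using a1 i
      · rw [s2.narr aLive rfl]; exact a3 j
      · rw [s2.narr aPos rfl]; exact a4 j
      · intro i j; rw [s2.narr aOrd rfl]; exact hord₁ i j
      · intro i j; rw [s2.farr 0 rfl, s1.farr 0 rfl]; exact hjac i j
      · rw [s2.nvar 0 rfl, hs1]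
      · rw [s2.nvar 1 rfl, hn1]
      · rw [s2.narr aC rfl]; simpa using a2 j
      · rw [s2.narr aOut rfl, s1.narr aOut rfl]; simp [inputStore]
    obtain ⟨out, st, T, hrun, hwp, hT, hT'⟩ := wp_mainLoop hcond.1 hmem hok
      (fun i _ => by simpa using hcond.2 i)
    refine ⟨out, st, t₁ + (t₂ + T), hrun, WP.seq_exec he₁ (WP.seq_exec he₂
      (hwp.mono le_rfl fun τ hτ => ?_) le_rfl) le_rfl, ?_, fun hq => ?_⟩
    · rw [hτ]
      simp
    · have hp := hrun.one_le_p hne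
      -- The initialization takes `O(s n)` operations, which the bound absorbs because `p ≥ 1`.
      have k : s * n ≤ st.p * ((st.q * st.d ^ 2 + s) * n) := by
        calc s * n ≤ (st.q * st.d ^ 2 + s) * n := by gcongr; omega
          _ ≤ _ := Nat.le_mul_of_pos_left _ hp
      omega
    · have := hT' hq
      simp only [Finset.card_univ, Fintype.card_fin] at this
      have e1 : (s + 1) * (n + 1) = s * n + s + n + 1 := by ring
      have e2 : (st.d ^ 2 + s) * n = st.d ^ 2 * n + s * n := by ring
      omega

end Program

/-! ### Independence of the choices and the two complexity bounds -/

section Complexity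

variable {F : Type} [Field F] {s n : ℕ} {A : Matrix (Fin s) (Fin n) (WithBot ℕ)}
  {J : Matrix (Fin s) (Fin n) F}

/-- The result of `Ō-reg` depends on the choice of the columns of nonvanishing minors, but its
success and the quantities attached to the execution do not. -/
theorem ORegRun.unique {R : Finset (Fin s)} {C : Finset (Fin n)}
    {out out' : Option (Finset (Fin n))} {st st' : Stats} (h : ORegRun A J R C out st)
    (h' : ORegRun A J R C out' st') : st = st' ∧ (out = none ↔ out' = none) := by
  induction h generalizing out' st' with
  | nil C =>
    cases h' with
    | nil => simp
    | reject _ _ hR => simp at hR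
    | seqFailed _ _ _ _ _ hR => simp at hR
    | step _ _ _ _ _ _ _ _ _ hR => simp at hR
  | reject R C hR hrej =>
    cases h' with
    | nil => simp at hR
    | reject => simp
    | seqFailed _ _ _ _ _ _ h => exact absurd hrej h
    | step _ _ _ _ _ _ _ _ _ _ h => exact absurd hrej h
  | seqFailed R C C₁ q c hR hrej hseq =>
    cases h' with
    | nil => simp at hR
    | reject _ _ _ h => exact absurd h hrej
    | seqFailed _ _ _ _ _ _ _ hseq' =>
      obtain ⟨-, -, rfl, rfl⟩ := hseq.unique hseq'
      simp
    | step _ _ _ _ _ _ _ _ _ _ _ hseq' hR₁ =>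
      obtain ⟨rfl, -⟩ := hseq.unique hseq'
      simp at hR₁
  | step R R₁ C C₁ Y₁ q c out st hR hrej hseq hR₁ hY₁ hcard hdet hrec ih =>
    cases h' with
    | nil => simp at hR
    | reject _ _ _ h => exact absurd h hrej
    | seqFailed _ _ _ _ _ _ _ hseq' =>
      obtain ⟨rfl, -⟩ := hseq.unique hseq'
      simp at hR₁
    | step _ _ _ _ _ _ _ _ _ _ _ hseq' _ _ _ _ hrec' =>
      obtain ⟨rfl, rfl, rfl, rfl⟩ := hseq.unique hseq'
      obtain ⟨rfl, h⟩ := ih hrec'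
      simp [h]

/-- The given run and the one followed by the program may choose different columns `Y₁`, but
`ORegRun.unique` identifies the attached quantities. -/
theorem oregProgram_implements : ImplementsORegWithin oregProgram (fun _ => True)
    (fun s n st => 1000000 * (st.p * (st.q * (st.d : ℝ) ^ 2 + s) * n)) := by
  intro K s n hs hn P η J _ _ out st hrun
  obtain ⟨out', st', T, hrun', ⟨τ, t, he, ht, hτ⟩, hT, -⟩ :=
    wp_oregProgram (A := orderMatrix P) (J := J) hs hn
  obtain ⟨rfl, -⟩ := hrun.unique hrun'
  refine ⟨τ, t, he, hτ ▸ hrun', fun _ => ?_⟩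
  have h : (t : ℝ) ≤ ((1000000 * (st.p * ((st.q * st.d ^ 2 + s) * n)) : ℕ) : ℝ) := by
    exact_mod_cast ht.trans hT
  refine h.trans (le_of_eq ?_)
  push_cast
  ring

/-- The program even achieves `O((d² + s) n)`. As `s ≥ 1`, the logarithm is at least `ln 2 ≥ 1/2`,
whence the factor 2. -/
theorem oregProgram_implements_log : ImplementsORegWithin oregProgram
    (fun st => st.q ≤ 1 ∧ st.c = 0)
    (fun s n st => 2000000 * (((st.d : ℝ) ^ 2 + s * Real.log (s + 1)) * n)) := by
  intro K s n hs hn P η J _ _ out st hrun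
  obtain ⟨out', st', T, hrun', ⟨τ, t, he, ht, hτ⟩, -, hT⟩ :=
    wp_oregProgram (A := orderMatrix P) (J := J) hs hn
  obtain ⟨rfl, -⟩ := hrun.unique hrun'
  refine ⟨τ, t, he, hτ ▸ hrun', fun hq => ?_⟩
  have h : (t : ℝ) ≤ ((1000000 * ((st.d ^ 2 + s) * n) : ℕ) : ℝ) := by
    exact_mod_cast ht.trans (hT hq.1)
  have hs' : (1 : ℝ) ≤ s := by exact_mod_cast hs
  have hlog : (1 : ℝ) / 2 ≤ Real.log (s + 1) := by
    have h1 : Real.log 2 ≤ Real.log (s + 1) := Real.log_le_log (by norm_num) (by linarith)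
    have h2 := Real.log_two_gt_d9
    linarith
  have h1 : (s : ℝ) ≤ 2 * (s * Real.log (s + 1)) := by nlinarith
  refine h.trans ?_
  push_cast
  have h2 : ((st.d : ℝ) ^ 2 + s) * n ≤ 2 * (((st.d : ℝ) ^ 2 + s * Real.log (s + 1)) * n) := by
    rw [← mul_assoc]
    gcongr
    nlinarith [sq_nonneg (st.d : ℝ)]
  linarith

end Complexity

/-! ### Correctness of the algorithm -/

section Correctness

variable {F : Type} [Field F] {s n : ℕ} {A : Matrix (Fin s) (Fin n) (WithBot ℕ)}
  {J M : Matrix (Fin s) (Fin n) F} {R R' L : Finset (Fin s)} {C Y Y' D : Finset (Fin n)}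

/-- The rows of the submatrix `(R, Y)` of `M` are linearly independent. -/
def RowIndep (M : Matrix (Fin s) (Fin n) F) (R : Finset (Fin s)) (Y : Finset (Fin n)) : Prop :=
  ∀ c : Fin s → F, (∀ j ∈ Y, ∑ i ∈ R, c i * M i j = 0) → ∀ i ∈ R, c i = 0

/-- Columns in which the chosen rows vanish impose no condition on a relation between these rows, so
they can be dropped. -/
theorem RowIndep.restrict (h : RowIndep M R Y) (hR : R' ⊆ R)
    (h0 : ∀ i ∈ R', ∀ j ∈ Y, j ∉ Y' → M i j = 0) : RowIndep M R' Y' := by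
  classical
  intro c hc i hi
  have := h (fun i => if i ∈ R' then c i else 0) (fun j hj => ?_) i (hR hi)
  · simpa [hi] using this
  · have e : ∑ i ∈ R, (if i ∈ R' then c i else 0) * M i j = ∑ i ∈ R', c i * M i j := by
      rw [← Finset.sum_subset hR]
      · exact Finset.sum_congr rfl fun i hi => by rw [if_pos hi]
      · intro i _ hi; rw [if_neg hi, zero_mul]
    rw [e]
    by_cases hj' : j ∈ Y'
    · exact hc j hj'
    · exact Finset.sum_eq_zero fun i hi => by rw [h0 i hi j hj hj', mul_zero]

theorem RowIndep.congr {M' : Matrix (Fin s) (Fin n) F} (h : RowIndep M R Y)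
    (e : ∀ i ∈ R, ∀ j ∈ Y, M' i j = M i j) : RowIndep M' R Y := by
  intro c hc
  refine h c fun j hj => ?_
  rw [← hc j hj]
  exact Finset.sum_congr rfl fun i hi => by rw [e i hi j hj]

theorem RowIndep.card_le (h : RowIndep M R Y) : R.card ≤ Y.card := by
  classical
  have hli : LinearIndependent F (fun (i : R) (j : Y) => M i j) := by
    rw [Fintype.linearIndependent_iff]
    intro g hg i
    have := h (fun k => if hk : k ∈ R then g ⟨k, hk⟩ else 0) (fun j hj => ?_) i i.2
    · simpa using this
    · have h1 := congrFun hg ⟨j, hj⟩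
      simp only [Finset.sum_apply, Pi.smul_apply, smul_eq_mul, Pi.zero_apply] at h1
      rw [← h1, ← Finset.sum_coe_sort R]
      exact Finset.sum_congr rfl fun i _ => by simp
  have := hli.fintype_card_le_finrank
  simpa using this

theorem RowIndep.exists_ne_zero (h : RowIndep M R Y) {i : Fin s} (hi : i ∈ R) :
    ∃ j ∈ Y, M i j ≠ 0 := by
  classical
  by_contra hcon
  push Not at hcon
  have := h (Pi.single i 1) (fun j hj => Finset.sum_eq_zero fun k _ => ?_) i hi
  · simp at this
  · by_cases hk : k = i
    · subst hk; rw [hcon j hj, mul_zero]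
    · simp [hk]

/-- The matrix is block triangular: the columns `Y₁` force a relation to vanish on `R₁`, and then
the columns `Y₂` force it to vanish on `R₂`. -/
theorem RowIndep.union {R₁ R₂ : Finset (Fin s)} {Y₁ Y₂ : Finset (Fin n)} [DecidableEq (Fin s)]
    [DecidableEq (Fin n)] (h₁ : RowIndep M R₁ Y₁) (h₂ : RowIndep M R₂ Y₂)
    (hR : Disjoint R₁ R₂) (h0 : ∀ i ∈ R₂, ∀ j ∈ Y₁, M i j = 0) :
    RowIndep M (R₁ ∪ R₂) (Y₁ ∪ Y₂) := by
  intro c hc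
  have hc₁ : ∀ i ∈ R₁, c i = 0 := by
    refine h₁ c fun j hj => ?_
    have := hc j (Finset.mem_union_left _ hj)
    rwa [Finset.sum_union hR, Finset.sum_eq_zero (s := R₂) fun i hi => by
      rw [h0 i hi j hj, mul_zero], add_zero] at this
  have hc₂ : ∀ i ∈ R₂, c i = 0 := by
    refine h₂ c fun j hj => ?_
    have := hc j (Finset.mem_union_right _ hj)
    rwa [Finset.sum_union hR, Finset.sum_eq_zero (s := R₁) fun i hi => by
      rw [hc₁ i hi, zero_mul], zero_add] at this
  intro i hi
  exact (Finset.mem_union.1 hi).elim (hc₁ i) (hc₂ i)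

/-- Independent rows that contain all the zeros of the columns in `D` are kept by `Seq`, as well as
these columns. -/
theorem SeqRun.subset_of_rowIndep (hJ : ∀ i j, A i j = ⊥ → J i j = 0) {R₁ : Finset (Fin s)}
    {C₁ : Finset (Fin n)} {q c : ℕ} (h : SeqRun A J R C R₁ C₁ q c)
    (hL : L ⊆ R) (hD : D ⊆ C) (hB : ∀ i ∈ R, ∀ j ∈ D, A i j = ⊥ ∨ A i j = 0 ∧ i ∈ L)
    (hind : RowIndep J L D) : L ⊆ R₁ ∧ D ⊆ C₁ := by
  classical
  have key : ∀ {R R₀ : Finset (Fin s)} {C C₀ : Finset (Fin n)}, IsHK A R C R₀ C₀ → L ⊆ R →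
      D ⊆ C → (∀ i ∈ R, ∀ j ∈ D, A i j = ⊥ ∨ A i j = 0 ∧ i ∈ L) →
      L ⊆ R₀ \ rowSupport J R₀ (C \ C₀) ∧ D ⊆ (C \ C₀) \ colSupport A J R₀ (C \ C₀) := by
    intro R R₀ C C₀ hHK hL hD hB
    obtain ⟨⟨hR₀, hC₀, hcov, hcard⟩, hmax⟩ := hHK
    -- The zeros of the columns in `D` lie in `L`, so these columns can be exchanged for the rows
    -- `L`.
    have hcov' : Covers A R C (R₀ ∪ L) (C₀ \ D) := by
      intro i hi j hj h0
      by_cases hjD : j ∈ D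
      · rcases hB i hi j hjD with h | ⟨-, h⟩
        · rw [h] at h0; simp at h0
        · exact Or.inl (Finset.mem_union_right _ h)
      · rcases hcov i hi j hj h0 with h | h
        · exact Or.inl (Finset.mem_union_left _ h)
        · exact Or.inr (Finset.mem_sdiff.2 ⟨h, hjD⟩)
    -- A row of `L` outside `R₀` can have zeros of `A` in `D` only in the columns of `C₀`, so `J`
    -- vanishes elsewhere on `D`; independence then bounds the number of these rows. The exchange
    -- does not enlarge the cover, and the extremality of `(R₀, C₀)` applies to it.
    have hle : (L \ R₀).card ≤ (C₀ ∩ D).card := by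
      refine RowIndep.card_le (M := J) (hind.restrict Finset.sdiff_subset fun i hi j hj hj' => ?_)
      obtain ⟨hi, hi'⟩ := Finset.mem_sdiff.1 hi
      refine hJ i j ((hB i (hL hi) j hj).resolve_right fun h0 => ?_)
      rcases hcov i (hL hi) j (hD hj) h0.1 with h | h
      · exact hi' h
      · exact hj' (Finset.mem_inter.2 ⟨h, hj⟩)
    have h1 := transversalNumber_le hcov'
    have h2 : (R₀ ∪ L).card = R₀.card + (L \ R₀).card := by
      rw [← Finset.union_sdiff_self_eq_union, Finset.card_union_of_disjoint Finset.disjoint_sdiff]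
    have h3 := Finset.card_sdiff_add_card_inter C₀ D
    obtain ⟨m1, m2⟩ := hmax (R₀ ∪ L) (C₀ \ D) ⟨Finset.union_subset hR₀ hL,
      Finset.sdiff_subset.trans hC₀, hcov', by omega⟩
    have hLR : L ⊆ R₀ := Finset.subset_union_right.trans m1
    have hDC : ∀ j ∈ D, j ∉ C₀ := fun j hj hj' => (Finset.mem_sdiff.1 (m2 hj')).2 hj
    -- In the columns `D` the matrix `J` is zero outside the rows `L`, so a linear relation induces
    -- one between the independent rows `L` and vanishes on them.
    have hsupp : ∀ i ∈ L, i ∉ rowSupport J R₀ (C \ C₀) := by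
      intro i hi hs
      obtain ⟨-, c, ⟨-, hc⟩, hci⟩ := Finset.mem_filter.1 hs
      refine hci (hind c (fun j hj => ?_) i hi)
      rw [← hc j (Finset.mem_sdiff.2 ⟨hD hj, hDC j hj⟩)]
      refine Finset.sum_subset hLR fun k hk hk' => ?_
      rw [hJ k j ((hB k (hR₀ hk) j hj).resolve_right fun h => hk' h.2), mul_zero]
    refine ⟨fun i hi => Finset.mem_sdiff.2 ⟨hLR hi, hsupp i hi⟩, fun j hj =>
      Finset.mem_sdiff.2 ⟨Finset.mem_sdiff.2 ⟨hD hj, hDC j hj⟩, fun hs => ?_⟩⟩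
    obtain ⟨-, i, hi, h0⟩ := Finset.mem_filter.1 hs
    rcases hB i (hR₀ (rowSupport_subset J _ _ hi)) j hj with h | ⟨-, h⟩
    · rw [h] at h0; simp at h0
    · exact hsupp i h hi
  induction h with
  | done R R₀ C C₀ hHK hR hC => exact ⟨hL, hD⟩
  | next R R₀ R₁ C C₀ C₁ q c hHK hne hrec ih =>
    obtain ⟨k1, k2⟩ := key hHK hL hD hB
    exact ih k1 k2 fun i hi => hB i (hHK.1.1 (Finset.mem_sdiff.1 hi).1)

open Classical in
/-- The entries of `J` whose row and column have the same potential. -/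
def tightPart (J : Matrix (Fin s) (Fin n) F) (l : Fin s → ℕ) (m : Fin n → ℕ) :
    Matrix (Fin s) (Fin n) F := fun i j => if l i = m j then J i j else 0

open Classical in
/-- The entries of `J` at the zeros of `A`. -/
def zeroPart (A : Matrix (Fin s) (Fin n) (WithBot ℕ)) (J : Matrix (Fin s) (Fin n) F) :
    Matrix (Fin s) (Fin n) F := fun i j => if A i j = 0 then J i j else 0

theorem eq_bot_or_zero_of_add_le {a : WithBot ℕ} {l m : ℕ} (h : a + (l : WithBot ℕ) ≤ m)
    (hml : m ≤ l) : a = ⊥ ∨ a = 0 ∧ l = m := by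
  induction a using WithBot.recBotCoe with
  | bot => exact Or.inl rfl
  | coe a =>
    right
    have : a + l ≤ m := WithBot.coe_le_coe.1 h
    constructor
    · have : a = 0 := by omega
      rw [this]; rfl
    · omega

/-- `Ō-reg` succeeds if there are potentials such that the tight part of `J` has independent rows. -/
theorem ORegRun.ne_none (hJ : ∀ i j, A i j = ⊥ → J i j = 0) {out : Option (Finset (Fin n))}
    {st : Stats} (h : ORegRun A J R C out st) {l : Fin s → ℕ} {m : Fin n → ℕ} (hY : Y ⊆ C)
    (hlm : ∀ i ∈ R, ∀ j ∈ Y, A i j + (l i : WithBot ℕ) ≤ m j)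
    (hind : RowIndep (tightPart J l m) R Y) : out ≠ none := by
  classical
  have hsurv : ∀ {R R₁ : Finset (Fin s)} {C C₁ Y : Finset (Fin n)} {q c : ℕ}, R.Nonempty →
      SeqRun A J (bRows A R C) (bCols A R C) R₁ C₁ q c → Y ⊆ C →
      (∀ i ∈ R, ∀ j ∈ Y, A i j + (l i : WithBot ℕ) ≤ m j) →
      RowIndep (tightPart J l m) R Y → R₁.Nonempty := by
    intro R R₁ C C₁ Y q c hR hseq hY hlm hind
    obtain ⟨i₀, hi₀, hmin⟩ := R.exists_min_image l hR
    -- At the least potential the inequality `A i j + l i ≤ m j` forces the columns `D` to contain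
    -- only `0` and `-∞`, with zeros only in the rows `L`, where the tight part coincides with `J`.
    set L := R.filter fun i => l i = l i₀ with hLdef
    set D := (liveCols A R Y).filter fun j => m j = l i₀ with hDdef
    have hLR : L ⊆ R := Finset.filter_subset _ _
    have hDY : D ⊆ Y := (Finset.filter_subset _ _).trans (liveCols_subset A R Y)
    have hent : ∀ i ∈ R, ∀ j ∈ D, A i j = ⊥ ∨ A i j = 0 ∧ i ∈ L := by
      intro i hi j hj
      have hm := (Finset.mem_filter.1 hj).2
      rcases eq_bot_or_zero_of_add_le (hlm i hi j (hDY hj)) (hm ▸ hmin i hi) with h | ⟨h, h'⟩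
      · exact Or.inl h
      · exact Or.inr ⟨h, Finset.mem_filter.2 ⟨hi, h'.trans hm⟩⟩
    have hindL : RowIndep J L D := by
      refine RowIndep.congr (M := tightPart J l m) (hind.restrict hLR ?_) ?_
      · intro i hi j hj hjD
        unfold tightPart
        split_ifs with h
        · refine hJ i j (by_contra fun hb => hjD (Finset.mem_filter.2 ⟨Finset.mem_filter.2
            ⟨hj, i, hLR hi, hb⟩, ?_⟩))
          rw [← h, (Finset.mem_filter.1 hi).2]
        · rfl
      · intro i hi j hj
        unfold tightPart
        rw [if_pos]
        rw [(Finset.mem_filter.1 hi).2, (Finset.mem_filter.1 hj).2]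
    have hDb : D ⊆ bCols A R C := by
      intro j hj
      have h1 := Finset.mem_filter.1 (Finset.mem_filter.1 hj).1
      refine Finset.mem_filter.2 ⟨Finset.mem_filter.2 ⟨hY h1.1, h1.2⟩, fun i hi => ?_⟩
      exact (hent i hi j hj).imp_right fun h => h.1
    have hLb : L ⊆ bRows A R C := by
      intro i hi
      obtain ⟨j, hj, hij⟩ := hindL.exists_ne_zero hi
      refine Finset.mem_filter.2 ⟨hLR hi, j, hDb hj, ?_⟩
      exact ((hent i (hLR hi) j hj).resolve_left fun h => hij (hJ i j h)).1
    have := (hseq.subset_of_rowIndep hJ hLb hDb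
      (fun i hi => hent i (bRows_subset A R C hi)) hindL).1
    exact ⟨i₀, this (Finset.mem_filter.2 ⟨hi₀, rfl⟩)⟩
  induction h generalizing Y with
  | nil C => simp
  | reject R C hR h =>
    exfalso
    rcases h with h | ⟨i, hi, h⟩
    · have h1 := hind.card_le
      have h2 := Finset.card_le_card hY
      omega
    · obtain ⟨j, hj, hij⟩ := hind.exists_ne_zero hi
      refine hij ?_
      unfold tightPart
      split_ifs
      · exact hJ i j (h j (hY hj))
      · rfl
  | seqFailed R C C₁ q c hR h hseq =>
    simpa using hsurv hR hseq hY hlm hind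
  | step R R₁ C C₁ Y₁ q c out st hR h hseq hR₁ hY₁ hcard hdet hrec ih =>
    -- The columns of `Y` that are lost consist of `-∞` in the remaining rows, so `J` vanishes there
    -- and the remaining rows stay independent.
    have hle : (Y ∩ liveCols A R C) \ C₁ ⊆ Y := Finset.sdiff_subset.trans Finset.inter_subset_left
    have := ih (Y := (Y ∩ liveCols A R C) \ C₁)
      (Finset.sdiff_subset_sdiff Finset.inter_subset_right subset_rfl)
      (fun i hi j hj => hlm i (Finset.mem_sdiff.1 hi).1 j (hle hj))
      (hind.restrict Finset.sdiff_subset fun i hi j hj hj' => ?_)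
    · simpa using this
    · unfold tightPart
      split_ifs
      · refine hJ i j ?_
        by_cases hjC : j ∈ C₁
        · exact eq_bot_of_mem_sdiff hseq hi hjC
        · by_contra hb
          refine hj' (Finset.mem_sdiff.2 ⟨Finset.mem_inter.2 ⟨hj, Finset.mem_filter.2
            ⟨hY hj, i, (Finset.mem_sdiff.1 hi).1, hb⟩⟩, hjC⟩)
      · rfl

/-- A result of `Ō-reg` comes with potentials, and its zero part has independent rows. -/
theorem ORegRun.exists_potential (hJ : ∀ i j, A i j = ⊥ → J i j = 0)
    {out : Option (Finset (Fin n))} {st : Stats} (h : ORegRun A J R C out st) (hY : out = some Y) :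
    Y ⊆ C ∧ Y.card = R.card ∧ RowIndep (zeroPart A J) R Y ∧
      ∃ (l : Fin s → ℕ) (m : Fin n → ℕ),
        (∀ i ∈ R, ∀ j ∈ Y, A i j + (l i : WithBot ℕ) ≤ m j) ∧ ∑ j ∈ Y, m j = ∑ i ∈ R, l i := by
  classical
  induction h generalizing Y with
  | nil C =>
    obtain rfl : ∅ = Y := by simpa using hY
    refine ⟨by simp, rfl, fun c _ i hi => by simp at hi, fun _ => 0, fun _ => 0, ?_, by simp⟩
    intro i hi; simp at hi
  | reject R C hR h => simp at hY
  | seqFailed R C C₁ q c hR h hseq => simp at hY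
  | step R R₁ C C₁ Y₁ q c out st hR h hseq hR₁ hY₁ hcard hdet hrec ih =>
    obtain ⟨Y₂, rfl, rfl⟩ := Option.map_eq_some_iff.1 hY
    obtain ⟨i1, i2, i3, l, m, i4, i5⟩ := ih rfl
    have hRR : R₁ ⊆ R := hseq.subset.1.trans (bRows_subset A R C)
    have hYb : Y₁ ⊆ bCols A R C := hY₁.trans hseq.subset.2
    have hdisj : Disjoint Y₁ Y₂ :=
      (Finset.disjoint_sdiff (s := C₁) (t := liveCols A R C)).mono hY₁ i1
    have hent : ∀ i ∈ R, ∀ j ∈ Y₁, A i j = ⊥ ∨ A i j = 0 :=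
      fun i hi j hj => eq_bot_or_zero_of_mem_bCols hi (hYb hj)
    have hbot : ∀ i ∈ R \ R₁, ∀ j ∈ Y₁, A i j = ⊥ :=
      fun i hi j hj => eq_bot_of_mem_sdiff hseq hi (hY₁ hj)
    have hRu : R₁ ∪ (R \ R₁) = R := Finset.union_sdiff_of_subset hRR
    refine ⟨?_, ?_, ?_, ?_⟩
    · exact Finset.union_subset ((hYb.trans (bCols_subset_liveCols A R C)).trans
        (liveCols_subset A R C)) (i1.trans (Finset.sdiff_subset.trans (liveCols_subset A R C)))
    · rw [Finset.card_union_of_disjoint hdisj, i2, hcard, Finset.card_sdiff_of_subset hRR]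
      have := Finset.card_le_card hRR
      omega
    · rw [← hRu]
      refine RowIndep.union (RowIndep.congr (M := J) ((det_orderEmb_ne_zero_iff hcard).1 hdet) ?_)
        i3 Finset.disjoint_sdiff ?_
      · intro i hi j hj
        unfold zeroPart
        split_ifs with h0
        · rfl
        · exact (hJ i j ((hent i (hRR hi) j hj).resolve_right h0)).symm
      · intro i hi j hj
        simp [zeroPart, hbot i hi j hj]
    -- The new block gets potential 0 and the later ones are raised by a bound `B` of all entries,
    -- which takes care of the entries in a row of `R₁` and a later column. The sums remain equal
    -- because the later block has as many columns as rows.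
    · obtain ⟨B, hB⟩ : ∃ B : ℕ, ∀ i j, A i j ≤ B := by
        refine ⟨Finset.univ.sup fun i => Finset.univ.sup fun j => (A i j).unbotD 0, fun i j => ?_⟩
        have h1 : (A i j).unbotD 0 ≤ Finset.univ.sup fun i => Finset.univ.sup fun j =>
            (A i j).unbotD 0 :=
          (Finset.le_sup (f := fun j => (A i j).unbotD 0) (Finset.mem_univ j)).trans
            (Finset.le_sup (f := fun i => Finset.univ.sup fun j => (A i j).unbotD 0)
              (Finset.mem_univ i))
        generalize A i j = a at h1
        induction a using WithBot.recBotCoe with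
        | bot => exact bot_le
        | coe a => exact WithBot.coe_le_coe.2 h1
      refine ⟨fun i => if i ∈ R₁ then 0 else l i + B, fun j => if j ∈ Y₁ then 0 else m j + B,
        fun i hi j hj => ?_, ?_⟩
      · by_cases hi₁ : i ∈ R₁
        · by_cases hj₁ : j ∈ Y₁
          · rcases hent i hi j hj₁ with h | h <;> simp [h, hi₁, hj₁]
          · simp only [hi₁, hj₁, if_true, if_false, Nat.cast_zero, add_zero]
            refine (hB i j).trans ?_
            exact_mod_cast Nat.le_add_left _ _
        · have hi' : i ∈ R \ R₁ := Finset.mem_sdiff.2 ⟨hi, hi₁⟩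
          by_cases hj₁ : j ∈ Y₁
          · simp [hbot i hi' j hj₁]
          · have := i4 i hi' j ((Finset.mem_union.1 hj).resolve_left hj₁)
            simp only [hi₁, hj₁, if_false, Nat.cast_add]
            rw [← add_assoc]
            gcongr
      · rw [Finset.sum_union hdisj]
        conv_rhs => rw [← hRu, Finset.sum_union Finset.disjoint_sdiff]
        have e1 : ∑ j ∈ Y₁, (if j ∈ Y₁ then 0 else m j + B) = 0 :=
          Finset.sum_eq_zero fun j hj => if_pos hj
        have e2 : ∑ i ∈ R₁, (if i ∈ R₁ then 0 else l i + B) = 0 :=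
          Finset.sum_eq_zero fun i hi => if_pos hi
        have e3 : ∑ j ∈ Y₂, (if j ∈ Y₁ then 0 else m j + B) = ∑ j ∈ Y₂, m j + Y₂.card * B := by
          rw [Finset.sum_congr rfl fun j hj => if_neg (Finset.disjoint_right.1 hdisj hj),
            Finset.sum_add_distrib, Finset.sum_const, smul_eq_mul]
        have e4 : ∑ i ∈ R \ R₁, (if i ∈ R₁ then 0 else l i + B) =
            ∑ i ∈ R \ R₁, l i + (R \ R₁).card * B := by
          rw [Finset.sum_congr rfl fun i hi => if_neg (Finset.mem_sdiff.1 hi).2,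
            Finset.sum_add_distrib, Finset.sum_const, smul_eq_mul]
        rw [e1, e2, e3, e4, i2, i5]

end Correctness

/-! ### The truncated determinant of a system with Jacobi number zero -/

section Square

variable {s : ℕ} {B : Matrix (Fin s) (Fin s) (WithBot ℕ)} {l : Fin s → ℕ}

theorem forall_eq_zero_of_sum_nonpos {f : Fin s → WithBot ℕ} (hb : ∀ i, f i ≠ ⊥)
    (h : ∑ i, f i ≤ 0) (i : Fin s) : f i = 0 := by
  choose g hg using fun i => WithBot.ne_bot_iff_exists.1 (hb i)
  have h1 : ∑ i, f i = ((∑ i, g i : ℕ) : WithBot ℕ) := by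
    push_cast
    exact Finset.sum_congr rfl fun i _ => (hg i).symm
  have h2 : ∑ i, g i ≤ 0 := by
    rw [h1] at h
    exact WithBot.coe_le_coe.1 h
  have h3 := Finset.single_le_sum (f := g) (fun i _ => Nat.zero_le _) (Finset.mem_univ i)
  have h4 : g i = 0 := by omega
  rw [← hg i, h4]
  rfl

theorem exists_zero_of_jacobiNumber (h : jacobiNumber B = 0) :
    ∃ σ : Fin s ≃ Fin s, ∀ i, B i (σ i) = 0 := by
  obtain ⟨σ, -, hσ⟩ := Finset.exists_mem_eq_sup (Finset.univ : Finset (Fin s ↪ Fin s))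
    ⟨Function.Embedding.refl _, Finset.mem_univ _⟩ fun σ => ∑ i, B i (σ i)
  have h0 : ∑ i, B i (σ i) = 0 := hσ.symm.trans h
  refine ⟨Equiv.ofBijective σ (Finite.injective_iff_bijective.1 σ.injective),
    forall_eq_zero_of_sum_nonpos (fun i hi => ?_) h0.le⟩
  have : ∑ i, B i (σ i) = ⊥ := WithBot.sum_eq_bot_iff.2 ⟨i, Finset.mem_univ i, hi⟩
  rw [h0] at this
  simp at this

/-- Any transversal of zeros can replace that of the canon. Each entry of the latter is finite,
since its column contains a zero of `σ`, and their sum is at most 0, so they are zeros too. The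
permutation `e` that compares the two transversals satisfies `l i ≤ l (e i)`; summing over `i` turns
these inequalities into equalities. -/
theorem isCanon_iff (h : jacobiNumber B = 0) {σ : Fin s ≃ Fin s} (hσ : ∀ i, B i (σ i) = 0) :
    IsCanon B l ↔ ∀ i i', B i' (σ i) + (l i' : WithBot ℕ) ≤ l i := by
  constructor
  · rintro ⟨τ, hτ⟩
    have hb : ∀ i, B i (τ i) ≠ ⊥ := by
      intro i hi
      have := hτ i (σ.symm (τ i))
      have h0 := hσ (σ.symm (τ i))
      rw [Equiv.apply_symm_apply] at h0
      rw [hi, h0, WithBot.bot_add, zero_add] at this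
      simp at this
    have h0 := forall_eq_zero_of_sum_nonpos hb
      (h ▸ Finset.le_sup (f := fun σ : Fin s ↪ Fin s => ∑ i, B i (σ i)) (Finset.mem_univ τ))
    let e : Fin s ≃ Fin s :=
      σ.trans (Equiv.ofBijective τ (Finite.injective_iff_bijective.1 τ.injective)).symm
    have he : ∀ i, τ (e i) = σ i := fun i => Equiv.ofBijective_apply_symm_apply τ
      (Finite.injective_iff_bijective.1 τ.injective) (σ i)
    have hle : ∀ i i', B i' (σ i) + (l i' : WithBot ℕ) ≤ l (e i) := by
      intro i i'
      have := hτ (e i) i'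
      rwa [h0, zero_add, he] at this
    have hl : ∀ i ∈ Finset.univ, l i ≤ l (e i) := by
      intro i _
      have := hle i i
      rw [hσ, zero_add] at this
      exact WithBot.coe_le_coe.1 this
    have heq := (Finset.sum_eq_sum_iff_of_le hl).1 (Equiv.sum_comp e l).symm
    intro i i'
    rw [heq i (Finset.mem_univ i)]
    exact hle i i'
  · intro hl
    refine ⟨σ.toEmbedding, fun i i' => ?_⟩
    simpa [hσ i] using hl i i'

/-- By `isCanon_iff` the canons are the solutions of inequalities between pairs of coordinates, a
system which is stable under coordinatewise minima. -/
theorem exists_isMinimalCanon (h : jacobiNumber B = 0) {σ : Fin s ≃ Fin s}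
    (hσ : ∀ i, B i (σ i) = 0) (hl : IsCanon B l) : ∃ l', IsMinimalCanon B l' := by
  classical
  have hmin : ∀ i, ∃ k : Fin s → ℕ, IsCanon B k ∧ ∀ k', IsCanon B k' → k i ≤ k' i := by
    intro i
    have hex : ∃ v, ∃ k : Fin s → ℕ, IsCanon B k ∧ k i = v := ⟨l i, l, hl, rfl⟩
    obtain ⟨k, hk, hki⟩ := Nat.find_spec hex
    exact ⟨k, hk, fun k' hk' => hki ▸ Nat.find_min' hex ⟨k', hk', rfl⟩⟩
  choose k hk hk' using hmin
  refine ⟨fun i => k i i, (isCanon_iff h hσ).2 fun i i' => ?_, fun l' hl' i => hk' i l' hl'⟩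
  refine le_trans ?_ ((isCanon_iff h hσ).1 (hk i) i i')
  gcongr
  exact hk' i' _ (hk i)

/-- The maximum that defines `β` is attained at the zero in place `(i, σ i)`. The order `α + β` of
row `i'` and column `σ i` is therefore `l i - l i'`. -/
theorem coverCol_eq {σ : Fin s ≃ Fin s} (hσ : ∀ i, B i (σ i) = 0)
    (hl : ∀ i i', B i' (σ i) + (l i' : WithBot ℕ) ≤ l i) (i : Fin s) :
    coverCol B l (σ i) = (((l i : ℤ) - (Finset.univ.sup l : ℕ) : ℤ) : WithBot ℤ) := by
  have hr : ∀ i, (coverRow l i : ℤ) = (Finset.univ.sup l : ℕ) - l i := by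
    intro i
    have := Finset.le_sup (f := l) (Finset.mem_univ i)
    unfold coverRow
    omega
  refine le_antisymm (Finset.sup_le fun i' _ => ?_) ?_
  · have := hl i i'
    generalize B i' (σ i) = b at this
    induction b using WithBot.recBotCoe with
    | bot => exact bot_le
    | coe b =>
      have hb : b + l i' ≤ l i := WithBot.coe_le_coe.1 this
      refine WithBot.coe_le_coe.2 ?_
      simp only [hr]
      omega
  · refine le_trans ?_ (Finset.le_sup (Finset.mem_univ i))
    rw [hσ i]
    refine WithBot.coe_le_coe.2 ?_
    rw [hr]
    push_cast
    omega

/-- Two matrices that are zero above the potentials and agree where these are equal have the same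
determinant. -/
theorem det_eq_of_potential {F : Type} [CommRing F] {M M' : Matrix (Fin s) (Fin s) F}
    {m : Fin s → ℕ} (hsum : ∑ i, l i = ∑ k, m k)
    (h0 : ∀ i k, m k < l i → M i k = 0 ∧ M' i k = 0) (h1 : ∀ i k, m k = l i → M i k = M' i k) :
    M.det = M'.det := by
  rw [← M.det_transpose, ← M'.det_transpose, Matrix.det_apply, Matrix.det_apply]
  refine Finset.sum_congr rfl fun τ _ => ?_
  congr 1
  simp only [Matrix.transpose_apply]
  -- As the sums agree, such a permutation meets equal potentials only, where the matrices coincide;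
  -- any other one meets a zero of both.
  by_cases hτ : ∀ i, l i ≤ m (τ i)
  · have heq := (Finset.sum_eq_sum_iff_of_le fun i _ => hτ i).1
      (hsum.trans (Equiv.sum_comp τ m).symm)
    exact Finset.prod_congr rfl fun i _ => h1 i _ (heq i (Finset.mem_univ i)).symm
  · push Not at hτ
    obtain ⟨i, hi⟩ := hτ
    rw [Finset.prod_eq_zero (Finset.mem_univ i) (h0 i _ hi).1,
      Finset.prod_eq_zero (Finset.mem_univ i) (h0 i _ hi).2]

end Square

/-! ### From potentials to the regularity of the system -/

section System

variable {s n : ℕ} {A : Matrix (Fin s) (Fin n) (WithBot ℕ)} {Y : Finset (Fin n)}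

theorem sum_orderEmbOfFin {α : Type*} [AddCommMonoid α] (hY : Y.card = s) (f : Fin n → α) :
    ∑ k, f (Y.orderEmbOfFin hY k) = ∑ j ∈ Y, f j := by
  have := Finset.sum_map Finset.univ (Y.orderEmbOfFin hY).toEmbedding f
  rw [Finset.map_orderEmbOfFin_univ] at this
  exact this.symm

theorem exists_orderEmbOfFin (hY : Y.card = s) {j : Fin n} (hj : j ∈ Y) :
    ∃ k, Y.orderEmbOfFin hY k = j := by
  have : j ∈ Set.range (Y.orderEmbOfFin hY) := by rwa [Finset.range_orderEmbOfFin]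
  exact this

theorem det_colsIn_ne_zero_iff {F : Type} [Field F] {M : Matrix (Fin s) (Fin n) F}
    (hY : Y.card = s) : (colsIn M Y hY).det ≠ 0 ↔ RowIndep M Finset.univ Y := by
  rw [Ne, ← Matrix.exists_vecMul_eq_zero_iff]
  constructor
  · intro h c hc i _
    by_contra hi
    refine h ⟨c, fun h0 => hi (congrFun h0 i), funext fun k => ?_⟩
    exact hc _ (Finset.orderEmbOfFin_mem _ _ _)
  · rintro h ⟨v, hv, hv0⟩
    refine hv (funext fun i => h v (fun j hj => ?_) i (Finset.mem_univ i))
    obtain ⟨k, rfl⟩ := exists_orderEmbOfFin hY hj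
    exact congrFun hv0 k

/-- Weak duality: the inequalities are added along a transversal, and the potentials cancel. -/
theorem jacobiNumberOn_eq_zero (hY : Y.card = s) {l : Fin s → ℕ} {m : Fin n → ℕ}
    (hlm : ∀ i, ∀ j ∈ Y, A i j + (l i : WithBot ℕ) ≤ m j) (hsum : ∑ j ∈ Y, m j = ∑ i, l i)
    {σ : Fin s ≃ Fin s} (hσ : ∀ i, colsIn A Y hY i (σ i) = 0) : jacobiNumberOn A Y hY = 0 := by
  refine le_antisymm (Finset.sup_le fun τ _ => ?_) ?_
  · have h1 : ∑ i, colsIn A Y hY i (τ i) + ((∑ i, l i : ℕ) : WithBot ℕ) ≤ (∑ i, l i : ℕ) := by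
      have e1 : ∑ i, m (Y.orderEmbOfFin hY (τ i)) = ∑ i, l i := by
        rw [← hsum, ← sum_orderEmbOfFin hY m]
        exact Equiv.sum_comp (Equiv.ofBijective τ (Finite.injective_iff_bijective.1 τ.injective))
          fun k => m (Y.orderEmbOfFin hY k)
      conv_rhs => rw [← e1]
      push_cast
      rw [← Finset.sum_add_distrib]
      exact Finset.sum_le_sum fun i _ => hlm i _ (Finset.orderEmbOfFin_mem _ _ _)
    rcases eq_bot_or_zero_of_add_le h1 le_rfl with h | h
    · rw [h]; exact bot_le
    · exact h.1.le
  · refine le_trans ?_ (Finset.le_sup (Finset.mem_univ σ.toEmbedding))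
    exact (Finset.sum_eq_zero fun i _ => hσ i).ge

/-- A nonzero term of the expansion of the determinant uses only zeros of `A`. -/
theorem exists_zero_of_det_ne_zero {F : Type} [Field F] {J : Matrix (Fin s) (Fin n) F}
    (hY : Y.card = s) (h : (colsIn (zeroPart A J) Y hY).det ≠ 0) :
    ∃ σ : Fin s ≃ Fin s, ∀ i, colsIn A Y hY i (σ i) = 0 := by
  rw [← Matrix.det_transpose, Matrix.det_apply] at h
  obtain ⟨σ, -, hσ⟩ := Finset.exists_ne_zero_of_sum_ne_zero h
  refine ⟨σ, fun i => by_contra fun h0 => hσ ?_⟩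
  rw [Finset.prod_eq_zero (Finset.mem_univ i), smul_zero]
  exact if_neg h0

variable {P : Fin s → DiffFun n} {η : Jet n} {K : Subfield ℝ} {J : Matrix (Fin s) (Fin n) K}

/-- The point `η` lies in the domain of the equation, so a nonzero derivative there would make the
order at least 0. -/
theorem IsJacobianAt.eq_zero (hJ : IsJacobianAt K P η J) (hP : ∀ i, (P i).DefinedAt η) (i : Fin s)
    (j : Fin n) (h : orderMatrix P i j = ⊥) : J i j = 0 := by
  classical
  have h1 : (P i).pderiv η j 0 = 0 := by
    by_contra hne
    have h2 : (0 : ℕ) ∈ (Finset.range ((P i).r + 1)).filter fun k =>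
        ∃ z ∈ (P i).dom, (P i).pderivFin j k z ≠ 0 :=
      Finset.mem_filter.2 ⟨by simp, _, hP i, hne⟩
    rw [orderMatrix, DiffFun.ord, Finset.max_eq_bot] at h
    rw [h] at h2
    simp at h2
  exact Subtype.ext ((hJ i j).trans h1)

/-- The entry `(i, k)` is a derivative of order `l (σ.symm k) - l i`. Negative orders give 0; for
order 0 the entry of `A` is `0` or `-∞`, so both matrices contain the Jacobian entry; positive
orders do not matter by `det_eq_of_potential`. -/
theorem truncDet_eq (hJ : IsJacobianAt K P η J) (hP : ∀ i, (P i).DefinedAt η) (hY : Y.card = s)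
    {l : Fin s → ℕ} {σ : Fin s ≃ Fin s} (hσ : ∀ i, colsIn (orderMatrix P) Y hY i (σ i) = 0)
    (hl : ∀ i i', colsIn (orderMatrix P) Y hY i' (σ i) + (l i' : WithBot ℕ) ≤ l i) :
    truncDet P η Y hY l = ((colsIn (zeroPart (orderMatrix P) J) Y hY).det : ℝ) := by
  have hmap : ((colsIn (zeroPart (orderMatrix P) J) Y hY).det : ℝ) =
      ((colsIn (zeroPart (orderMatrix P) J) Y hY).map K.subtype).det :=
    RingHom.map_det K.subtype _
  rw [hmap]
  have hexp : ∀ i' k, ((coverRow l i' : ℤ) : WithBot ℤ) +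
      coverCol (colsIn (orderMatrix P) Y hY) l k =
      (((l (σ.symm k) : ℤ) - l i' : ℤ) : WithBot ℤ) := by
    intro i' k
    have h1 := coverCol_eq hσ hl (σ.symm k)
    rw [Equiv.apply_symm_apply] at h1
    rw [h1, ← WithBot.coe_add]
    have := Finset.le_sup (f := l) (Finset.mem_univ i')
    congr 1
    unfold coverRow
    omega
  have hle : ∀ i k, colsIn (orderMatrix P) Y hY i k + (l i : WithBot ℕ) ≤ l (σ.symm k) := by
    intro i k
    have := hl (σ.symm k) i
    rwa [Equiv.apply_symm_apply] at this
  have hpd : ∀ (i : Fin s) (j : Fin n) (z : ℤ), (P i).pderivInt η j (z : WithBot ℤ) =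
      if 0 ≤ z then (P i).pderiv η j z.toNat else 0 := fun i j z => rfl
  refine det_eq_of_potential (l := l) (m := fun k => l (σ.symm k))
    (Equiv.sum_comp σ.symm l).symm (fun i k hik => ⟨?_, ?_⟩) fun i k hik => ?_
  · rw [Matrix.of_apply, hexp, hpd, if_neg (by omega)]
  · have : zeroPart (orderMatrix P) J i (Y.orderEmbOfFin hY k) = 0 := by
      refine if_neg fun h0 => ?_
      have h1 := hle i k
      have h2 : colsIn (orderMatrix P) Y hY i k = 0 := h0
      rw [h2, zero_add] at h1
      exact absurd (WithBot.coe_le_coe.1 h1) (not_le.2 hik)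
    simp [colsIn, this]
  · have h1 : (P i).pderiv η (Y.orderEmbOfFin hY k) 0 =
        ((zeroPart (orderMatrix P) J i (Y.orderEmbOfFin hY k) : K) : ℝ) := by
      rw [← hJ i]
      rcases eq_bot_or_zero_of_add_le (hle i k) hik.le with h | ⟨h, -⟩
      · have h' : orderMatrix P i (Y.orderEmbOfFin hY k) = ⊥ := h
        simp [zeroPart, hJ.eq_zero hP i _ h']
      · have h' : orderMatrix P i (Y.orderEmbOfFin hY k) = 0 := h
        simp [zeroPart, h']
    have h2 : (l (σ.symm k) : ℤ) - l i = 0 := by omega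
    rw [Matrix.of_apply, hexp, hpd, h2]
    simpa [colsIn] using h1

theorem isSaddleNumber_zero {hY : Y.card = s} (h : jacobiNumberOn A Y hY = 0) :
    IsSaddleNumber A 0 := by
  refine Or.inl ⟨⟨by simp, Y, hY, h.symm⟩, fun v hv => ?_⟩
  obtain ⟨a, rfl⟩ := WithBot.ne_bot_iff_exists.1 hv.1
  exact WithBot.coe_le_coe.2 (Nat.zero_le a)

theorem IsSaddleNumber.unique {v w : WithBot ℕ} (hv : IsSaddleNumber A v)
    (hw : IsSaddleNumber A w) : v = w := by
  rcases hv with hv | ⟨hv, rfl⟩ <;> rcases hw with hw | ⟨hw, rfl⟩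
  · exact hv.unique hw
  · have := hv.1; simp [hw] at this
  · have := hw.1; simp [hv] at this
  · rfl

/-- The sets of variables returned by `Ō-reg` have Jacobi number zero and a nonvanishing truncated
determinant. -/
theorem ORegRun.nablaNeZero (hJ : IsJacobianAt K P η J) (hP : ∀ i, (P i).DefinedAt η)
    {out : Option (Finset (Fin n))} {st : Stats}
    (h : ORegRun (orderMatrix P) J Finset.univ Finset.univ out st) (ho : out = some Y) :
    ∃ hY : Y.card = s, jacobiNumberOn (orderMatrix P) Y hY = 0 ∧ NablaNeZero P η Y hY := by
  obtain ⟨-, h1, h2, l, m, h3, h4⟩ := h.exists_potential (hJ.eq_zero hP) ho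
  have hY : Y.card = s := by simpa using h1
  have hdet := (det_colsIn_ne_zero_iff hY).2 h2
  obtain ⟨σ, hσ⟩ := exists_zero_of_det_ne_zero hY hdet
  have hO := jacobiNumberOn_eq_zero hY (fun i => h3 i (Finset.mem_univ i)) h4 hσ
  have hle : ∀ i, l i ≤ m (Y.orderEmbOfFin hY (σ i)) := by
    intro i
    have := h3 i (Finset.mem_univ i) _ (Finset.orderEmbOfFin_mem Y hY (σ i))
    have h0 : orderMatrix P i (Y.orderEmbOfFin hY (σ i)) = 0 := hσ i
    rw [h0, zero_add] at this
    exact WithBot.coe_le_coe.1 this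
  -- Equal sums make the inequalities along `σ` equalities, so `m` is `l` transported by `σ`, and
  -- the potentials amount to a canon.
  have heq := (Finset.sum_eq_sum_iff_of_le fun i _ => hle i).1 (by
    rw [← h4, ← sum_orderEmbOfFin hY m]
    exact (Equiv.sum_comp σ fun k => m (Y.orderEmbOfFin hY k)).symm)
  have hcanon : IsCanon (colsIn (orderMatrix P) Y hY) l := by
    refine (isCanon_iff hO hσ).2 fun i i' => ?_
    rw [heq i (Finset.mem_univ i)]
    exact h3 i' (Finset.mem_univ i') _ (Finset.orderEmbOfFin_mem Y hY (σ i))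
  obtain ⟨l', hl'⟩ := exists_isMinimalCanon hO hσ hcanon
  refine ⟨hY, hO, l', hl', ?_⟩
  rw [truncDet_eq hJ hP hY hσ ((isCanon_iff hO hσ).1 hl'.1)]
  exact_mod_cast hdet

/-- `Ō-reg` succeeds for the regular ō-systems. -/
theorem ORegRun.ne_none_of_isORegularAt (hJ : IsJacobianAt K P η J) (hP : ∀ i, (P i).DefinedAt η)
    {out : Option (Finset (Fin n))} {st : Stats}
    (h : ORegRun (orderMatrix P) J Finset.univ Finset.univ out st) (hreg : IsORegularAt P η) :
    out ≠ none := by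
  classical
  obtain ⟨h0, Y, hY, hOY, l, hl, hdet⟩ := hreg
  have hO : jacobiNumberOn (orderMatrix P) Y hY = 0 := hOY.unique h0
  obtain ⟨σ, hσ⟩ := exists_zero_of_jacobiNumber hO
  have hlc := (isCanon_iff hO hσ).1 hl.1
  rw [truncDet_eq hJ hP hY hσ hlc] at hdet
  -- A column of `Y` receives the potential of the row that `σ` matches with it; the values outside
  -- `Y` are irrelevant.
  obtain ⟨m, hm⟩ : ∃ m : Fin n → ℕ, ∀ k, m (Y.orderEmbOfFin hY k) = l (σ.symm k) := by
    refine ⟨Function.extend (Y.orderEmbOfFin hY) (fun k => l (σ.symm k)) 0, fun k => ?_⟩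
    exact (Y.orderEmbOfFin hY).injective.extend_apply _ _ _
  have hle : ∀ i k, orderMatrix P i (Y.orderEmbOfFin hY k) + (l i : WithBot ℕ) ≤
      m (Y.orderEmbOfFin hY k) := by
    intro i k
    have := hlc (σ.symm k) i
    rw [Equiv.apply_symm_apply] at this
    rw [hm]
    exact this
  -- `∇` is the determinant of the zero part, whereas the survival argument uses the tight part.
  -- They may differ only above the diagonal of the potentials, so their determinants agree.
  have htight : (colsIn (tightPart J l m) Y hY).det =
      (colsIn (zeroPart (orderMatrix P) J) Y hY).det := by
    refine det_eq_of_potential (l := l) (m := fun k => m (Y.orderEmbOfFin hY k)) ?_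
      (fun i k hik => ⟨if_neg hik.ne', if_neg fun h0 => ?_⟩) fun i k hik => ?_
    · simp only [hm]
      exact (Equiv.sum_comp σ.symm l).symm
    · have := hle i k
      have h1 : orderMatrix P i (Y.orderEmbOfFin hY k) = 0 := h0
      rw [h1, zero_add] at this
      exact absurd (WithBot.coe_le_coe.1 this) (not_le.2 hik)
    · refine (if_pos hik.symm).trans ?_
      rcases eq_bot_or_zero_of_add_le (hle i k) hik.le with h | ⟨h, -⟩
      · simp [colsIn, zeroPart, hJ.eq_zero hP i _ h]
      · simp [colsIn, zeroPart, h]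
  refine h.ne_none (hJ.eq_zero hP) (l := l) (m := m) (Finset.subset_univ Y) ?_
    ((det_colsIn_ne_zero_iff hY).1 ?_)
  · intro i _ j hj
    obtain ⟨k, rfl⟩ := exists_orderEmbOfFin hY hj
    exact hle i k
  · rw [htight]
    exact_mod_cast hdet

/-- Termination comes from the proof for the program, which constructs a run; that proof assumes `s,
n ≥ 1`, so the degenerate cases are treated by hand. -/
theorem exists_oRegRun {F : Type} [Field F] (A : Matrix (Fin s) (Fin n) (WithBot ℕ))
    (J : Matrix (Fin s) (Fin n) F) :
    ∃ out st, ORegRun A J Finset.univ Finset.univ out st := by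
  rcases Nat.eq_zero_or_pos s with rfl | hs
  · exact ⟨_, _, .nil _⟩
  rcases Nat.eq_zero_or_pos n with rfl | hn
  · exact ⟨_, _, .reject _ _ ⟨⟨0, hs⟩, Finset.mem_univ _⟩ (Or.inl (by simpa using hs))⟩
  · obtain ⟨out, st, -, h, -⟩ := wp_oregProgram (A := A) (J := J) hs hn
    exact ⟨out, st, h⟩

end System

end OReg

end

/-! ### The theorem -/

theorem mainTheorem7 :
    (∀ (K : Subfield ℝ) (s n : ℕ) (P : Fin s → OReg.DiffFun n) (η : OReg.Jet n)
        (J : Matrix (Fin s) (Fin n) K),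
      (∀ i, (P i).DefinedAt η) → OReg.IsJacobianAt K P η J →
        (∃ out st, OReg.ORegRun (OReg.orderMatrix P) J Finset.univ Finset.univ out st) ∧
        ∀ out st, OReg.ORegRun (OReg.orderMatrix P) J Finset.univ Finset.univ out st →
          (OReg.IsORegularAt P η →
            ∃ (Y : Finset (Fin n)) (hY : Y.card = s), out = some Y ∧
              OReg.jacobiNumberOn (OReg.orderMatrix P) Y hY = 0 ∧ OReg.NablaNeZero P η Y hY) ∧
          (¬ OReg.IsORegularAt P η → out = none)) ∧
    (∃ (prog : OReg.Cmd) (M : ℝ), OReg.ImplementsORegWithin prog (fun _ => True)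
      (fun s n st => M * (st.p * (st.q * (st.d : ℝ) ^ 2 + s) * n))) ∧
    (∃ (prog : OReg.Cmd) (M : ℝ), OReg.ImplementsORegWithin prog (fun st => st.q ≤ 1 ∧ st.c = 0)
      (fun s n st => M * (((st.d : ℝ) ^ 2 + s * Real.log (s + 1)) * n))) := by
  refine ⟨fun K s n P η J hP hJ => ⟨OReg.exists_oRegRun _ _, fun out st h => ⟨fun hreg => ?_,
    fun hreg => ?_⟩⟩, ⟨_, _, OReg.oregProgram_implements⟩, ⟨_, _, OReg.oregProgram_implements_log⟩⟩
  · obtain ⟨Y, hY⟩ := Option.ne_none_iff_exists'.1 (h.ne_none_of_isORegularAt hJ hP hreg)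
    obtain ⟨hcard, h1, h2⟩ := h.nablaNeZero hJ hP hY
    exact ⟨Y, hcard, hY, h1, h2⟩
  · by_contra hne
    obtain ⟨Y, hY⟩ := Option.ne_none_iff_exists'.1 hne
    obtain ⟨hcard, h1, h2⟩ := h.nablaNeZero hJ hP hY
    have h0 := OReg.isSaddleNumber_zero h1
    exact hreg ⟨h0, Y, hcard, h1.symm ▸ h0, h2⟩
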